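/- **Theorem (Dirac point).** *Setting.* Let $\Lambda=\mathbb Z\mathbf v_1\oplus\mathbb Z\mathbf v_2\subset\mathbb R^2$ with $\mathbf v_1=(\frac{\sqrt3}{2},\frac12)$, $\mathbf v_2=(\frac{\sqrt3}{2},-\frac12)$, let $\Omega=\{\theta_1\mathbf v_1+\theta_2\mathbf v_2:0\le\theta_j\le1\}$, let $\mathbf k_1,\mathbf k_2$ be the dual vectors, $\mathbf v_i\cdot\mathbf k_j=2\pi\delta_{ij}$, and write $\mathbf m\vec{\mathbf k}=m_1\mathbf k_1+m_2\mathbf k_2$ for $\mathbf m\in\mathbb Z^2$. Put $\mathbf K=\frac13(\mathbf k_1-\mathbf k_2)$, $\tau=e^{2\pi i/3}$, and let $R=\begin{pmatrix}-\frac12&\frac{\sqrt3}2\\-\frac{\sqrt3}2&-\frac12\end{pmatrix}$ be the clockwise rotation by $2\pi/3$, with transpose $R^*$. For $\mathbf k\in\mathbb R^2$ let $L^2_{\mathbf k}$ be the space of $\Phi\in L^2_{\mathrm{loc}}(\mathbb R^2,\mathbb C)$ with $\Phi(\mathbf y+\mathbf v)=e^{i\mathbf k\cdot\mathbf v}\Phi(\mathbf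 y)$ for all $\mathbf v\in\Lambda$, with $\langle\Phi,\Psi\rangle_\Omega=\int_\Omega\overline\Phi\,\Psi$; its elements have Fourier series $\Phi(\mathbf y)=\sum_{\mathbf m\in\mathbb Z^2}\hat\Phi(\mathbf k+\mathbf m\vec{\mathbf k})e^{i(\mathbf k+\mathbf m\vec{\mathbf k})\cdot\mathbf y}$ with $\hat\Phi(\mathbf k+\mathbf m\vec{\mathbf k})=\frac1{|\Omega|}\int_\Omega e^{-i(\mathbf k+\mathbf m\vec{\mathbf k})\cdot\mathbf y}\Phi(\mathbf y)\,d\mathbf y$. Let $H^\sigma_{\mathbf k}\subset L^2_{\mathbf k}$ be the corresponding Sobolev space, $\sum_{\mathbf m}(1+|\mathbf k+\mathbf m\vec{\mathbf k}|^2)^\sigma|\hat\Phi(\mathbf k+\mathbf m\vec{\mathbf k})|^2<\infty$. Let $1<\sigma\le2$ and let $V\in C^\infty(\mathbb R^2,\mathbb R)$ be a honeycomb potential: $V(-\mathbf y)=V(\mathbf y)$, $V(\mathbf y+\mathbf v)=V(\mathbf y)$ for $\mathbf v\in\Lambda$, and $V(R^*\mathbf y)=V(\mathbf y)$. Let $\mathcal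 H^\sigma=(-\Delta)^{\sigma/2}+V$ act on $L^2_{\mathbf k}$ with domain $H^\sigma_{\mathbf k}$, where $$(-\Delta)^{\sigma/2}\Phi(\mathbf y)=\sum_{\mathbf m}|\mathbf k+\mathbf m\vec{\mathbf k}|^\sigma\,\hat\Phi(\mathbf k+\mathbf m\vec{\mathbf k})\,e^{i(\mathbf k+\mathbf m\vec{\mathbf k})\cdot\mathbf y},$$ and let $E_1(\mathbf k)\le E_2(\mathbf k)\le\cdots$ be its eigenvalues, counted with multiplicity. For $\Phi\in H^\sigma_{\mathbf K}$ put $$\boldsymbol p^\sigma\Phi(\mathbf y)=i\sigma\sum_{\mathbf m}(\mathbf K+\mathbf m\vec{\mathbf k})\,|\mathbf K+\mathbf m\vec{\mathbf k}|^{\sigma-2}\,\hat\Phi(\mathbf K+\mathbf m\vec{\mathbf k})\,e^{i(\mathbf K+\mathbf m\vec{\mathbf k})\cdot\mathbf y}.$$ *Assumptions.* 1. There are $E_D\in\mathbb R$ and $b_*\ge1$ such that $E_{b_*}(\mathbf K)=E_{b_*+1}(\mathbf K)=E_D$, and $E_b(\mathbf K)\ne E_D$ for every $b\ge 1$ with $b\ne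 b_*,b_*+1$. 2. $\Phi_1\in L^2_{\mathbf K}$ is an eigenfunction of $\mathcal H^\sigma$ for $E_D$ with $\langle\Phi_1,\Phi_1\rangle_\Omega=1$ and $\Phi_1(R^*\mathbf y)=\tau\Phi_1(\mathbf y)$. 3. With $\Phi_2(\mathbf y)=\overline{\Phi_1(-\mathbf y)}$ and $a\cdot b=a_1b_1+a_2b_2$ on $\mathbb C^2$, the number $$v_F^\sigma=\tfrac12\,\overline{\langle\Phi_1,i\boldsymbol p^\sigma\Phi_2\rangle_\Omega}\cdot\begin{pmatrix}1\\ i\end{pmatrix}$$ is real and positive. *Conclusion.* There are constants $q_0>0$ and $C>0$ and real functions $e_{b_*},e_{b_*+1}$ such that, for all $\mathbf k\in\mathbb R^2$ with $|\mathbf k-\mathbf K|<q_0$, $$E_{b_*+1}(\mathbf k)-E_D=+v_F^\sigma|\mathbf k-\mathbf K|\,\bigl(1+e_{b_*+1}(\mathbf k-\mathbf K)\bigr),$$ $$E_{b_*}(\mathbf k)-E_D=-v_F^\sigma|\mathbf k-\mathbf K|\,\bigl(1+e_{b_*}(\mathbf k-\mathbf K)\bigr),$$ with $|e_{b_*}(\mathbf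 k-\mathbf K)|\le C|\mathbf k-\mathbf K|$ and $|e_{b_*+1}(\mathbf k-\mathbf K)|\le C|\mathbf k-\mathbf K|$; moreover $E_{b_*}(\mathbf k)<E_{b_*+1}(\mathbf k)$ if $\mathbf k\ne\mathbf K$. -/

import Mathlib

open MeasureTheory Filter Topology

open scoped Matrix ContDiff

namespace FracHoneycomb

noncomputable section

/-- The Euclidean plane. -/
abbrev Plane : Type := EuclideanSpace ℝ (Fin 2)

/-! ### The hexagonal lattice and its dual -/

/-- First generator of the hexagonal lattice. -/
def v₁ : Plane := !₂[√3 / 2, 1 / 2]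

/-- Second generator of the hexagonal lattice. -/
def v₂ : Plane := !₂[√3 / 2, -(1 / 2)]

/-- First generator of the dual lattice. -/
def k₁ : Plane := !₂[2 * Real.pi / √3, 2 * Real.pi]

/-- Second generator of the dual lattice. -/
def k₂ : Plane := !₂[2 * Real.pi / √3, -(2 * Real.pi)]

/-- The defining relations `vᵢ · kⱼ = 2π δᵢⱼ` of the dual generators. -/
theorem dual_relations :
    inner ℝ v₁ k₁ = 2 * Real.pi ∧ inner ℝ v₁ k₂ = 0 ∧
      inner ℝ v₂ k₁ = 0 ∧ inner ℝ v₂ k₂ = 2 * Real.pi := by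
  have h3 : √3 ≠ 0 := by positivity
  refine ⟨?_, ?_, ?_, ?_⟩ <;>
    simp only [v₁, v₂, k₁, k₂, PiLp.inner_apply, Fin.sum_univ_two] <;> simp <;> field_simp <;> ring

/-- The vector `n₁ v₁ + n₂ v₂` of the lattice `Λ`. -/
def latticeVec (n : Fin 2 → ℤ) : Plane := (n 0 : ℝ) • v₁ + (n 1 : ℝ) • v₂

/-- The vector `m₁ k₁ + m₂ k₂` of the dual lattice `Λ*`. -/
def dualVec (m : Fin 2 → ℤ) : Plane := (m 0 : ℝ) • k₁ + (m 1 : ℝ) • k₂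

/-- The fundamental cell `Ω = {θ₁ v₁ + θ₂ v₂ : 0 ≤ θⱼ ≤ 1}`. -/
def cell : Set Plane :=
  {y | ∃ s ∈ Set.Icc (0 : ℝ) 1, ∃ t ∈ Set.Icc (0 : ℝ) 1, y = s • v₁ + t • v₂}

/-- The high-symmetry quasi-momentum `K = (k₁ - k₂) / 3`. -/
def pointK : Plane := (1 / 3 : ℝ) • (k₁ - k₂)

/-! ### Rotation by `2π/3` and honeycomb potentials -/

/-- The matrix `R` of the clockwise rotation by `2π/3`. -/
def rotMatrix : Matrix (Fin 2) (Fin 2) ℝ := !![-(1 / 2), √3 / 2; -(√3 / 2), -(1 / 2)]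

/-- The map `y ↦ R* y`. -/
def rotStar (y : Plane) : Plane := WithLp.toLp 2 (rotMatrixᵀ *ᵥ y.ofLp)

/-- The cube root of unity `τ = exp (2πi/3)`. -/
def tau : ℂ := Complex.exp (Complex.I * (2 * Real.pi / 3))

/-- Honeycomb potentials: smooth, real-valued, even, `Λ`-periodic and invariant under rotation. -/
structure IsHoneycomb (V : Plane → ℝ) : Prop where
  smooth : ContDiff ℝ ∞ V
  even : ∀ y, V (-y) = V y
  periodic : ∀ (n : Fin 2 → ℤ) (y : Plane), V (y + latticeVec n) = V y
  rotation : ∀ y, V (rotStar y) = V y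

/-! ### Quasi-periodic functions and their Fourier series

Functions are identified when they agree almost everywhere; all notions below respect this. -/

/-- `f ∈ L²_k(ℝ²/Λ)`: `f(y + v) = e^{i k·v} f(y)` for every lattice vector `v`, and `f` is square
integrable on the cell (hence locally square integrable). -/
def MemL2 (k : Plane) (f : Plane → ℂ) : Prop :=
  MemLp f 2 (volume.restrict cell) ∧
    ∀ n : Fin 2 → ℤ, ∀ᵐ y : Plane,
      f (y + latticeVec n) = Complex.exp (Complex.I * (inner ℝ k (latticeVec n) : ℝ)) * f y

/-- The inner product `⟨f, g⟩_Ω`, conjugate linear in the first argument. -/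
def cellInner (f g : Plane → ℂ) : ℂ := ∫ y in cell, starRingEnd ℂ (f y) * g y

/-- The plane wave `y ↦ e^{i (k + m₁ k₁ + m₂ k₂)·y}`. -/
def planeWave (k : Plane) (m : Fin 2 → ℤ) (y : Plane) : ℂ :=
  Complex.exp (Complex.I * (inner ℝ (k + dualVec m) y : ℝ))

/-- The Fourier coefficient `|Ω|⁻¹ ∫_Ω e^{-i (k + m₁ k₁ + m₂ k₂)·y} f(y) dy`. -/
def fourierCoeffAt (k : Plane) (m : Fin 2 → ℤ) (f : Plane → ℂ) : ℂ :=
  ((volume.real cell : ℝ) : ℂ)⁻¹ *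
    ∫ y in cell, Complex.exp (-(Complex.I * (inner ℝ (k + dualVec m) y : ℝ))) * f y

/-- `f ∈ L²_k` is the sum of the series `∑ₘ cₘ e^{i (k + m₁ k₁ + m₂ k₂)·y}`, with convergence
in `L²(Ω)`. -/
def HasFourierSeries (k : Plane) (c : (Fin 2 → ℤ) → ℂ) (f : Plane → ℂ) : Prop :=
  MemL2 k f ∧
    Tendsto (fun s : Finset (Fin 2 → ℤ) =>
      eLpNorm (fun y => f y - ∑ m ∈ s, c m * planeWave k m y) 2 (volume.restrict cell))
      atTop (𝓝 0)

open Classical in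
/-- The sum in `L²_k` of `∑ₘ cₘ e^{i (k + m₁ k₁ + m₂ k₂)·y}`; it exists for square summable
coefficients and is unique up to a null set (the value is `0` if the series diverges). -/
def fourierSeries (k : Plane) (c : (Fin 2 → ℤ) → ℂ) : Plane → ℂ :=
  if h : ∃ f, HasFourierSeries k c f then h.choose else 0

/-- The Sobolev space `H^s_k(ℝ²/Λ)` of quasi-periodic functions. -/
def MemSobolev (s : ℝ) (k : Plane) (f : Plane → ℂ) : Prop :=
  MemL2 k f ∧
    Summable fun m : Fin 2 → ℤ => (1 + ‖k + dualVec m‖ ^ 2) ^ s * ‖fourierCoeffAt k m f‖ ^ 2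

/-! ### The fractional Schrödinger operator and its bands -/

/-- The fractional Laplacian `(-Δ)^{σ/2}` on `H^σ_k(ℝ²/Λ)`. -/
def fracLaplacian (σ : ℝ) (k : Plane) (f : Plane → ℂ) : Plane → ℂ :=
  fourierSeries k fun m => ((‖k + dualVec m‖ ^ σ : ℝ) : ℂ) * fourierCoeffAt k m f

/-- `f` is an eigenfunction of `(-Δ)^{σ/2} + V` on `L²_k(ℝ²/Λ)`, with domain `H^σ_k(ℝ²/Λ)`,
for the eigenvalue `E`. -/
def IsEigenfunction (σ : ℝ) (V : Plane → ℝ) (k : Plane) (E : ℝ) (f : Plane → ℂ) : Prop :=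
  MemSobolev σ k f ∧ (¬ f =ᵐ[volume] 0) ∧
    ∀ᵐ y : Plane, fracLaplacian σ k f y + (V y : ℂ) * f y = (E : ℂ) * f y

/-- The span, modulo null functions, of all eigenfunctions with eigenvalue at most `E`. -/
def eigenspaceUpTo (σ : ℝ) (V : Plane → ℝ) (k : Plane) (E : ℝ) :
    Submodule ℂ (Plane →ₘ[(volume : Measure Plane)] ℂ) :=
  Submodule.span ℂ {Φ | ∃ μ : ℝ, μ ≤ E ∧ IsEigenfunction σ V k μ Φ}

/-- The dispersion band `E_b(k)`, `b ≥ 1`: the `b`-th eigenvalue of `(-Δ)^{σ/2} + V` on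
`L²_k(ℝ²/Λ)`, in increasing order and counted with multiplicity, that is, the least `E` such that
at least `b` eigenvalues, counted with multiplicity, are `≤ E`. -/
def band (σ : ℝ) (V : Plane → ℝ) (b : ℕ) (k : Plane) : ℝ :=
  sInf {E : ℝ | (b : Cardinal) ≤ Module.rank ℂ (eigenspaceUpTo σ V k E)}

/-! ### The Fermi velocity -/

/-- The `j`-th component of the operator `p^σ` on `H^σ_K(ℝ²/Λ)`: it multiplies the Fourier
coefficient at `ξ = K + m₁ k₁ + m₂ k₂` by `i σ |ξ|^{σ-2} ξⱼ`. -/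
def momentum (σ : ℝ) (j : Fin 2) (f : Plane → ℂ) : Plane → ℂ :=
  fourierSeries pointK fun m =>
    Complex.I * ((σ * (‖pointK + dualVec m‖ ^ (σ - 2) * (pointK + dualVec m) j) : ℝ) : ℂ) *
      fourierCoeffAt pointK m f

/-- The function `y ↦ conj (f (-y))`. -/
def conjInv (f : Plane → ℂ) : Plane → ℂ := fun y => starRingEnd ℂ (f (-y))

/-- The number `½ conj ⟨Φ₁, i p^σ Φ₂⟩_Ω · (1, i)`, where `Φ₂(y) = conj (Φ₁(-y))` and the dot is
the bilinear product on `ℂ²`. -/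
def fermiVelocity (σ : ℝ) (Φ₁ : Plane → ℂ) : ℂ :=
  (1 / 2) * ∑ j : Fin 2,
    starRingEnd ℂ (cellInner Φ₁ fun y => Complex.I * momentum σ j (conjInv Φ₁) y) *
      (![1, Complex.I] : Fin 2 → ℂ) j

end

end FracHoneycomb

open FracHoneycomb

namespace FracHoneycomb

/-! ### Diagonal plus bounded operators on `ℓ²` -/

/-! Passing to Fourier coefficients turns the operator on `L²_k` into `d + V` on `ℓ²(ℤ²)`. Here `d`
is multiplication by the symbol `|k + m·k|^σ`, and `V` is a bounded symmetric operator that does not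
depend on `k`. Near `K`, with `κ = k - K`, the symbol changes by a linear term `ℓ` plus an error
`O(|κ|²)` that is uniform in `m`. The theorem is thus first order perturbation theory of a double
eigenvalue whose spectral gaps are known.

The symmetries determine the first order matrix on the eigenspace. With `Φ₁` rotating by `τ`, the
partner `Φ₂ = conj Φ₁(-·)` is an eigenfunction because `V` is real and even. It rotates by `conj τ`,
so it is orthogonal to `Φ₁`, and the two span the eigenspace. The symbol gradient rotates like a
vector, so reindexing the sums by the rotation multiplies some of them by a nontrivial cube root of
unity and forces them to vanish. The diagonal entries of `ℓ` vanish (`hasSum_symbolDeriv_normSq`).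
The off-diagonal entry, for normalized eigenfunctions, is `-(κ₁ + iκ₂) v_F`
(`hasSum_symbolDeriv_conj_sq`). The matrix therefore has eigenvalues `±v_F|κ|`.

The passage from matrix to bands uses min-max rather than a reduction to a finite determinant. In
the quadratic form, the coupling between the eigenspace and the rest of the spectrum is `O(|κ|)`.
The gap absorbs it at a cost of `O(|κ|²)` (`form_perturbation`). Trial spaces built from the lower
spectral subspace and the eigenvectors of the matrix then bound each band from both sides
(`exists_conical_bands`). Min-max itself rests on `le_form_of_mem_orthogonal`, which is derived from
a compact resolvent. -/

/-- Square summable complex sequences. -/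
abbrev SeqL2 (ι : Type*) : Type _ := lp (fun _ : ι => ℂ) 2

section SeqL2

variable {ι : Type*}

theorem SeqL2.hasSum_normSq (u : SeqL2 ι) : HasSum (fun m => ‖u m‖ ^ 2) (‖u‖ ^ 2) := by
  have h := lp.hasSum_norm (p := 2) (by norm_num) u
  simpa using h

theorem memℓp_two_iff {f : ι → ℂ} : Memℓp f 2 ↔ Summable fun m => ‖f m‖ ^ 2 := by
  rw [memℓp_gen_iff (by norm_num)]
  simp

theorem memℓp_two_of_le {f g : ι → ℂ} {C : ℝ} (hg : Memℓp g 2) (h : ∀ m, ‖f m‖ ≤ C * ‖g m‖) :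
    Memℓp f 2 := by
  rw [memℓp_two_iff] at hg ⊢
  refine Summable.of_nonneg_of_le (fun m => by positivity) (fun m => ?_) (hg.mul_left (C ^ 2))
  rw [← mul_pow]
  exact pow_le_pow_left₀ (norm_nonneg _) (h m) 2

/-- Multiplication of a square summable sequence by a bounded real one, as a linear map. -/
noncomputable def diagLin (a : ι → ℝ) (C : ℝ) (ha : ∀ m, |a m| ≤ C) : SeqL2 ι →ₗ[ℂ] SeqL2 ι where
  toFun u := ⟨fun m => (a m : ℂ) * u m, memℓp_two_of_le (C := C) (lp.memℓp u) fun m => by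
    rw [norm_mul, Complex.norm_real]
    exact mul_le_mul_of_nonneg_right (ha m) (norm_nonneg _)⟩
  map_add' u v := by
    ext m
    change (a m : ℂ) * (u m + v m) = a m * u m + a m * v m
    ring
  map_smul' c u := by
    ext m
    change (a m : ℂ) * (c * u m) = c * (a m * u m)
    ring

theorem diagLin_apply (a : ι → ℝ) (C : ℝ) (ha : ∀ m, |a m| ≤ C) (u : SeqL2 ι) (m : ι) :
    diagLin a C ha u m = (a m : ℂ) * u m := rfl

theorem norm_diagLin_le (a : ι → ℝ) (C : ℝ) (ha : ∀ m, |a m| ≤ C) (u : SeqL2 ι) :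
    ‖diagLin a C ha u‖ ≤ |C| * ‖u‖ := by
  have h := lp.norm_mono (p := 2) (by norm_num) (x := diagLin a C ha u)
    (y := ((|C| : ℝ) : ℂ) • u) (fun m => by
      rw [diagLin_apply, lp.coeFn_smul, Pi.smul_apply, smul_eq_mul, norm_mul, norm_mul,
        Complex.norm_real, Complex.norm_real]
      refine mul_le_mul_of_nonneg_right ?_ (norm_nonneg _)
      rw [Real.norm_eq_abs, Real.norm_eq_abs, abs_abs]
      exact (ha m).trans (le_abs_self _))
  refine h.trans ?_
  rw [norm_smul, Complex.norm_real, Real.norm_eq_abs, abs_abs]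

/-- Multiplication of a square summable sequence by a bounded real one. -/
noncomputable def diagOp (a : ι → ℝ) (C : ℝ) (ha : ∀ m, |a m| ≤ C) : SeqL2 ι →L[ℂ] SeqL2 ι :=
  (diagLin a C ha).mkContinuous |C| (norm_diagLin_le a C ha)

@[simp]
theorem diagOp_apply (a : ι → ℝ) (C : ℝ) (ha : ∀ m, |a m| ≤ C) (u : SeqL2 ι) (m : ι) :
    diagOp a C ha u m = (a m : ℂ) * u m := rfl

theorem norm_diagOp_le (a : ι → ℝ) (C : ℝ) (hC : 0 ≤ C) (ha : ∀ m, |a m| ≤ C) :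
    ‖diagOp a C ha‖ ≤ C := by
  have := LinearMap.mkContinuous_norm_le (diagLin a C ha) (abs_nonneg C) (norm_diagLin_le a C ha)
  exact this.trans_eq (abs_of_nonneg hC)

/-- The truncations of the multiplier to finite index sets have finite rank. They converge in
operator norm, since the norm of the remainder is at most the supremum of `|a|` off the set. -/
theorem isCompactOperator_diagOp (a : ι → ℝ) (C : ℝ) (ha : ∀ m, |a m| ≤ C)
    (h0 : Tendsto a cofinite (𝓝 0)) : IsCompactOperator (diagOp a C ha) := by
  classical
  let e : ι → SeqL2 ι := fun m => lp.single 2 m (1 : ℂ)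
  have he : ∀ m n, e m n = if n = m then 1 else 0 := fun m n => by
    rw [← Pi.single_apply]
    exact congrFun (lp.coeFn_single (E := fun _ : ι => ℂ) 2 m (1 : ℂ)) n
  let T : Finset ι → SeqL2 ι →L[ℂ] SeqL2 ι := fun s =>
    ∑ m ∈ s, (a m : ℂ) • ((lp.evalCLM ℂ (fun _ : ι => ℂ) 2 m).smulRight (e m))
  have hT : ∀ (s : Finset ι) (u : SeqL2 ι) (m : ι),
      T s u m = if m ∈ s then (a m : ℂ) * u m else 0 := by
    intro s u m
    have h1 : T s u = ∑ c ∈ s, (a c : ℂ) • (u c • e c) := by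
      simp only [T, _root_.sum_apply]
      rfl
    rw [h1, lp.coeFn_sum, Finset.sum_apply]
    simp only [lp.coeFn_smul, Pi.smul_apply, he]
    simp
  refine isCompactOperator_of_tendsto (F := T) (l := atTop) ?_ ?_
  · rw [Metric.tendsto_atTop]
    intro ε hε
    have hfin : {m | ¬ |a m| < ε / 2}.Finite := by
      have := h0.eventually (Metric.ball_mem_nhds (0 : ℝ) (half_pos hε))
      simpa using this
    refine ⟨hfin.toFinset, fun s hs => ?_⟩
    rw [dist_eq_norm]
    have hle : ∀ m, |(fun m => if m ∈ s then 0 else -a m) m| ≤ ε / 2 := by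
      intro m
      by_cases hm : m ∈ s
      · simpa [hm] using (half_pos hε).le
      · have : m ∉ hfin.toFinset := fun h => hm (hs h)
        simp only [Set.Finite.mem_toFinset, Set.mem_ofPred_eq, not_not] at this
        simp [hm, this.le]
    have heq : T s - diagOp a C ha = diagOp _ _ hle := by
      ext u m
      rw [_root_.sub_apply, lp.coeFn_sub, Pi.sub_apply, hT]
      simp only [diagOp_apply]
      split_ifs <;> simp
    rw [heq]
    exact (norm_diagOp_le _ _ (half_pos hε).le hle).trans_lt (half_lt_self hε)
  · refine Eventually.of_forall fun s => ?_
    have : T s ∈ compactOperator (RingHom.id ℂ) (SeqL2 ι) (SeqL2 ι) := by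
      refine Submodule.sum_mem _ fun m _ => Submodule.smul_mem _ _ ?_
      have h1 : IsCompactOperator (lp.evalCLM ℂ (fun _ : ι => ℂ) 2 m) :=
        isCompactOperator_of_locallyCompactSpace_dom _
      exact h1.clm_comp (ContinuousLinearMap.toSpanSingleton ℂ (e m))
    exact this

end SeqL2

end FracHoneycomb

namespace FracHoneycomb

/-! ### Symmetry and spectral subspaces of diagonal plus bounded operators -/

section HasImage

variable {ι : Type*} {d : ι → ℝ} {V : SeqL2 ι →L[ℂ] SeqL2 ι}

/-- `u` lies in the domain of the operator `d + V`, and this operator maps `u` to `w`. -/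
def HasImage (d : ι → ℝ) (V : SeqL2 ι →L[ℂ] SeqL2 ι) (u w : SeqL2 ι) : Prop :=
  ∀ m, (d m : ℂ) * u m + V u m = w m

namespace HasImage

variable {u u' w w' : SeqL2 ι}

theorem zero : HasImage d V 0 0 := fun m => by simp

theorem add (h : HasImage d V u w) (h' : HasImage d V u' w') :
    HasImage d V (u + u') (w + w') := fun m => by
  rw [map_add, lp.coeFn_add, lp.coeFn_add, lp.coeFn_add, Pi.add_apply, Pi.add_apply, Pi.add_apply,
    ← h m, ← h' m]
  ring

theorem smul (h : HasImage d V u w) (c : ℂ) : HasImage d V (c • u) (c • w) := fun m => by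
  rw [map_smul, lp.coeFn_smul, lp.coeFn_smul, lp.coeFn_smul, Pi.smul_apply, Pi.smul_apply,
    Pi.smul_apply, ← h m]
  simp only [smul_eq_mul]
  ring

theorem sub (h : HasImage d V u w) (h' : HasImage d V u' w') :
    HasImage d V (u - u') (w - w') := by
  have := h.add (h'.smul (-1))
  simpa [sub_eq_add_neg] using this

theorem sum {α : Type*} {s : Finset α} {f g : α → SeqL2 ι}
    (h : ∀ i ∈ s, HasImage d V (f i) (g i)) : HasImage d V (∑ i ∈ s, f i) (∑ i ∈ s, g i) := by
  classical
  induction s using Finset.induction_on with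
  | empty => simpa using zero
  | insert a s ha ih =>
    rw [Finset.sum_insert ha, Finset.sum_insert ha]
    exact (h a (Finset.mem_insert_self a s)).add
      (ih fun i hi => h i (Finset.mem_insert_of_mem hi))

theorem diag_eq (h : HasImage d V u w) (m : ι) : (d m : ℂ) * u m = (w - V u) m := by
  rw [lp.coeFn_sub, Pi.sub_apply, ← h m]
  ring

/-- The sequence `d u = w - V u` is square summable on the domain, so the form of the diagonal part
is an honest convergent series. All later form estimates are termwise comparisons of such series. -/
theorem hasSum_inner (h : HasImage d V u w) (u' : SeqL2 ι) :
    HasSum (fun m => (d m : ℂ) * (u m * starRingEnd ℂ (u' m))) (inner ℂ u' (w - V u)) := by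
  have := lp.hasSum_inner (𝕜 := ℂ) u' (w - V u)
  refine this.congr_fun fun m => ?_
  rw [← h.diag_eq, RCLike.inner_apply]
  ring

theorem hasSum_normSq (h : HasImage d V u w) :
    HasSum (fun m => d m * ‖u m‖ ^ 2) (inner ℂ u (w - V u)).re := by
  have := Complex.hasSum_re (h.hasSum_inner u)
  refine this.congr_fun fun m => ?_
  rw [Complex.mul_conj, ← Complex.ofReal_mul, Complex.ofReal_re, Complex.normSq_eq_norm_sq]

/-- Symmetry of `d + V` on its domain: the diagonal contributions to both sides are the same series
because `d` is real. -/
theorem inner_comm (hV : V.IsSymmetric) (h : HasImage d V u w) (h' : HasImage d V u' w') :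
    inner ℂ w' u = inner ℂ u' w := by
  have h1 := h.hasSum_inner u'
  have h2 := (h'.hasSum_inner u).star
  rw [Complex.star_def, inner_conj_symm] at h2
  have h3 : inner ℂ u' (w - V u) = inner ℂ (w' - V u') u := by
    refine h1.unique (h2.congr_fun fun m => ?_)
    simp only [map_mul, Complex.conj_ofReal, Complex.conj_conj]
    ring
  have h4 : inner ℂ (V u') u = inner ℂ u' (V u) := hV u' u
  rw [inner_sub_left, inner_sub_right, h4] at h3
  linear_combination -h3

theorem le_form {e : ℝ} (hd : ∀ m, e ≤ d m) (h : HasImage d V u w) :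
    (e - ‖V‖) * ‖u‖ ^ 2 ≤ (inner ℂ u w).re := by
  have h1 := hasSum_le (fun m => mul_le_mul_of_nonneg_right (hd m) (sq_nonneg _))
    (u.hasSum_normSq.mul_left e) h.hasSum_normSq
  have h2 : |(inner ℂ u (V u)).re| ≤ ‖V‖ * ‖u‖ ^ 2 := by
    refine (Complex.abs_re_le_norm _).trans ((norm_inner_le_norm _ _).trans ?_)
    nlinarith [V.le_opNorm u, norm_nonneg u]
  rw [inner_sub_right, Complex.sub_re] at h1
  have := (abs_le.1 h2).1
  linarith

end HasImage

/-- The eigenspace of `d + V` for the real number `μ`. -/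
noncomputable def eig (d : ι → ℝ) (V : SeqL2 ι →L[ℂ] SeqL2 ι) (μ : ℝ) : Submodule ℂ (SeqL2 ι) where
  carrier := {u | HasImage d V u ((μ : ℂ) • u)}
  zero_mem' := by
    change HasImage d V 0 ((μ : ℂ) • 0)
    rw [smul_zero]
    exact HasImage.zero
  add_mem' {u u'} h h' := by
    change HasImage d V (u + u') ((μ : ℂ) • (u + u'))
    rw [smul_add]
    exact HasImage.add h h'
  smul_mem' c u h := by
    have := HasImage.smul h c
    rwa [smul_comm] at this

theorem mem_eig {μ : ℝ} {u : SeqL2 ι} : u ∈ eig d V μ ↔ HasImage d V u ((μ : ℂ) • u) := Iff.rfl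

/-- The span of the eigenvectors of `d + V` with eigenvalue in `A`. -/
noncomputable def specOn (d : ι → ℝ) (V : SeqL2 ι →L[ℂ] SeqL2 ι) (A : Set ℝ) : Submodule ℂ (SeqL2 ι) :=
  ⨆ μ : A, eig d V μ

theorem eig_le_specOn {A : Set ℝ} {μ : ℝ} (hμ : μ ∈ A) : eig d V μ ≤ specOn d V A :=
  le_iSup (fun μ : A => eig d V μ) ⟨μ, hμ⟩

theorem specOn_le_iff {A : Set ℝ} {N : Submodule ℂ (SeqL2 ι)} :
    specOn d V A ≤ N ↔ ∀ μ ∈ A, eig d V μ ≤ N := by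
  rw [specOn, iSup_le_iff]
  exact ⟨fun h μ hμ => h ⟨μ, hμ⟩, fun h μ => h μ μ.2⟩

theorem specOn_mono {A B : Set ℝ} (h : A ⊆ B) : specOn d V A ≤ specOn d V B :=
  specOn_le_iff.2 fun _ hμ => eig_le_specOn (h hμ)

theorem specOn_eq_of_forall_eig_eq_bot {A B : Set ℝ} (h : A ⊆ B)
    (h' : ∀ μ ∈ B, μ ∉ A → eig d V μ = ⊥) : specOn d V B = specOn d V A := by
  refine le_antisymm (specOn_le_iff.2 fun μ hμ => ?_) (specOn_mono h)
  by_cases hA : μ ∈ A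
  · exact eig_le_specOn hA
  · rw [h' μ hμ hA]
    exact bot_le

theorem inner_eq_zero_of_mem_eig (hV : V.IsSymmetric) {μ ν : ℝ} (hne : μ ≠ ν) {u u' : SeqL2 ι}
    (hu : u ∈ eig d V μ) (hu' : u' ∈ eig d V ν) : inner ℂ u u' = 0 := by
  have h := HasImage.inner_comm hV hu' hu
  rw [inner_smul_left, inner_smul_right, Complex.conj_ofReal] at h
  have h2 : ((μ : ℂ) - ν) * inner ℂ u u' = 0 := by linear_combination h
  refine (mul_eq_zero.1 h2).resolve_left ?_
  exact sub_ne_zero.2 (by exact_mod_cast hne)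

/-- The quadratic form of `d + V` on a spectral subspace. -/
theorem exists_hasImage_of_mem_specOn (hV : V.IsSymmetric) {A : Set ℝ} {E : ℝ}
    (hA : ∀ μ ∈ A, μ ≤ E) {u : SeqL2 ι} (hu : u ∈ specOn d V A) :
    ∃ w ∈ specOn d V A, HasImage d V u w ∧ (inner ℂ u w).re ≤ E * ‖u‖ ^ 2 := by
  obtain ⟨f, hf, rfl⟩ := (Submodule.mem_iSup_iff_exists_finsupp _ _).1 hu
  refine ⟨f.sum fun μ x => ((μ : ℝ) : ℂ) • x, ?_, HasImage.sum fun μ _ => hf μ, ?_⟩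
  · exact Submodule.sum_mem _ fun μ _ =>
      Submodule.smul_mem _ _ (eig_le_specOn μ.2 (hf μ))
  -- Distinct eigenvalues have orthogonal eigenvectors, so the double sum collapses to its diagonal.
  -- The choice `c μ = μ` gives the form and `c = 1` gives the norm.
  · have key : ∀ c : A → ℝ, inner ℂ (∑ μ ∈ f.support, f μ) (∑ μ ∈ f.support, (c μ : ℂ) • f μ)
        = ((∑ μ ∈ f.support, c μ * ‖f μ‖ ^ 2 : ℝ) : ℂ) := by
      intro c
      rw [sum_inner, Complex.ofReal_sum]
      refine Finset.sum_congr rfl fun μ hμ => ?_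
      rw [inner_sum, Finset.sum_eq_single μ]
      · rw [inner_smul_right, inner_self_eq_norm_sq_to_K]
        simp
      · intro ν _ hne
        rw [inner_smul_right, inner_eq_zero_of_mem_eig hV
          (fun h => hne (Subtype.ext h.symm)) (hf μ) (hf ν), mul_zero]
      · exact fun h => absurd hμ h
    have h1 := key fun μ => μ
    have h2 := key fun _ => 1
    simp only [Complex.ofReal_one, one_smul] at h2
    simp only [one_mul] at h2
    have h2' : ‖∑ μ ∈ f.support, f μ‖ ^ 2 = ∑ μ ∈ f.support, ‖f μ‖ ^ 2 := by
      have := congrArg Complex.re h2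
      rw [Complex.ofReal_re] at this
      rw [← this]
      exact (inner_self_eq_norm_sq (𝕜 := ℂ) _).symm
    rw [Finsupp.sum, Finsupp.sum, h1, Complex.ofReal_re, h2', Finset.mul_sum]
    exact Finset.sum_le_sum fun μ _ => mul_le_mul_of_nonneg_right (hA μ μ.2) (sq_nonneg _)

/-- A vector of this space is determined by its finitely many coordinates with `d m ≤ E + ‖V‖`. If
these vanish, then `∑ (d m - E - ‖V‖) |u m|²` has nonnegative terms, while the bound on the form
makes it at most `0`. Hence `u = 0`. -/
theorem finiteDimensional_specOn (hV : V.IsSymmetric) (hd : Tendsto d cofinite atTop) (E : ℝ) :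
    FiniteDimensional ℂ (specOn d V (Set.Iic E)) := by
  have hfin : {m | ¬ E + ‖V‖ < d m}.Finite := by
    have := hd.eventually (eventually_gt_atTop (E + ‖V‖))
    simpa using this
  have := hfin.to_subtype
  let T : specOn d V (Set.Iic E) →ₗ[ℂ] ({m | ¬ E + ‖V‖ < d m} → ℂ) :=
    { toFun := fun u m => (u : SeqL2 ι) m
      map_add' := fun u v => rfl
      map_smul' := fun c u => rfl }
  refine FiniteDimensional.of_injective T ?_
  rw [← LinearMap.ker_eq_bot, LinearMap.ker_eq_bot']
  rintro ⟨u, hu⟩ h0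
  have hz : ∀ m, ¬ E + ‖V‖ < d m → u m = 0 := fun m hm => congrFun h0 ⟨m, hm⟩
  obtain ⟨w, -, hw, hle⟩ := exists_hasImage_of_mem_specOn hV (fun _ h => h) hu
  have h2 : |(inner ℂ u (V u)).re| ≤ ‖V‖ * ‖u‖ ^ 2 := by
    refine (Complex.abs_re_le_norm _).trans ((norm_inner_le_norm _ _).trans ?_)
    nlinarith [V.le_opNorm u, norm_nonneg u]
  have h3 := hw.hasSum_normSq
  rw [inner_sub_right, Complex.sub_re] at h3
  have h4 := h3.sub (u.hasSum_normSq.mul_left (E + ‖V‖))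
  have h5 : ∀ m, 0 ≤ d m * ‖u m‖ ^ 2 - (E + ‖V‖) * ‖u m‖ ^ 2 := by
    intro m
    by_cases hm : E + ‖V‖ < d m
    · rw [← sub_mul]
      exact mul_nonneg (sub_nonneg.2 hm.le) (sq_nonneg _)
    · simp [hz m hm]
  have h6 : (inner ℂ u w).re - (inner ℂ u (V u)).re - (E + ‖V‖) * ‖u‖ ^ 2 ≤ 0 := by
    have := (abs_le.1 h2).1
    linarith
  have h7 := (hasSum_zero_iff_of_nonneg h5).1 (by
    rwa [le_antisymm h6 (h4.nonneg h5)] at h4)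
  refine Subtype.ext (lp.ext (funext fun m => ?_))
  by_cases hm : E + ‖V‖ < d m
  · have := congrFun h7 m
    simp only [Pi.zero_apply, ← sub_mul] at this
    have h8 := (mul_eq_zero.1 this).resolve_left (sub_ne_zero.2 hm.ne')
    simpa using h8
  · exact hz m hm

/-- The spectrum below a bound is finite. -/
theorem finite_setOf_eig_ne_bot (hV : V.IsSymmetric) (hd : Tendsto d cofinite atTop) (E : ℝ) :
    {μ | μ ≤ E ∧ eig d V μ ≠ ⊥}.Finite := by
  set S : Set ℝ := {μ | μ ≤ E ∧ eig d V μ ≠ ⊥} with hS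
  have hfd := finiteDimensional_specOn hV hd E
  -- One nonzero eigenvector per eigenvalue gives an orthogonal, hence independent, family in a
  -- finite dimensional space.
  have hex : ∀ μ : S, ∃ u : specOn d V (Set.Iic E), (u : SeqL2 ι) ∈ eig d V μ ∧ u ≠ 0 := by
    intro μ
    obtain ⟨u, hu, hu0⟩ := (Submodule.ne_bot_iff _).1 μ.2.2
    have hle : eig d V μ ≤ specOn d V (Set.Iic E) := eig_le_specOn (Set.mem_Iic.2 μ.2.1)
    exact ⟨⟨u, hle hu⟩, hu, fun h => hu0 ((Submodule.mk_eq_zero _ _).1 h)⟩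
  choose f hf hf0 using hex
  have hg : LinearIndependent ℂ f :=
    linearIndependent_of_ne_zero_of_inner_eq_zero (𝕜 := ℂ) hf0 fun μ ν hne =>
      inner_eq_zero_of_mem_eig hV (fun h => hne (Subtype.ext h)) (hf μ) (hf ν)
  have : Finite S := LinearIndependent.finite_of_isNoetherian hg
  exact S.toFinite

/-- Spectral gaps around a given energy. -/
theorem exists_spectral_gap (hV : V.IsSymmetric) (hd : Tendsto d cofinite atTop) (E : ℝ) :
    ∃ δ > 0, specOn d V (Set.Iic (E + δ)) = specOn d V (Set.Iic E) ∧
      specOn d V (Set.Iio E) = specOn d V (Set.Iic (E - δ)) := by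
  -- The cutoff `E + 1` only makes the set of competing eigenvalues finite, so that its complement
  -- is a neighbourhood of `E`.
  have hfin := (finite_setOf_eig_ne_bot hV hd (E + 1)).subset
    (show {μ | (μ ≤ E + 1 ∧ eig d V μ ≠ ⊥) ∧ μ ≠ E} ⊆ _ from fun μ h => h.1)
  have hnhds : {μ | (μ ≤ E + 1 ∧ eig d V μ ≠ ⊥) ∧ μ ≠ E}ᶜ ∈ 𝓝 E :=
    hfin.isClosed.isOpen_compl.mem_nhds (by simp)
  obtain ⟨ε, hε, hball⟩ := Metric.mem_nhds_iff.1 hnhds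
  have key : ∀ μ, |μ - E| < min ε 1 → μ ≠ E → eig d V μ = ⊥ := by
    intro μ hμ hne
    by_contra h
    have h1 : μ ∈ Metric.ball E ε := by
      rw [Metric.mem_ball, Real.dist_eq]
      exact hμ.trans_le (min_le_left _ _)
    refine hball h1 ⟨⟨?_, h⟩, hne⟩
    have := (abs_lt.1 (hμ.trans_le (min_le_right _ _))).2
    linarith
  have hpos : 0 < min ε 1 := lt_min hε one_pos
  refine ⟨min ε 1 / 2, half_pos hpos, specOn_eq_of_forall_eig_eq_bot ?_ ?_,
    specOn_eq_of_forall_eig_eq_bot ?_ ?_⟩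
  · exact Set.Iic_subset_Iic.2 (by linarith)
  · intro μ h1 h2
    rw [Set.mem_Iic] at h1 h2
    refine key μ ?_ (by linarith)
    rw [abs_lt]
    constructor <;> linarith
  · exact Set.Iic_subset_Iio.2 (by linarith)
  · intro μ h1 h2
    rw [Set.mem_Iio] at h1
    rw [Set.mem_Iic] at h2
    refine key μ ?_ (by linarith)
    rw [abs_lt]
    constructor <;> linarith

end HasImage

end FracHoneycomb

namespace FracHoneycomb

/-! ### Compact resolvent and the form above a spectral subspace -/

section Resolvent

variable {ι : Type*} {d : ι → ℝ} {V : SeqL2 ι →L[ℂ] SeqL2 ι}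

/-- The operator `d + V + c` has a compact inverse for large `c`. -/
theorem exists_resolvent (V : SeqL2 ι →L[ℂ] SeqL2 ι) (hd : Tendsto d cofinite atTop) {c : ℝ}
    (hc : ∀ m, 2 * (‖V‖ + 1) ≤ d m + c) :
    ∃ G : SeqL2 ι →L[ℂ] SeqL2 ι, IsCompactOperator G ∧
      ∀ f, HasImage d V (G f) (f - (c : ℂ) • G f) := by
  have hpos : 0 < 2 * (‖V‖ + 1) := by positivity
  have hdc : ∀ m, 0 < d m + c := fun m => hpos.trans_le (hc m)
  have ha : ∀ m, |(d m + c)⁻¹| ≤ (2 * (‖V‖ + 1))⁻¹ := fun m => by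
    rw [abs_of_pos (inv_pos.2 (hdc m))]
    exact inv_anti₀ hpos (hc m)
  have h0 : Tendsto (fun m => (d m + c)⁻¹) cofinite (𝓝 0) :=
    tendsto_inv_atTop_zero.comp (tendsto_atTop_add_const_right _ c hd)
  -- With `A = (d + c)⁻¹` one has `d + V + c = (1 + V A)(d + c)`. The bound on `c` makes `‖V A‖ <
  -- 1`, so a Neumann series inverts the first factor and `G = A (1 + V A)⁻¹`. It is compact because
  -- `A` is.
  set A := diagOp (fun m => (d m + c)⁻¹) _ ha with hA
  have hT : ‖-(V.comp A)‖ < 1 := by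
    rw [norm_neg]
    refine (ContinuousLinearMap.opNorm_comp_le _ _).trans_lt ?_
    have h1 : ‖A‖ ≤ (2 * (‖V‖ + 1))⁻¹ := norm_diagOp_le _ _ (inv_pos.2 hpos).le ha
    refine (mul_le_mul_of_nonneg_left h1 (norm_nonneg _)).trans_lt ?_
    rw [← div_eq_mul_inv, div_lt_one hpos]
    linarith [norm_nonneg V]
  let U := Units.oneSub (-(V.comp A)) hT
  refine ⟨A.comp (↑U⁻¹ : SeqL2 ι →L[ℂ] SeqL2 ι),
    (isCompactOperator_diagOp _ _ ha h0).comp_clm _, fun f => ?_⟩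
  set g := (↑U⁻¹ : SeqL2 ι →L[ℂ] SeqL2 ι) f with hg
  have hUg : g + V (A g) = f := by
    have h1 : ((U : SeqL2 ι →L[ℂ] SeqL2 ι) * ↑U⁻¹) f = f := by rw [Units.mul_inv]; rfl
    have h2 : (U : SeqL2 ι →L[ℂ] SeqL2 ι) g = g - -(V (A g)) := rfl
    rw [sub_neg_eq_add] at h2
    rw [← h2]
    exact h1
  intro m
  change (d m : ℂ) * A g m + V (A g) m = (f - (c : ℂ) • A g) m
  rw [← hUg, lp.coeFn_sub, lp.coeFn_add, lp.coeFn_smul, Pi.sub_apply, Pi.add_apply, Pi.smul_apply,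
    hA, diagOp_apply, smul_eq_mul]
  have h3 : ((d m : ℂ) + c) ≠ 0 := by exact_mod_cast (hdc m).ne'
  push_cast
  field_simp
  ring

theorem exists_forall_le_of_tendsto_cofinite (hd : Tendsto d cofinite atTop) :
    ∃ e, ∀ m, e ≤ d m := by
  have hfin : {m | ¬ 0 ≤ d m}.Finite := by
    have := hd.eventually (eventually_ge_atTop 0)
    simpa using this
  obtain ⟨b, hb⟩ := (hfin.image d).bddBelow
  refine ⟨min b 0, fun m => ?_⟩
  by_cases hm : 0 ≤ d m
  · exact (min_le_right _ _).trans hm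
  · exact (min_le_left _ _).trans (hb ⟨m, hm, rfl⟩)

/-- On the orthogonal complement of the eigenvectors with eigenvalue at most `E`, the quadratic
form of `d + V` is bounded below by `E`. -/
theorem le_form_of_mem_orthogonal (hV : V.IsSymmetric) (hd : Tendsto d cofinite atTop) {E : ℝ}
    {u w : SeqL2 ι} (h : HasImage d V u w) (hu : u ∈ (specOn d V (Set.Iic E))ᗮ) :
    E * ‖u‖ ^ 2 ≤ (inner ℂ u w).re := by
  obtain ⟨e, he⟩ := exists_forall_le_of_tendsto_cofinite hd
  -- The shift must be large enough for the resolvent to exist and for `E + c` to be invertible and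
  -- positive.
  obtain ⟨c, hc1, hc2⟩ : ∃ c : ℝ, 2 * (‖V‖ + 1) ≤ e + c ∧ 0 < E + c :=
    ⟨max (2 * (‖V‖ + 1) - e) (1 - E), by linarith [le_max_left (2 * (‖V‖ + 1) - e) (1 - E)],
      by linarith [le_max_right (2 * (‖V‖ + 1) - e) (1 - E)]⟩
  obtain ⟨G, hGc, hG⟩ := exists_resolvent V hd (c := c) fun m => hc1.trans (by linarith [he m])
  have hVn := norm_nonneg V
  have normsq : ∀ x : SeqL2 ι, (inner ℂ x x).re = ‖x‖ ^ 2 := fun x =>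
    inner_self_eq_norm_sq (𝕜 := ℂ) x
  have hGsymm : ∀ f f', inner ℂ (G f) f' = inner ℂ f (G f') := fun f f' => by
    have := HasImage.inner_comm hV (hG f') (hG f)
    rw [inner_sub_left, inner_sub_right, inner_smul_left, inner_smul_right,
      Complex.conj_ofReal] at this
    linear_combination -this
  -- The choice of `c` gives `d + V + c ≥ 1` as a form, so `G` is positive.
  have hGpos : ∀ f, ‖G f‖ ^ 2 ≤ (inner ℂ (G f) f).re := fun f => by
    have := HasImage.le_form he (hG f)
    rw [inner_sub_right, inner_smul_right, Complex.sub_re, Complex.re_ofReal_mul, normsq] at this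
    nlinarith [sq_nonneg ‖G f‖]
  -- `G` is also a left inverse: the difference `z` of two preimages satisfies `(d + V) z = -c z`,
  -- which strict positivity of `d + V + c` rules out unless `z = 0`.
  have hGinv : ∀ {u w}, HasImage d V u w → u = G (w + (c : ℂ) • u) := fun {u w} h => by
    have h1 := h.sub (hG (w + (c : ℂ) • u))
    set z := u - G (w + (c : ℂ) • u) with hz
    have h2 : w - (w + (c : ℂ) • u - (c : ℂ) • G (w + (c : ℂ) • u)) = ((-c : ℝ) : ℂ) • z := by
      rw [hz]
      push_cast
      module
    rw [h2] at h1
    have h3 := HasImage.le_form he h1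
    rw [inner_smul_right, Complex.re_ofReal_mul, normsq] at h3
    have h4 : ‖z‖ ^ 2 ≤ 0 := by nlinarith [sq_nonneg ‖z‖]
    have h5 : z = 0 := by
      have : ‖z‖ = 0 := by nlinarith [norm_nonneg z]
      exact norm_eq_zero.1 this
    exact sub_eq_zero.1 h5
  set S := specOn d V (Set.Iic E) with hS
  have hGS : ∀ φ ∈ S, G φ ∈ S := by
    have : S ≤ S.comap (G : SeqL2 ι →ₗ[ℂ] SeqL2 ι) := by
      refine specOn_le_iff.2 fun μ hμ φ hφ => ?_
      have h1 := hGinv (mem_eig.1 hφ)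
      rw [← add_smul, map_smul] at h1
      change G φ ∈ S
      by_cases hz : (μ : ℂ) + c = 0
      · rw [hz, zero_smul] at h1
        rw [h1, map_zero]
        exact S.zero_mem
      · have h2 : G φ = ((μ : ℂ) + c)⁻¹ • φ := by
          rw [eq_inv_smul_iff₀ hz]
          exact h1.symm
        rw [h2]
        exact S.smul_mem _ (eig_le_specOn hμ hφ)
    exact this
  have hinv : ∀ f ∈ Sᗮ, G f ∈ Sᗮ := fun f hf φ hφ => by
    rw [← hGsymm]
    exact hf _ (hGS φ hφ)
  let GT : Sᗮ →L[ℂ] Sᗮ := G.restrict hinv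
  have hGTc : IsCompactOperator GT := hGc.restrict' (f := (G : SeqL2 ι →ₗ[ℂ] SeqL2 ι)) hinv
  have hGTs : (GT : Sᗮ →ₗ[ℂ] Sᗮ).IsSymmetric := fun f f' => hGsymm f f'
  -- `G` preserves `S` and is symmetric, so it restricts to a compact self-adjoint operator on `Sᗮ`,
  -- whose norm is its spectral radius. A nonzero spectral value is an eigenvalue `r > 0`, and it
  -- yields the eigenvalue `r⁻¹ - c` of `d + V` with an eigenvector in `Sᗮ`. Then `r⁻¹ - c > E`,
  -- since otherwise the eigenvector would lie in `S` as well.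
  have hnorm : ‖GT‖ ≤ (E + c)⁻¹ := by
    have hrad := GT.spectralRadius_eq_nnnorm hGTs.isSelfAdjoint
    have hle : spectralRadius ℂ GT ≤ ENNReal.ofReal (E + c)⁻¹ := by
      refine iSup₂_le fun k hk => ?_
      rw [← enorm_eq_nnnorm, ← ofReal_norm]
      refine ENNReal.ofReal_le_ofReal ?_
      by_cases hk0 : k = 0
      · rw [hk0, norm_zero]
        exact (inv_pos.2 hc2).le
      have hev := (hGTc.hasEigenvalue_iff_mem_spectrum hk0).2 hk
      obtain ⟨x, hx, hx0⟩ := hev.exists_hasEigenvector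
      have hreal := hGTs.conj_eigenvalue_eq_self hev
      obtain ⟨r, rfl⟩ := Complex.conj_eq_iff_real.1 hreal
      rw [Module.End.mem_eigenspace_iff] at hx
      have hx' : G x = (r : ℂ) • (x : SeqL2 ι) := congrArg (fun y : Sᗮ => (y : SeqL2 ι)) hx
      have hxne : (x : SeqL2 ι) ≠ 0 := fun h => hx0 (Subtype.ext h)
      have hr0 : r ≠ 0 := fun h => hk0 (by rw [h]; rfl)
      have hxpos : 0 < ‖(x : SeqL2 ι)‖ ^ 2 := by positivity
      have hr : 0 < r := by
        have h1 := (sq_nonneg _).trans (hGpos x)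
        rw [hx', inner_smul_left, Complex.conj_ofReal, Complex.re_ofReal_mul, normsq] at h1
        exact lt_of_le_of_ne (nonneg_of_mul_nonneg_left h1 hxpos) hr0.symm
      rw [Complex.norm_real, Real.norm_of_nonneg hr.le]
      have him : HasImage d V x (((r⁻¹ - c : ℝ) : ℂ) • (x : SeqL2 ι)) := by
        have h1 := (hG x).smul (r⁻¹ : ℂ)
        have hrc : (r : ℂ) ≠ 0 := by exact_mod_cast hr0
        rw [hx', smul_smul, inv_mul_cancel₀ hrc, one_smul] at h1
        convert h1 using 1
        rw [smul_sub, smul_smul, smul_smul]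
        push_cast
        rw [mul_right_comm, inv_mul_cancel₀ hrc, one_mul, sub_smul]
      have hlt : E < r⁻¹ - c := by
        by_contra hle
        have hmem : (x : SeqL2 ι) ∈ S := eig_le_specOn (Set.mem_Iic.2 (not_lt.1 hle)) (mem_eig.2 him)
        have := x.2 _ hmem
        exact hxne (inner_self_eq_zero.1 this)
      rw [le_inv_comm₀ hr hc2]
      linarith
    rw [hrad] at hle
    have := ENNReal.toReal_mono ENNReal.ofReal_ne_top hle
    rwa [ENNReal.toReal_ofReal (inv_pos.2 hc2).le] at this
  have hGle : ∀ f ∈ Sᗮ, ‖G f‖ ≤ (E + c)⁻¹ * ‖f‖ := fun f hf => by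
    have h1 := GT.le_opNorm ⟨f, hf⟩
    exact h1.trans (mul_le_mul_of_nonneg_right hnorm (norm_nonneg _))
  -- Positivity of `G` is applied to `f - (E + c) G f`. The norm bound on `Sᗮ` controls the
  -- quadratic term of the expansion. With `f = w + c u` and `G f = u` this becomes the claim.
  have hform : ∀ f ∈ Sᗮ, (E + c) * ‖G f‖ ^ 2 ≤ (inner ℂ (G f) f).re := fun f hf => by
    have h1 := (sq_nonneg _).trans (hGpos (f - ((E + c : ℝ) : ℂ) • G f))
    have h2 : (inner ℂ (G (f - ((E + c : ℝ) : ℂ) • G f)) (f - ((E + c : ℝ) : ℂ) • G f)).re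
        = (inner ℂ (G f) f).re - 2 * (E + c) * ‖G f‖ ^ 2
          + (E + c) ^ 2 * (inner ℂ (G (G f)) (G f)).re := by
      rw [map_sub, map_smul, inner_sub_left, inner_sub_right, inner_sub_right, inner_smul_left,
        inner_smul_right, inner_smul_right, inner_smul_left, Complex.conj_ofReal,
        hGsymm (G f) f]
      simp only [Complex.sub_re, Complex.re_ofReal_mul, normsq]
      ring
    have h3 : (inner ℂ (G (G f)) (G f)).re ≤ (E + c)⁻¹ * ‖G f‖ ^ 2 := by
      refine (Complex.re_le_norm _).trans ((norm_inner_le_norm _ _).trans ?_)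
      have := hGle (G f) (hinv f hf)
      nlinarith [norm_nonneg (G f)]
    have h4 : (E + c) ^ 2 * (inner ℂ (G (G f)) (G f)).re ≤ (E + c) * ‖G f‖ ^ 2 := by
      refine (mul_le_mul_of_nonneg_left h3 (sq_nonneg _)).trans (le_of_eq ?_)
      field_simp
    rw [h2] at h1
    linarith
  have hf : w + (c : ℂ) • u ∈ Sᗮ := by
    refine Submodule.add_mem _ ?_ (Submodule.smul_mem _ _ hu)
    have hle : S ≤ (ℂ ∙ w)ᗮ := specOn_le_iff.2 fun μ hμ φ hφ => by
      rw [Submodule.mem_orthogonal_singleton_iff_inner_left]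
      have h1 := HasImage.inner_comm hV h (mem_eig.1 hφ)
      rw [← h1, inner_smul_left, hu φ (eig_le_specOn hμ hφ), mul_zero]
    intro φ hφ
    exact Submodule.mem_orthogonal_singleton_iff_inner_left.1 (hle hφ)
  have h1 := hform _ hf
  rw [← hGinv h, inner_add_right, inner_smul_right, Complex.add_re, Complex.re_ofReal_mul,
    normsq] at h1
  linarith

end Resolvent

/-! ### The min-max principle -/

section MinMax

variable {ι : Type*} {d : ι → ℝ} {V : SeqL2 ι →L[ℂ] SeqL2 ι}

/-- Dimension count: the orthogonal projection from `W` to the smaller space `N` has a kernel. -/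
theorem exists_mem_orthogonal_ne_zero {W N : Submodule ℂ (SeqL2 ι)} [FiniteDimensional ℂ W]
    [FiniteDimensional ℂ N] (h : Module.finrank ℂ N < Module.finrank ℂ W) :
    ∃ u ∈ W, u ∈ Nᗮ ∧ u ≠ 0 := by
  let T : W →ₗ[ℂ] N := (N.orthogonalProjectionOnto : SeqL2 ι →ₗ[ℂ] N).comp W.subtype
  obtain ⟨u, hu, hu0⟩ := (Submodule.ne_bot_iff _).1 (LinearMap.ker_ne_bot_of_finrank_lt (f := T) h)
  refine ⟨u, u.2, ?_, fun h => hu0 (Subtype.ext h)⟩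
  exact Submodule.orthogonalProjectionOnto_eq_zero_iff.1 (LinearMap.mem_ker.1 hu)

/-- Upper half of the min-max principle. -/
theorem le_finrank_specOn_of_form_le (hV : V.IsSymmetric) (hd : Tendsto d cofinite atTop) {E : ℝ}
    (W : Submodule ℂ (SeqL2 ι)) [FiniteDimensional ℂ W]
    (hW : ∀ u ∈ W, ∃ w, HasImage d V u w ∧ (inner ℂ u w).re ≤ E * ‖u‖ ^ 2) :
    Module.finrank ℂ W ≤ Module.finrank ℂ (specOn d V (Set.Iic E)) := by
  by_contra! hlt
  have := finiteDimensional_specOn hV hd E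
  obtain ⟨u, huW, hu, hu0⟩ := exists_mem_orthogonal_ne_zero hlt
  obtain ⟨w, hw, hle⟩ := hW u huW
  -- The lower bound `E` on the complement would not contradict the upper bound `E`. The gap shows
  -- that the same complement satisfies the bound `E + δ`.
  obtain ⟨δ, hδ, hgap, -⟩ := exists_spectral_gap hV hd E
  rw [← hgap] at hu
  have h1 := le_form_of_mem_orthogonal hV hd hw hu
  have h2 : 0 < ‖u‖ := norm_pos_iff.2 hu0
  nlinarith [mul_pos hδ (pow_pos h2 2)]

/-- Lower half of the min-max principle. -/
theorem finrank_specOn_le_of_le_form (hV : V.IsSymmetric) (hd : Tendsto d cofinite atTop)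
    {E E' : ℝ} (hE : E' < E) (N : Submodule ℂ (SeqL2 ι)) [FiniteDimensional ℂ N]
    (hN : ∀ u ∈ Nᗮ, ∀ w, HasImage d V u w → E * ‖u‖ ^ 2 ≤ (inner ℂ u w).re) :
    Module.finrank ℂ (specOn d V (Set.Iic E')) ≤ Module.finrank ℂ N := by
  by_contra! hlt
  have := finiteDimensional_specOn hV hd E'
  obtain ⟨u, huS, hu, hu0⟩ := exists_mem_orthogonal_ne_zero hlt
  obtain ⟨w, -, hw, hle⟩ := exists_hasImage_of_mem_specOn hV (fun _ h => h) huS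
  have h1 := hN u hu w hw
  have h2 : 0 < ‖u‖ := norm_pos_iff.2 hu0
  nlinarith [mul_pos (sub_pos.2 hE) (pow_pos h2 2)]

/-- The `b`-th eigenvalue of `d + V`, counted with multiplicity. -/
noncomputable def seqBand (d : ι → ℝ) (V : SeqL2 ι →L[ℂ] SeqL2 ι) (b : ℕ) : ℝ :=
  sInf {E | b ≤ Module.finrank ℂ (specOn d V (Set.Iic E))}

/-- No spectrum lies below `e - ‖V‖`, where `e` bounds `d` from below. The condition `1 ≤ b`
matters, because for `b = 0` the set is the whole line. -/
theorem bddBelow_setOf_le_finrank (hV : V.IsSymmetric) (hd : Tendsto d cofinite atTop) {b : ℕ}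
    (hb : 1 ≤ b) : BddBelow {E | b ≤ Module.finrank ℂ (specOn d V (Set.Iic E))} := by
  obtain ⟨e, he⟩ := exists_forall_le_of_tendsto_cofinite hd
  refine ⟨e - ‖V‖, fun E hE => ?_⟩
  by_contra! hlt
  have h1 := finrank_specOn_le_of_le_form hV hd hlt ⊥ fun u _ w hw => HasImage.le_form he hw
  rw [finrank_bot] at h1
  have h2 : b ≤ Module.finrank ℂ (specOn d V (Set.Iic E)) := hE
  omega

theorem seqBand_le (hV : V.IsSymmetric) (hd : Tendsto d cofinite atTop) {b : ℕ} (hb : 1 ≤ b)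
    {E : ℝ} (h : b ≤ Module.finrank ℂ (specOn d V (Set.Iic E))) : seqBand d V b ≤ E :=
  csInf_le (bddBelow_setOf_le_finrank hV hd hb) h

/-- Bands lie below the largest value of the form on a trial space. -/
theorem seqBand_le_of_form_le (hV : V.IsSymmetric) (hd : Tendsto d cofinite atTop) {b : ℕ}
    (hb : 1 ≤ b) {E : ℝ} (W : Submodule ℂ (SeqL2 ι)) [FiniteDimensional ℂ W]
    (hbW : b ≤ Module.finrank ℂ W)
    (hW : ∀ u ∈ W, ∃ w, HasImage d V u w ∧ (inner ℂ u w).re ≤ E * ‖u‖ ^ 2) :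
    b ≤ Module.finrank ℂ (specOn d V (Set.Iic E)) ∧ seqBand d V b ≤ E := by
  have h := hbW.trans (le_finrank_specOn_of_form_le hV hd W hW)
  exact ⟨h, seqBand_le hV hd hb h⟩

/-- Bands lie above the smallest value of the form on a space of small codimension. -/
theorem le_seqBand_of_le_form (hV : V.IsSymmetric) (hd : Tendsto d cofinite atTop) {b : ℕ}
    {E E₁ : ℝ} (hne : b ≤ Module.finrank ℂ (specOn d V (Set.Iic E₁)))
    (N : Submodule ℂ (SeqL2 ι)) [FiniteDimensional ℂ N] (hbN : Module.finrank ℂ N < b)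
    (hN : ∀ u ∈ Nᗮ, ∀ w, HasImage d V u w → E * ‖u‖ ^ 2 ≤ (inner ℂ u w).re) :
    E ≤ seqBand d V b := by
  -- The energy `E₁` serves only to make the set nonempty; the real infimum of the empty set is `0`
  -- by convention.
  refine le_csInf ⟨E₁, hne⟩ fun E' hE' => ?_
  by_contra! hlt
  have h1 := finrank_specOn_le_of_le_form hV hd hlt N hN
  have h2 : b ≤ Module.finrank ℂ (specOn d V (Set.Iic E')) := hE'
  omega

end MinMax

end FracHoneycomb

namespace FracHoneycomb

/-! ### Perturbation of the quadratic form -/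

section Perturbation

variable {ι : Type*} {d d' ℓ : ι → ℝ} {V : SeqL2 ι →L[ℂ] SeqL2 ι}

/-- If `|d'|` is bounded by `A |d| + B`, then `d' u` is square summable whenever `d u` is. Used in
both directions, this gives the operators at `K` and at nearby `k` the same domain. -/
theorem HasImage.exists_of_le {u w : SeqL2 ι} (h : HasImage d V u w) {A B : ℝ}
    (hd : ∀ m, |d' m| ≤ A * |d m| + B) : ∃ w', HasImage d' V u w' := by
  have hmem : Memℓp (fun m => (d' m : ℂ) * u m) 2 := by
    rw [memℓp_two_iff]
    refine Summable.of_nonneg_of_le (fun m => sq_nonneg _) (fun m => ?_)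
      (((w - V u).hasSum_normSq.summable.mul_left (2 * A ^ 2)).add
        (u.hasSum_normSq.summable.mul_left (2 * B ^ 2)))
    rw [← h.diag_eq, norm_mul, norm_mul, Complex.norm_real, Complex.norm_real, Real.norm_eq_abs,
      Real.norm_eq_abs]
    have h1 : |d' m| * ‖u m‖ ≤ (A * |d m| + B) * ‖u m‖ :=
      mul_le_mul_of_nonneg_right (hd m) (norm_nonneg _)
    refine (pow_le_pow_left₀ (by positivity) h1 2).trans ?_
    nlinarith [sq_nonneg (A * (|d m| * ‖u m‖) - B * ‖u m‖)]
  refine ⟨V u + ⟨_, hmem⟩, fun m => ?_⟩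
  rw [lp.coeFn_add, Pi.add_apply, add_comm]

theorem abs_re_inner_apply_le (V : SeqL2 ι →L[ℂ] SeqL2 ι) (u : SeqL2 ι) :
    |(inner ℂ u (V u)).re| ≤ ‖V‖ * ‖u‖ ^ 2 := by
  refine (Complex.abs_re_le_norm _).trans ((norm_inner_le_norm _ _).trans ?_)
  nlinarith [V.le_opNorm u, norm_nonneg u]

/-- First order change of the quadratic form when the diagonal part `d` is replaced by
`d' = d + ℓ + O(t²)`. -/
theorem abs_form_sub_le {M t ε : ℝ} (hM : 0 ≤ M) (ht : 0 ≤ t) (hε : 0 < ε)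
    (hd : ∀ m, 0 ≤ d m)
    (hℓ : ∀ m, |ℓ m| ≤ M * t * d m) (hd' : ∀ m, |d' m - d m - ℓ m| ≤ M * t ^ 2)
    {x y wx wy w' : SeqL2 ι} (hx : HasImage d V x wx) (hy : HasImage d V y wy)
    (hw' : HasImage d' V (x + y) w') {L : ℝ} (hL : HasSum (fun m => ℓ m * ‖x m‖ ^ 2) L) :
    |(inner ℂ (x + y) w').re - (inner ℂ (x + y) (wx + wy)).re - L| ≤
      (M * t + ε) * (inner ℂ y (wy - V y)).re + (M * t) ^ 2 / ε * (inner ℂ x (wx - V x)).re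
        + M * t ^ 2 * ‖x + y‖ ^ 2 := by
  have h1 := (hw'.hasSum_normSq.sub (hx.add hy).hasSum_normSq).sub hL
  have h2 := ((hy.hasSum_normSq.mul_left (M * t + ε)).add
    (hx.hasSum_normSq.mul_left ((M * t) ^ 2 / ε))).add
    ((x + y).hasSum_normSq.mul_left (M * t ^ 2))
  -- The remainder `d' - d - ℓ` costs `M t²`. The term `ℓ` is compared at `x + y` and at `x`, which
  -- leaves a cross term and a term in `|y|²`.
  have key : ∀ m, |d' m * ‖(x + y) m‖ ^ 2 - d m * ‖(x + y) m‖ ^ 2 - ℓ m * ‖x m‖ ^ 2| ≤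
      (M * t + ε) * (d m * ‖y m‖ ^ 2) + (M * t) ^ 2 / ε * (d m * ‖x m‖ ^ 2)
        + M * t ^ 2 * ‖(x + y) m‖ ^ 2 := by
    intro m
    have e1 : d' m * ‖(x + y) m‖ ^ 2 - d m * ‖(x + y) m‖ ^ 2 - ℓ m * ‖x m‖ ^ 2
        = (d' m - d m - ℓ m) * ‖(x + y) m‖ ^ 2 + ℓ m * (‖(x + y) m‖ ^ 2 - ‖x m‖ ^ 2) := by ring
    have hxy : (x + y) m = x m + y m := rfl
    have e2 : |‖(x + y) m‖ ^ 2 - ‖x m‖ ^ 2| ≤ 2 * ‖x m‖ * ‖y m‖ + ‖y m‖ ^ 2 := by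
      have a1 := norm_add_le (x m) (y m)
      have a2 := norm_sub_le (x m + y m) (y m)
      rw [add_sub_cancel_right] at a2
      rw [hxy, abs_le]
      have := norm_nonneg (x m)
      have := norm_nonneg (y m)
      have := norm_nonneg (x m + y m)
      constructor
      · by_cases hc : ‖y m‖ ≤ ‖x m‖
        · nlinarith
        · nlinarith
      · nlinarith
    -- Weighted arithmetic-geometric mean: the `y` part receives the small factor `ε`, to be
    -- absorbed by the gap, and the `x` part receives `t²/ε`, which is of second order.
    have e3 : 2 * (M * t) * (‖x m‖ * ‖y m‖) ≤ ε * ‖y m‖ ^ 2 + (M * t) ^ 2 / ε * ‖x m‖ ^ 2 := by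
      have : ε * ‖y m‖ ^ 2 + (M * t) ^ 2 / ε * ‖x m‖ ^ 2 - 2 * (M * t) * (‖x m‖ * ‖y m‖)
          = (ε * ‖y m‖ - M * t * ‖x m‖) ^ 2 / ε := by
        field_simp
        ring
      have h0 : 0 ≤ (ε * ‖y m‖ - M * t * ‖x m‖) ^ 2 / ε := by positivity
      linarith
    rw [e1]
    refine (abs_add_le _ _).trans ?_
    rw [abs_mul, abs_mul, abs_of_nonneg (sq_nonneg ‖(x + y) m‖)]
    have e4 : |ℓ m| * |‖(x + y) m‖ ^ 2 - ‖x m‖ ^ 2| ≤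
        (M * t * d m) * (2 * ‖x m‖ * ‖y m‖ + ‖y m‖ ^ 2) :=
      mul_le_mul (hℓ m) e2 (abs_nonneg _) (by have := hd m; positivity)
    have e5 := mul_le_mul_of_nonneg_right (hd' m) (sq_nonneg ‖(x + y) m‖)
    have e6 := mul_le_mul_of_nonneg_left e3 (hd m)
    nlinarith
  have h3 : (inner ℂ (x + y) (w' - V (x + y))).re
      - (inner ℂ (x + y) (wx + wy - V (x + y))).re - L =
      (inner ℂ (x + y) w').re - (inner ℂ (x + y) (wx + wy)).re - L := by
    rw [inner_sub_right, inner_sub_right, Complex.sub_re, Complex.sub_re]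
    ring
  rw [h3] at h1
  rw [abs_le]
  constructor
  · have := hasSum_le (fun m => (abs_le.1 (key m)).1) h2.neg h1
    linarith
  · exact hasSum_le (fun m => (abs_le.1 (key m)).2) h1 h2

/-- The form of the perturbed operator on the sum of an eigenvector and a vector that is orthogonal
to it, when the form of the unperturbed operator is known on the latter. -/
theorem form_perturbation (hV : V.IsSymmetric) {M t ε δ E : ℝ} (hM : 0 ≤ M) (ht : 0 ≤ t)
    (hε : 0 < ε) (hδ : 0 < δ) (hd : ∀ m, 0 ≤ d m)
    (hη : M * t + ε ≤ 1) (hη' : (M * t + ε) * (|E| + δ + ‖V‖) ≤ δ / 2)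
    (hℓ : ∀ m, |ℓ m| ≤ M * t * d m) (hd' : ∀ m, |d' m - d m - ℓ m| ≤ M * t ^ 2)
    {x y wy w' : SeqL2 ι} (hx : x ∈ eig d V E) (hy : HasImage d V y wy)
    (hxy : inner ℂ x y = 0) (hw' : HasImage d' V (x + y) w') {L lam : ℝ}
    (hL : HasSum (fun m => ℓ m * ‖x m‖ ^ 2) L) (hlam : |lam| ≤ δ / 2) :
    (lam * ‖x‖ ^ 2 ≤ L → (E + δ) * ‖y‖ ^ 2 ≤ (inner ℂ y wy).re →
      (E + lam - (M + M ^ 2 / ε * (|E| + ‖V‖)) * t ^ 2) * ‖x + y‖ ^ 2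
        ≤ (inner ℂ (x + y) w').re) ∧
    (L ≤ lam * ‖x‖ ^ 2 → (inner ℂ y wy).re ≤ (E - δ) * ‖y‖ ^ 2 →
      (inner ℂ (x + y) w').re ≤
        (E + lam + (M + M ^ 2 / ε * (|E| + ‖V‖)) * t ^ 2) * ‖x + y‖ ^ 2) := by
  have hmain := abs_form_sub_le hM ht hε hd hℓ hd' hx hy hw' hL
  have hyx : inner ℂ y x = 0 := inner_eq_zero_symm.1 hxy
  have hxx : (inner ℂ x x).re = ‖x‖ ^ 2 := inner_self_eq_norm_sq (𝕜 := ℂ) x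
  -- By symmetry `⟨x, (d + V) y⟩ = E ⟨x, y⟩`, so the unperturbed form has no cross terms.
  have hwy : inner ℂ x wy = 0 := by
    rw [← HasImage.inner_comm hV hy hx, inner_smul_left, hxy, mul_zero]
  have hnorm : ‖x + y‖ ^ 2 = ‖x‖ ^ 2 + ‖y‖ ^ 2 := by
    have := norm_add_sq_eq_norm_sq_add_norm_sq_of_inner_eq_zero x y hxy
    nlinarith
  have hcross : (inner ℂ (x + y) ((E : ℂ) • x + wy)).re = E * ‖x‖ ^ 2 + (inner ℂ y wy).re := by
    rw [inner_add_left, inner_add_right, inner_add_right, inner_smul_right, inner_smul_right,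
      hyx, hwy, Complex.add_re, Complex.add_re, Complex.add_re, Complex.re_ofReal_mul, hxx]
    simp
  have hQx : (inner ℂ x ((E : ℂ) • x - V x)).re ≤ (|E| + ‖V‖) * ‖x‖ ^ 2 := by
    rw [inner_sub_right, inner_smul_right, Complex.sub_re, Complex.re_ofReal_mul, hxx]
    have h1 := (abs_le.1 (abs_re_inner_apply_le V x)).1
    nlinarith [le_abs_self E, sq_nonneg ‖x‖]
  have hQy : (inner ℂ y (wy - V y)).re ≤ (inner ℂ y wy).re + ‖V‖ * ‖y‖ ^ 2 := by
    rw [inner_sub_right, Complex.sub_re]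
    have h1 := (abs_le.1 (abs_re_inner_apply_le V y)).1
    linarith
  rw [hcross] at hmain
  have hη0 : 0 ≤ M * t + ε := by positivity
  have hx1 : (M * t) ^ 2 / ε * (inner ℂ x ((E : ℂ) • x - V x)).re ≤
      M ^ 2 / ε * (|E| + ‖V‖) * t ^ 2 * ‖x‖ ^ 2 := by
    refine (mul_le_mul_of_nonneg_left hQx (by positivity)).trans (le_of_eq ?_)
    ring
  have hy1 := mul_le_mul_of_nonneg_left hQy hη0
  have hn2 := mul_le_mul_of_nonneg_right hη' (sq_nonneg ‖y‖)
  have hlam2 := mul_le_mul_of_nonneg_right hlam (sq_nonneg ‖y‖)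
  have hKpos : 0 ≤ M ^ 2 / ε * (|E| + ‖V‖) * t ^ 2 * ‖y‖ ^ 2 := by positivity
  set η := M * t + ε
  set K := M ^ 2 / ε * (|E| + ‖V‖) * t ^ 2
  have hE := mul_le_mul_of_nonneg_right (mul_le_mul_of_nonneg_left (le_abs_self E) hη0)
    (sq_nonneg ‖y‖)
  have hdy : 0 ≤ η * δ * ‖y‖ ^ 2 := by positivity
  -- Both directions use the same budget. On `y` the form is at distance `δ` from `E`; half of it
  -- pays for the error with factor `M t + ε`, and the other half for `lam`. What remains is of
  -- order `t²`.
  constructor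
  · intro h1 h2
    have h3 := (abs_le.1 hmain).1
    have h4 := mul_le_mul_of_nonneg_left h2 (sub_nonneg.2 hη)
    have h5 := mul_le_mul_of_nonneg_right (le_abs_self lam) (sq_nonneg ‖y‖)
    rw [hnorm] at h3 ⊢
    have : (E + lam - (M + M ^ 2 / ε * (|E| + ‖V‖)) * t ^ 2) * (‖x‖ ^ 2 + ‖y‖ ^ 2) =
      (E + lam) * (‖x‖ ^ 2 + ‖y‖ ^ 2) - M * t ^ 2 * (‖x‖ ^ 2 + ‖y‖ ^ 2) -
        K * ‖x‖ ^ 2 - K * ‖y‖ ^ 2 := by ring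
    rw [this]
    linarith
  · intro h1 h2
    have h3 := (abs_le.1 hmain).2
    have h4 := mul_le_mul_of_nonneg_left h2 hη0
    have h5 := mul_le_mul_of_nonneg_right (neg_abs_le lam) (sq_nonneg ‖y‖)
    rw [hnorm] at h3 ⊢
    have : (E + lam + (M + M ^ 2 / ε * (|E| + ‖V‖)) * t ^ 2) * (‖x‖ ^ 2 + ‖y‖ ^ 2) =
      (E + lam) * (‖x‖ ^ 2 + ‖y‖ ^ 2) + M * t ^ 2 * (‖x‖ ^ 2 + ‖y‖ ^ 2) +
        K * ‖x‖ ^ 2 + K * ‖y‖ ^ 2 := by ring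
    rw [this]
    linarith

/-- The first order form on a two dimensional eigenspace on which it is off-diagonal. -/
theorem hasSum_form_pair {φ₁ φ₂ : SeqL2 ι} {z : ℂ}
    (h₁ : HasSum (fun m => ℓ m * ‖φ₁ m‖ ^ 2) 0) (h₂ : HasSum (fun m => ℓ m * ‖φ₂ m‖ ^ 2) 0)
    (h₁₂ : HasSum (fun m => (ℓ m : ℂ) * (starRingEnd ℂ (φ₁ m) * φ₂ m)) z) (α β : ℂ) :
    HasSum (fun m => ℓ m * ‖(α • φ₁ + β • φ₂) m‖ ^ 2) (2 * (starRingEnd ℂ α * β * z).re) := by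
  have h := ((h₁.mul_left (‖α‖ ^ 2)).add (h₂.mul_left (‖β‖ ^ 2))).add
    ((Complex.hasSum_re (h₁₂.mul_left (starRingEnd ℂ α * β))).mul_left 2)
  simp only [mul_zero, zero_add] at h
  refine h.congr_fun fun m => ?_
  have e : (α • φ₁ + β • φ₂) m = α * φ₁ m + β * φ₂ m := rfl
  rw [e]
  simp only [← Complex.normSq_eq_norm_sq, Complex.normSq_add, map_mul]
  have e2 : (starRingEnd ℂ α * β * ((ℓ m : ℂ) * (starRingEnd ℂ (φ₁ m) * φ₂ m))).re =
      ℓ m * (α * φ₁ m * (starRingEnd ℂ β * starRingEnd ℂ (φ₂ m))).re := by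
    rw [← Complex.re_ofReal_mul, ← Complex.conj_re]
    congr 1
    simp only [map_mul, Complex.conj_conj, Complex.conj_ofReal]
    ring
  rw [e2]
  ring

end Perturbation

end FracHoneycomb

namespace FracHoneycomb

/-! ### Conical splitting of a double eigenvalue -/

section ConicalBands

variable {ι : Type*} {d : ι → ℝ} {V : SeqL2 ι →L[ℂ] SeqL2 ι}

theorem finrank_sup_span_singleton_of_mem_orthogonal {N : Submodule ℂ (SeqL2 ι)}
    [FiniteDimensional ℂ N] {w : SeqL2 ι} (hw : w ∈ Nᗮ) (hw0 : w ≠ 0) :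
    Module.finrank ℂ (N ⊔ ℂ ∙ w : Submodule ℂ (SeqL2 ι)) = Module.finrank ℂ N + 1 := by
  have h := Submodule.finrank_sup_add_finrank_inf_eq N (ℂ ∙ w)
  have hdisj : N ⟂ ℂ ∙ w := by
    rw [Submodule.isOrtho_comm, Submodule.isOrtho_iff_le, Submodule.span_singleton_le_iff_mem]
    exact hw
  rw [hdisj.disjoint.eq_bot, finrank_bot, add_zero, finrank_span_singleton hw0] at h
  exact h

theorem inner_combination {φ₁ φ₂ : SeqL2 ι} (n₁ : inner ℂ φ₁ φ₁ = 1) (n₂ : inner ℂ φ₂ φ₂ = 1)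
    (n₁₂ : inner ℂ φ₁ φ₂ = 0) (α β γ κ : ℂ) :
    inner ℂ (α • φ₁ + β • φ₂) (γ • φ₁ + κ • φ₂) =
      starRingEnd ℂ α * γ + starRingEnd ℂ β * κ := by
  have n₂₁ : inner ℂ φ₂ φ₁ = 0 := inner_eq_zero_symm.1 n₁₂
  simp only [inner_add_left, inner_add_right, inner_smul_left, inner_smul_right, n₁, n₂, n₁₂, n₂₁]
  ring

theorem normSq_combination {φ₁ φ₂ : SeqL2 ι} (n₁ : inner ℂ φ₁ φ₁ = 1) (n₂ : inner ℂ φ₂ φ₂ = 1)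
    (n₁₂ : inner ℂ φ₁ φ₂ = 0) (α β : ℂ) :
    ‖α • φ₁ + β • φ₂‖ ^ 2 = ‖α‖ ^ 2 + ‖β‖ ^ 2 := by
  have h1 : (inner ℂ (α • φ₁ + β • φ₂) (α • φ₁ + β • φ₂)).re = ‖α • φ₁ + β • φ₂‖ ^ 2 :=
    inner_self_eq_norm_sq (𝕜 := ℂ) _
  rw [← h1, inner_combination n₁ n₂ n₁₂, ← Complex.normSq_eq_conj_mul_self,
    ← Complex.normSq_eq_conj_mul_self, Complex.add_re, Complex.ofReal_re, Complex.ofReal_re,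
    Complex.normSq_eq_norm_sq, Complex.normSq_eq_norm_sq]

/-- A double eigenvalue on whose eigenspace the first order change of the diagonal part acts as an
off-diagonal matrix with entries of modulus `v t` splits into `E ± v t + O(t²)`. -/
theorem exists_conical_bands (hV : V.IsSymmetric) (hd : Tendsto d cofinite atTop)
    (hd0 : ∀ m, 0 ≤ d m) {E : ℝ} {n : ℕ} {φ₁ φ₂ : SeqL2 ι}
    (hφ₁ : φ₁ ∈ eig d V E) (hφ₂ : φ₂ ∈ eig d V E) (n₁ : inner ℂ φ₁ φ₁ = 1)
    (n₂ : inner ℂ φ₂ φ₂ = 1) (n₁₂ : inner ℂ φ₁ φ₂ = 0)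
    (hlt : Module.finrank ℂ (specOn d V (Set.Iio E)) = n)
    (hle : Module.finrank ℂ (specOn d V (Set.Iic E)) = n + 2) {M v : ℝ} (hM : 0 ≤ M)
    (hv : 0 ≤ v) :
    ∃ t₀ > 0, ∃ C > 0, ∀ (t : ℝ) (d' ℓ : ι → ℝ) (ζ : ℂ), 0 ≤ t → t < t₀ → ‖ζ‖ = 1 →
      Tendsto d' cofinite atTop → (∀ m, |ℓ m| ≤ M * t * d m) →
      (∀ m, |d' m - d m - ℓ m| ≤ M * t ^ 2) →
      HasSum (fun m => ℓ m * ‖φ₁ m‖ ^ 2) 0 → HasSum (fun m => ℓ m * ‖φ₂ m‖ ^ 2) 0 →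
      HasSum (fun m => (ℓ m : ℂ) * (starRingEnd ℂ (φ₁ m) * φ₂ m)) (((v * t : ℝ) : ℂ) * ζ) →
      |seqBand d' V (n + 2) - E - v * t| ≤ C * t ^ 2 ∧
        |seqBand d' V (n + 1) - E + v * t| ≤ C * t ^ 2 := by
  obtain ⟨δ, hδ, hgap, hgap'⟩ := exists_spectral_gap hV hd E
  set S := specOn d V (Set.Iio E) with hS
  have hfd := finiteDimensional_specOn hV hd E
  have hSle : S ≤ specOn d V (Set.Iic E) := specOn_mono Set.Iio_subset_Iic_self
  have hfdS : FiniteDimensional ℂ S := Submodule.finiteDimensional_of_le hSle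
  have hEig : eig d V E ≤ Sᗮ := by
    have h1 : S ≤ (eig d V E)ᗮ := specOn_le_iff.2 fun μ hμ u hu u' hu' =>
      inner_eq_zero_of_mem_eig hV (ne_of_gt hμ) hu' hu
    exact (Submodule.isOrtho_iff_le.2 h1).symm.le
  have n₂₁ : inner ℂ φ₂ φ₁ = 0 := inner_eq_zero_symm.1 n₁₂
  have hφ₁0 : φ₁ ≠ 0 := fun h => by simp [h] at n₁
  have hφ₂0 : φ₂ ≠ 0 := fun h => by simp [h] at n₂
  have hφ₂' : φ₂ ∈ (S ⊔ ℂ ∙ φ₁)ᗮ := by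
    rw [← Submodule.inf_orthogonal]
    exact ⟨hEig hφ₂, Submodule.mem_orthogonal_singleton_iff_inner_right.2 n₁₂⟩
  -- The eigenvalue counts `n` and `n + 2` leave no room in the eigenspace beyond `φ₁` and `φ₂`.
  have hsup : specOn d V (Set.Iic E) = (S ⊔ ℂ ∙ φ₁) ⊔ ℂ ∙ φ₂ := by
    symm
    have hmem : ∀ {φ}, φ ∈ eig d V E → ℂ ∙ φ ≤ specOn d V (Set.Iic E) := fun h =>
      (Submodule.span_singleton_le_iff_mem _ _).2 (eig_le_specOn Set.self_mem_Iic h)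
    refine Submodule.eq_of_le_of_finrank_eq (sup_le (sup_le hSle (hmem hφ₁)) (hmem hφ₂)) ?_
    rw [finrank_sup_span_singleton_of_mem_orthogonal hφ₂' hφ₂0,
      finrank_sup_span_singleton_of_mem_orthogonal (hEig hφ₁) hφ₁0, hlt, hle]
  have hpair : ∀ α β : ℂ, α • φ₁ + β • φ₂ ∈ eig d V E := fun α β =>
    Submodule.add_mem _ (Submodule.smul_mem _ _ hφ₁) (Submodule.smul_mem _ _ hφ₂)
  -- The budget for `M t + ε` in `form_perturbation`: half goes to `ε = η / 2`, and half to `M t`,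
  -- which restricts `t`.
  set η := min 1 (δ / (2 * (|E| + δ + ‖V‖))) with hη
  have hden : 0 < |E| + δ + ‖V‖ := by positivity
  have hηpos : 0 < η := lt_min one_pos (by positivity)
  have hη1 : η ≤ 1 := min_le_left _ _
  have hη2 : η * (|E| + δ + ‖V‖) ≤ δ / 2 := by
    refine (mul_le_mul_of_nonneg_right (min_le_right _ _) hden.le).trans (le_of_eq ?_)
    field_simp
  set C₀ := M + M ^ 2 / (η / 2) * (|E| + ‖V‖) with hC₀
  have hC₀pos : 0 ≤ C₀ := by positivity
  -- The two bounds on `t` ensure `M t ≤ η / 2` and `v t ≤ δ / 2`. The added ones avoid division by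
  -- zero when `M` or `v` vanishes, and `C₀ + 1` makes the constant positive.
  refine ⟨min (η / 2 / (M + 1)) (δ / 2 / (v + 1)), lt_min (by positivity) (by positivity),
    C₀ + 1, by positivity, ?_⟩
  intro t d' ℓ ζ ht htlt hζ hd' hℓ hdd' hs₁ hs₂ hs₁₂
  have hMt : M * t ≤ η / 2 := by
    have h1 := (le_div_iff₀ (by positivity)).1 (htlt.le.trans (min_le_left _ _))
    nlinarith
  have hvt : v * t ≤ δ / 2 := by
    have h1 := (le_div_iff₀ (by positivity)).1 (htlt.le.trans (min_le_right _ _))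
    nlinarith
  have hvt0 : 0 ≤ v * t := by positivity
  have hε : 0 < η / 2 := half_pos hηpos
  have hη3 : M * t + η / 2 ≤ 1 := by linarith
  have hη4 : (M * t + η / 2) * (|E| + δ + ‖V‖) ≤ δ / 2 :=
    (mul_le_mul_of_nonneg_right (by linarith) hden.le).trans hη2
  have hto : ∀ {u w}, HasImage d V u w → ∃ w', HasImage d' V u w' := fun {u w} h => by
    refine h.exists_of_le (A := 1 + M * t) (B := M * t ^ 2) fun m => ?_
    have h1 := abs_add_le (d' m - d m - ℓ m) (d m + ℓ m)
    have h2 := abs_add_le (d m) (ℓ m)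
    have h3 := hdd' m
    have h4 := hℓ m
    rw [abs_of_nonneg (hd0 m)] at h2 ⊢
    have h5 : d' m - d m - ℓ m + (d m + ℓ m) = d' m := by ring
    rw [h5] at h1
    linarith
  have hfrom : ∀ {u w'}, HasImage d' V u w' → ∃ w, HasImage d V u w := fun {u w'} h => by
    refine h.exists_of_le (A := 2) (B := 2 * (M * t ^ 2)) fun m => ?_
    have h3 := (abs_le.1 (hdd' m)).1
    have h4 := (abs_le.1 (hℓ m)).1
    have h5 := le_abs_self (d' m)
    rw [abs_of_nonneg (hd0 m)]
    have h6 : M * t * d m ≤ 1 / 2 * d m := mul_le_mul_of_nonneg_right (by linarith) (hd0 m)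
    linarith
  have hform := hasSum_form_pair hs₁ hs₂ hs₁₂
  have hnorm := normSq_combination n₁ n₂ n₁₂
  have hζζ : starRingEnd ℂ ζ * ζ = 1 := by
    rw [← Complex.normSq_eq_conj_mul_self, Complex.normSq_eq_norm_sq, hζ]
    simp
  have habs : ∀ α β : ℂ, |2 * (starRingEnd ℂ α * β * (((v * t : ℝ) : ℂ) * ζ)).re| ≤
      v * t * ‖α • φ₁ + β • φ₂‖ ^ 2 := fun α β => by
    rw [hnorm, abs_mul, abs_two]
    have h1 := Complex.abs_re_le_norm (starRingEnd ℂ α * β * (((v * t : ℝ) : ℂ) * ζ))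
    rw [norm_mul, norm_mul, norm_mul, hζ, RCLike.norm_conj, Complex.norm_real,
      Real.norm_of_nonneg hvt0] at h1
    nlinarith [mul_nonneg hvt0 (sq_nonneg (‖α‖ - ‖β‖))]
  have hlam : ∀ s : ℝ, |s| = 1 → |s * (v * t)| ≤ δ / 2 := fun s hs => by
    rw [abs_mul, hs, one_mul, abs_of_nonneg hvt0]
    exact hvt
  -- For trial vectors the part `a` lies at or below `E - δ` by the gap. The sign `s` selects the
  -- branch `±v t`.
  have hupper : ∀ s : ℝ, |s| = 1 → ∀ a ∈ S, ∀ α β : ℂ,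
      2 * (starRingEnd ℂ α * β * (((v * t : ℝ) : ℂ) * ζ)).re ≤
        s * (v * t) * ‖α • φ₁ + β • φ₂‖ ^ 2 →
      ∃ w, HasImage d' V (a + (α • φ₁ + β • φ₂)) w ∧
        (inner ℂ (a + (α • φ₁ + β • φ₂)) w).re ≤
          (E + s * (v * t) + C₀ * t ^ 2) * ‖a + (α • φ₁ + β • φ₂)‖ ^ 2 := by
    intro s hs a ha α β hL
    have ha' := ha
    rw [hgap'] at ha'
    obtain ⟨wa, -, hwa, hqa⟩ := exists_hasImage_of_mem_specOn hV (fun _ h => h) ha'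
    obtain ⟨w', hw'⟩ := hto ((mem_eig.1 (hpair α β)).add hwa)
    rw [add_comm a]
    exact ⟨w', hw', (form_perturbation hV hM ht hε hδ hd0 hη3 hη4 hℓ hdd' (hpair α β) hwa
      (inner_eq_zero_symm.1 (hEig (hpair α β) a ha)) hw' (hform α β) (hlam s hs)).2 hL hqa⟩
  -- A vector orthogonal to `S` splits into its component in the eigenspace and a remainder `c` on
  -- which the form is at least `E + δ`.
  have hlower : ∀ s : ℝ, |s| = 1 → ∀ u ∈ Sᗮ, ∀ w', HasImage d' V u w' →
      s * (v * t) * ‖(inner ℂ φ₁ u : ℂ) • φ₁ + (inner ℂ φ₂ u : ℂ) • φ₂‖ ^ 2 ≤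
        2 * (starRingEnd ℂ (inner ℂ φ₁ u) * inner ℂ φ₂ u * (((v * t : ℝ) : ℂ) * ζ)).re →
      (E + s * (v * t) - C₀ * t ^ 2) * ‖u‖ ^ 2 ≤ (inner ℂ u w').re := by
    intro s hs u hu w' hw' hL
    set α := (inner ℂ φ₁ u : ℂ)
    set β := (inner ℂ φ₂ u : ℂ)
    obtain ⟨w, hw⟩ := hfrom hw'
    have hwc := hw.sub (mem_eig.1 (hpair α β))
    set c := u - (α • φ₁ + β • φ₂) with hc
    have hcS : c ∈ (specOn d V (Set.Iic E))ᗮ := by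
      rw [hsup, ← Submodule.inf_orthogonal, ← Submodule.inf_orthogonal]
      refine ⟨⟨Submodule.sub_mem _ hu (hEig (hpair α β)), ?_⟩, ?_⟩
      · refine Submodule.mem_orthogonal_singleton_iff_inner_right.2 ?_
        rw [hc, inner_sub_right, inner_add_right, inner_smul_right, inner_smul_right, n₁, n₁₂]
        ring
      · refine Submodule.mem_orthogonal_singleton_iff_inner_right.2 ?_
        rw [hc, inner_sub_right, inner_add_right, inner_smul_right, inner_smul_right, n₂, n₂₁]
        ring
    have hcq := hcS
    rw [← hgap] at hcq
    have hqc := le_form_of_mem_orthogonal hV hd hwc hcq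
    have hxc : inner ℂ (α • φ₁ + β • φ₂) c = 0 :=
      hcS _ (eig_le_specOn Set.self_mem_Iic (hpair α β))
    have huc : α • φ₁ + β • φ₂ + c = u := by rw [hc]; abel
    have h := (form_perturbation hV hM ht hε hδ hd0 hη3 hη4 hℓ hdd' (hpair α β) hwc hxc
      (huc.symm ▸ hw') (hform α β) (hlam s hs)).1 hL hqc
    rwa [huc] at h
  have hs1 : |(1 : ℝ)| = 1 := abs_one
  have hs2 : |(-1 : ℝ)| = 1 := by simp
  -- Eigenvector, for `-v t`, of the Hermitian matrix with zero diagonal and upper right entry `v t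
  -- ζ`.
  set ψ := (1 : ℂ) • φ₁ + (-starRingEnd ℂ ζ) • φ₂ with hψ
  have hψS : ψ ∈ Sᗮ := hEig (hpair _ _)
  have hψ0 : ψ ≠ 0 := fun h => by
    have h1 := hnorm 1 (-starRingEnd ℂ ζ)
    rw [← hψ, h, norm_zero, norm_neg, RCLike.norm_conj, hζ] at h1
    norm_num at h1
  -- Trial spaces for the upper bounds are the whole space up to `E`, where the matrix is at most `v
  -- t`, and `S` with `ψ`, where it is `-v t`. For the lower bounds `S ⊔ ℂ ∙ ψ` and `S` are removed
  -- instead.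
  have hupp₁ := seqBand_le_of_form_le hV hd' (b := n + 2) (by omega)
    (E := E + v * t + C₀ * t ^ 2) (specOn d V (Set.Iic E)) hle.ge fun u hu => by
      rw [hsup] at hu
      obtain ⟨x, hx, y, hy, rfl⟩ := Submodule.mem_sup.1 hu
      obtain ⟨a, ha, z, hz, rfl⟩ := Submodule.mem_sup.1 hx
      obtain ⟨α, rfl⟩ := Submodule.mem_span_singleton.1 hz
      obtain ⟨β, rfl⟩ := Submodule.mem_span_singleton.1 hy
      have := hupper 1 hs1 a ha α β (by
        rw [one_mul]
        exact (abs_le.1 (habs α β)).2)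
      rwa [one_mul, ← add_assoc a] at this
  have hupp₂ := seqBand_le_of_form_le hV hd' (b := n + 1) (by omega)
    (E := E - v * t + C₀ * t ^ 2) (S ⊔ ℂ ∙ ψ)
    (by rw [finrank_sup_span_singleton_of_mem_orthogonal hψS hψ0, hlt]) fun u hu => by
      obtain ⟨a, ha, y, hy, rfl⟩ := Submodule.mem_sup.1 hu
      obtain ⟨γ, rfl⟩ := Submodule.mem_span_singleton.1 hy
      have h1 : γ • ψ = γ • φ₁ + (-(γ * starRingEnd ℂ ζ)) • φ₂ := by
        rw [hψ]
        module
      have := hupper (-1) hs2 a ha γ (-(γ * starRingEnd ℂ ζ)) (by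
        rw [hnorm, norm_neg, norm_mul, RCLike.norm_conj, hζ]
        have h2 : starRingEnd ℂ γ * -(γ * starRingEnd ℂ ζ) * (((v * t : ℝ) : ℂ) * ζ) =
            ((-(‖γ‖ ^ 2 * (v * t)) : ℝ) : ℂ) := by
          have h3 : starRingEnd ℂ γ * γ = ((‖γ‖ ^ 2 : ℝ) : ℂ) := by
            rw [← Complex.normSq_eq_conj_mul_self, Complex.normSq_eq_norm_sq]
          push_cast at h3 ⊢
          linear_combination (-(v * t : ℂ)) * (starRingEnd ℂ ζ * ζ) * h3
            - (v * t : ℂ) * (‖γ‖ : ℂ) ^ 2 * hζζ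
        rw [h2, Complex.ofReal_re]
        linarith)
      rw [← h1] at this
      rwa [show E - v * t + C₀ * t ^ 2 = E + -1 * (v * t) + C₀ * t ^ 2 by ring]
  have hlow₁ := le_seqBand_of_le_form hV hd' (E := E + v * t - C₀ * t ^ 2) hupp₁.1 (S ⊔ ℂ ∙ ψ)
    (by rw [finrank_sup_span_singleton_of_mem_orthogonal hψS hψ0, hlt]; omega) fun u hu w hw => by
      rw [← Submodule.inf_orthogonal] at hu
      have h1 := Submodule.mem_orthogonal_singleton_iff_inner_right.1 hu.2
      rw [hψ, inner_add_left, inner_smul_left, inner_smul_left, map_neg, Complex.conj_conj,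
        map_one, one_mul] at h1
      -- Orthogonality to `ψ` puts the eigenspace component of `u` on the eigenvector of the matrix
      -- for `+v t`.
      have h2 : inner ℂ φ₁ u = ζ * inner ℂ φ₂ u := by linear_combination h1
      have := hlower 1 hs1 u hu.1 w hw (by
        rw [hnorm, h2, norm_mul, hζ]
        set β := (inner ℂ φ₂ u : ℂ)
        have h3 : starRingEnd ℂ (ζ * β) * β * (((v * t : ℝ) : ℂ) * ζ) =
            ((‖β‖ ^ 2 * (v * t) : ℝ) : ℂ) := by
          have h3 : starRingEnd ℂ β * β = ((‖β‖ ^ 2 : ℝ) : ℂ) := by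
            rw [← Complex.normSq_eq_conj_mul_self, Complex.normSq_eq_norm_sq]
          rw [map_mul]
          push_cast at h3 ⊢
          linear_combination (v * t : ℂ) * (starRingEnd ℂ ζ * ζ) * h3
            + (v * t : ℂ) * (‖β‖ : ℂ) ^ 2 * hζζ
        rw [h3, Complex.ofReal_re]
        linarith)
      rwa [one_mul] at this
  have hlow₂ := le_seqBand_of_le_form hV hd' (E := E - v * t - C₀ * t ^ 2) hupp₂.1 S
    (by rw [hlt]; omega) fun u hu w hw => by
      have := hlower (-1) hs2 u hu w hw (by
        have := (abs_le.1 (habs (inner ℂ φ₁ u) (inner ℂ φ₂ u))).1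
        linarith)
      rwa [show E - v * t - C₀ * t ^ 2 = E + -1 * (v * t) - C₀ * t ^ 2 by ring]
  have ht2 := sq_nonneg t
  have h₁ := hupp₁.2
  have h₂ := hupp₂.2
  rw [show (C₀ + 1) * t ^ 2 = C₀ * t ^ 2 + t ^ 2 by ring]
  exact ⟨abs_le.2 ⟨by linarith, by linarith⟩, abs_le.2 ⟨by linarith, by linarith⟩⟩

end ConicalBands

end FracHoneycomb

namespace FracHoneycomb

noncomputable section

/-! ### The plane over the torus -/

/-- The torus `ℝ² / ℤ²`. -/
abbrev Torus : Type := UnitAddTorus (Fin 2)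

/-- The Haar probability measure of the torus. -/
def torusMeasure : Measure Torus := Measure.pi fun _ => AddCircle.haarAddCircle

instance : IsProbabilityMeasure torusMeasure := by
  unfold torusMeasure
  infer_instance

instance : torusMeasure.IsAddHaarMeasure := by
  unfold torusMeasure
  infer_instance

/-- The coordinates of a point of the plane with respect to `v₁`, `v₂`. -/
def planeCoordLin : Plane ≃ₗ[ℝ] (Fin 2 → ℝ) where
  toFun y := ![y 0 / √3 + y 1, y 0 / √3 - y 1]
  map_add' x y := by
    ext i
    fin_cases i <;> simp <;> ring
  map_smul' c y := by
    ext i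
    fin_cases i <;> simp <;> ring
  invFun s := s 0 • v₁ + s 1 • v₂
  left_inv y := by
    have h3 : √3 ≠ 0 := by positivity
    ext i
    fin_cases i <;> simp [v₁, v₂] <;> field_simp <;> ring
  right_inv s := by
    have h3 : √3 ≠ 0 := by positivity
    ext i
    fin_cases i <;> simp [v₁, v₂] <;> field_simp <;> ring

/-- The coordinates of a point of the plane with respect to `v₁`, `v₂`, as a homeomorphism. -/
def planeCoord : Plane ≃L[ℝ] (Fin 2 → ℝ) := planeCoordLin.toContinuousLinearEquiv

theorem planeCoord_apply (y : Plane) : planeCoord y = ![y 0 / √3 + y 1, y 0 / √3 - y 1] := rfl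

theorem planeCoord_latticeVec (n : Fin 2 → ℤ) : planeCoord (latticeVec n) = fun i => (n i : ℝ) :=
  planeCoord.apply_symm_apply fun i => (n i : ℝ)

theorem inner_dualVec (m : Fin 2 → ℤ) (y : Plane) :
    inner ℝ (dualVec m) y = 2 * Real.pi * (m 0 * planeCoord y 0 + m 1 * planeCoord y 1) := by
  have h3 : √3 ≠ 0 := by positivity
  simp only [planeCoord_apply, dualVec, k₁, k₂, PiLp.inner_apply, Fin.sum_univ_two]
  simp
  field_simp
  ring

theorem cell_eq_preimage : cell = planeCoord ⁻¹' Set.Icc 0 1 := by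
  ext y
  constructor
  · rintro ⟨s, hs, t, ht, rfl⟩
    have h : planeCoord (s • v₁ + t • v₂) = ![s, t] := planeCoord.apply_symm_apply ![s, t]
    rw [Set.mem_preimage, h]
    refine ⟨fun i => ?_, fun i => ?_⟩ <;> fin_cases i
    exacts [hs.1, ht.1, hs.2, ht.2]
  · intro h
    exact ⟨planeCoord y 0, ⟨h.1 0, h.2 0⟩, planeCoord y 1, ⟨h.1 1, h.2 1⟩,
      (planeCoord.symm_apply_apply y).symm⟩

theorem isCompact_cell : IsCompact cell := by
  rw [cell_eq_preimage]
  exact planeCoord.toHomeomorph.isCompact_preimage.2 isCompact_Icc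

/-- The covering map of the torus `ℝ² / Λ`, in the coordinates with respect to `v₁`, `v₂`. -/
def toTorus (y : Plane) : Torus := fun i => (planeCoord y i : UnitAddCircle)

theorem measurable_toTorus : Measurable toTorus := by
  refine measurable_pi_lambda _ fun i => ?_
  exact AddCircle.measurable_mk'.comp ((measurable_pi_apply i).comp planeCoord.continuous.measurable)

theorem toTorus_add (x y : Plane) : toTorus (x + y) = toTorus x + toTorus y := by
  ext i
  simp [toTorus]

theorem toTorus_neg (y : Plane) : toTorus (-y) = -toTorus y := by
  ext i
  simp [toTorus]

theorem toTorus_add_latticeVec (y : Plane) (n : Fin 2 → ℤ) :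
    toTorus (y + latticeVec n) = toTorus y := by
  rw [toTorus_add, add_eq_left]
  ext i
  simp only [toTorus, planeCoord_latticeVec]
  exact (AddCircle.coe_eq_zero_iff 1).2 ⟨n i, by simp⟩

theorem exists_latticeVec_of_toTorus_eq {x y : Plane} (h : toTorus x = toTorus y) :
    ∃ n, x = y + latticeVec n := by
  have h1 : ∀ i, ∃ n : ℤ, (n : ℝ) = planeCoord x i - planeCoord y i := fun i => by
    have h2 : ((planeCoord x i - planeCoord y i : ℝ) : UnitAddCircle) = 0 := by
      rw [AddCircle.coe_sub, sub_eq_zero]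
      exact congrFun h i
    obtain ⟨n, hn⟩ := (AddCircle.coe_eq_zero_iff 1).1 h2
    exact ⟨n, by simpa using hn⟩
  choose n hn using h1
  refine ⟨n, planeCoord.injective ?_⟩
  rw [map_add, planeCoord_latticeVec]
  ext i
  simp [hn]

/-- The representative in the half open cell of a point of the torus. -/
def torusSection (x : Torus) : Plane :=
  planeCoord.symm fun i => ((AddCircle.equivIoc 1 0 (x i) : Set.Ioc (0 : ℝ) (0 + 1)) : ℝ)

theorem measurable_torusSection : Measurable torusSection := by
  refine planeCoord.symm.continuous.measurable.comp (measurable_pi_lambda _ fun i => ?_)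
  exact measurable_subtype_coe.comp
    ((AddCircle.measurableEquivIoc 1 0).measurable.comp (measurable_pi_apply i))

theorem toTorus_torusSection (x : Torus) : toTorus (torusSection x) = x := by
  ext i
  simp only [toTorus, torusSection, ContinuousLinearEquiv.apply_symm_apply]
  exact (AddCircle.equivIoc 1 0).symm_apply_apply (x i)

theorem torusSection_mem_cell (x : Torus) : torusSection x ∈ cell := by
  rw [cell_eq_preimage, Set.mem_preimage, torusSection, ContinuousLinearEquiv.apply_symm_apply]
  refine ⟨fun i => (AddCircle.equivIoc 1 0 (x i)).2.1.le, fun i => ?_⟩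
  simpa using (AddCircle.equivIoc 1 0 (x i)).2.2

theorem exists_torusSection_toTorus (y : Plane) :
    ∃ n, torusSection (toTorus y) = y + latticeVec n :=
  exists_latticeVec_of_toTorus_eq (toTorus_torusSection _)

theorem torusSection_toTorus_of_mem {y : Plane}
    (hy : planeCoord y ∈ Set.univ.pi fun _ => Set.Ioc (0 : ℝ) 1) : torusSection (toTorus y) = y := by
  refine planeCoord.injective ?_
  rw [torusSection, ContinuousLinearEquiv.apply_symm_apply]
  ext i
  have h : planeCoord y i ∈ Set.Ioc (0 : ℝ) (0 + 1) := by simpa using hy i (Set.mem_univ i)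
  exact congrArg Subtype.val ((AddCircle.equivIoc 1 0).apply_symm_apply ⟨_, h⟩)

theorem map_coe_pi_Ioc :
    Measure.map (fun (s : Fin 2 → ℝ) i => (s i : UnitAddCircle))
      (volume.restrict (Set.univ.pi fun _ => Set.Ioc (0 : ℝ) 1)) = torusMeasure := by
  have h1 : MeasurePreserving ((↑) : ℝ → UnitAddCircle) (volume.restrict (Set.Ioc (0 : ℝ) 1))
      AddCircle.haarAddCircle := by
    have := UnitAddCircle.measurePreserving_mk 0
    rwa [zero_add, AddCircle.volume_eq_smul_haarAddCircle, ENNReal.ofReal_one, one_smul] at this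
  have h2 := measurePreserving_pi (fun _ : Fin 2 => volume.restrict (Set.Ioc (0 : ℝ) 1))
    (fun _ : Fin 2 => AddCircle.haarAddCircle (T := (1 : ℝ))) fun _ => h1
  rw [volume_pi, Measure.restrict_pi_pi]
  exact h2.map_eq

/-- The pushforward is a Haar measure, so uniqueness gives a constant. This Jacobian is never
computed; it is later recognized as the area of the cell. -/
theorem exists_map_planeCoord : ∃ c : ENNReal, c ≠ 0 ∧ c ≠ ⊤ ∧
    Measure.map planeCoord (volume : Measure Plane) = c • volume := by
  have : (Measure.map planeCoord (volume : Measure Plane)).IsAddHaarMeasure :=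
    planeCoord.isAddHaarMeasure_map _
  have hpos := Measure.addHaarScalarFactor_pos_of_isAddHaarMeasure
    (Measure.map planeCoord (volume : Measure Plane)) volume
  exact ⟨_, ENNReal.coe_ne_zero.2 hpos.ne', ENNReal.coe_ne_top,
    Measure.isAddLeftInvariant_eq_smul (Measure.map planeCoord (volume : Measure Plane)) volume⟩

theorem map_planeCoord_restrict_cell {c : ENNReal}
    (hc : Measure.map planeCoord (volume : Measure Plane) = c • volume) :
    Measure.map planeCoord (volume.restrict cell) =
      c • volume.restrict (Set.univ.pi fun _ => Set.Ioc (0 : ℝ) 1) := by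
  rw [cell_eq_preimage, ← Measure.restrict_map planeCoord.continuous.measurable measurableSet_Icc,
    hc, Measure.restrict_smul]
  congr 1
  exact (Measure.restrict_congr_set Measure.univ_pi_Ioc_ae_eq_Icc).symm

theorem map_toTorus_restrict_cell :
    Measure.map toTorus (volume.restrict cell) = volume cell • torusMeasure ∧
      volume cell ≠ 0 ∧ volume cell ≠ ⊤ := by
  obtain ⟨c, hc0, hct, hc⟩ := exists_map_planeCoord
  have h1 : Measure.map toTorus (volume.restrict cell) = c • torusMeasure := by
    rw [← map_coe_pi_Ioc, ← Measure.map_smul, ← map_planeCoord_restrict_cell hc, Measure.map_map]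
    · rfl
    · exact measurable_pi_lambda _ fun i => AddCircle.measurable_mk'.comp (measurable_pi_apply i)
    · exact planeCoord.continuous.measurable
  have h2 : volume cell = c := by
    have := congrArg (fun μ : Measure Torus => μ Set.univ) h1
    simpa [Measure.map_apply measurable_toTorus MeasurableSet.univ] using this
  rw [h2]
  exact ⟨h1, hc0, hct⟩

/-- The closed and the half open cell differ by a null set, and on the half open one the section
inverts the covering map. -/
theorem ae_cell_torusSection_toTorus :
    ∀ᵐ y ∂(volume.restrict cell), torusSection (toTorus y) = y := by
  obtain ⟨c, hc0, hct, hc⟩ := exists_map_planeCoord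
  have h1 : ∀ᵐ s ∂(Measure.map planeCoord (volume.restrict cell)),
      s ∈ Set.univ.pi fun _ : Fin 2 => Set.Ioc (0 : ℝ) 1 := by
    rw [map_planeCoord_restrict_cell hc]
    exact Measure.ae_smul_measure
      (ae_restrict_mem (MeasurableSet.univ_pi fun _ => measurableSet_Ioc)) c
  exact (ae_of_ae_map planeCoord.continuous.measurable.aemeasurable h1).mono fun y hy =>
    torusSection_toTorus_of_mem hy

theorem measurePreserving_torusSection :
    MeasurePreserving torusSection torusMeasure ((volume cell)⁻¹ • volume.restrict cell) := by
  obtain ⟨h1, h0, ht⟩ := map_toTorus_restrict_cell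
  refine ⟨measurable_torusSection, ?_⟩
  have h2 : torusMeasure = (volume cell)⁻¹ • Measure.map toTorus (volume.restrict cell) := by
    rw [h1, smul_smul, ENNReal.inv_mul_cancel h0 ht, one_smul]
  rw [h2, Measure.map_smul, Measure.map_map measurable_torusSection measurable_toTorus]
  congr 1
  exact (Measure.map_congr (g := id) ae_cell_torusSection_toTorus).trans Measure.map_id

theorem quasiMeasurePreserving_torusSection :
    Measure.QuasiMeasurePreserving torusSection torusMeasure volume := by
  refine measurePreserving_torusSection.quasiMeasurePreserving.mono_right ?_
  exact (Measure.smul_absolutelyContinuous).trans Measure.absolutelyContinuous_restrict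

/-- A property that holds almost everywhere on all translates of the cell holds almost
everywhere. -/
theorem ae_of_ae_cell_translate {P : Plane → Prop}
    (h : ∀ᵐ y ∂(volume.restrict cell), ∀ n, P (y + latticeVec n)) : ∀ᵐ y : Plane, P y := by
  have hms : MeasurableSet cell := isCompact_cell.measurableSet
  rw [ae_restrict_iff' hms] at h
  have h2 : ∀ n, ∀ᵐ y : Plane, y + latticeVec n ∈ cell →
      ∀ n', P (y + latticeVec n + latticeVec n') := fun n =>
    (measurePreserving_add_right volume (latticeVec n)).quasiMeasurePreserving.ae h
  filter_upwards [ae_all_iff.2 h2] with y hy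
  obtain ⟨n, hn⟩ := exists_torusSection_toTorus y
  have h3 := hy n (hn ▸ torusSection_mem_cell _) (-n)
  have h4 : y + latticeVec n + latticeVec (-n) = y := by
    simp [latticeVec]
    module
  rwa [h4] at h3

theorem ae_toTorus_of_ae {P : Torus → Prop} (h : ∀ᵐ x ∂torusMeasure, P x) :
    ∀ᵐ y : Plane, P (toTorus y) := by
  refine ae_of_ae_cell_translate ?_
  simp only [toTorus_add_latticeVec, forall_const]
  refine ae_of_ae_map measurable_toTorus.aemeasurable ?_
  rw [map_toTorus_restrict_cell.1]
  exact Measure.ae_smul_measure h _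

theorem quasiMeasurePreserving_toTorus :
    Measure.QuasiMeasurePreserving toTorus volume torusMeasure := by
  refine ⟨measurable_toTorus, Measure.AbsolutelyContinuous.mk fun s hs h0 => ?_⟩
  rw [Measure.map_apply measurable_toTorus hs]
  have := ae_toTorus_of_ae (measure_eq_zero_iff_ae_notMem.1 h0)
  exact measure_eq_zero_iff_ae_notMem.2 this

theorem ae_of_ae_toTorus {P : Torus → Prop} (h : ∀ᵐ y : Plane, P (toTorus y)) :
    ∀ᵐ x ∂torusMeasure, P x := by
  filter_upwards [quasiMeasurePreserving_torusSection.ae h] with x hx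
  rwa [toTorus_torusSection] at hx

theorem integral_cell_toTorus {F : Torus → ℂ} (hF : AEStronglyMeasurable F torusMeasure) :
    ∫ y in cell, F (toTorus y) = (volume.real cell : ℂ) * ∫ x, F x ∂torusMeasure := by
  rw [← integral_map (φ := toTorus) measurable_toTorus.aemeasurable, map_toTorus_restrict_cell.1,
    integral_smul_measure]
  · rw [Complex.real_smul]
    rfl
  · rw [map_toTorus_restrict_cell.1]
    exact hF.smul_measure _

theorem volumeReal_cell_pos : 0 < volume.real cell :=
  ENNReal.toReal_pos map_toTorus_restrict_cell.2.1 map_toTorus_restrict_cell.2.2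

end

end FracHoneycomb

namespace FracHoneycomb

noncomputable section

open UnitAddTorus

/-! ### Bloch functions and their Fourier coefficients -/

/-- The Fourier basis of the square integrable functions on the torus. -/
def torusBasis : HilbertBasis (Fin 2 → ℤ) ℂ (Lp ℂ 2 torusMeasure) := mFourierBasis

theorem torusBasis_repr (f : Lp ℂ 2 torusMeasure) (m : Fin 2 → ℤ) :
    torusBasis.repr f m = ∫ x, mFourier (-m) x * f x ∂torusMeasure :=
  mFourierBasis_repr f m

theorem torusBasis_apply (m : Fin 2 → ℤ) : torusBasis m =ᵐ[torusMeasure] mFourier m := by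
  have h : torusBasis m = mFourierLp 2 m := congrFun coe_mFourierBasis m
  rw [h]
  exact coeFn_mFourierLp 2 m

/-- The function `y ↦ e^{i k·y}`. -/
def phase (k y : Plane) : ℂ := Complex.exp (Complex.I * (inner ℝ k y : ℝ))

theorem norm_phase (k y : Plane) : ‖phase k y‖ = 1 := by
  rw [phase, mul_comm, Complex.norm_exp_ofReal_mul_I]

theorem continuous_phase (k : Plane) : Continuous (phase k) := by
  unfold phase
  fun_prop

theorem phase_add_left (k k' y : Plane) : phase (k + k') y = phase k y * phase k' y := by
  rw [phase, phase, phase, ← Complex.exp_add, inner_add_left]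
  push_cast
  ring_nf

theorem phase_add_right (k x y : Plane) : phase k (x + y) = phase k x * phase k y := by
  rw [phase, phase, phase, ← Complex.exp_add, inner_add_right]
  push_cast
  ring_nf

theorem phase_neg_right (k y : Plane) : phase k (-y) = starRingEnd ℂ (phase k y) := by
  rw [phase, phase, ← Complex.exp_conj, inner_neg_right]
  simp

theorem phase_neg_left (k y : Plane) : phase (-k) y = starRingEnd ℂ (phase k y) := by
  rw [phase, phase, ← Complex.exp_conj, inner_neg_left]
  simp

theorem conj_phase_mul_phase (k y : Plane) : starRingEnd ℂ (phase k y) * phase k y = 1 := by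
  rw [← Complex.normSq_eq_conj_mul_self, Complex.normSq_eq_norm_sq, norm_phase]
  simp

theorem phase_dualVec (m : Fin 2 → ℤ) (y : Plane) : phase (dualVec m) y = mFourier m (toTorus y) := by
  have h : mFourier m (toTorus y) = fourier (m 0) (planeCoord y 0 : UnitAddCircle) *
      fourier (m 1) (planeCoord y 1 : UnitAddCircle) := by
    simp only [mFourier, ContinuousMap.coe_mk, Fin.prod_univ_two, toTorus]
  rw [h, fourier_coe_apply, fourier_coe_apply, ← Complex.exp_add, phase, inner_dualVec]
  congr 1
  push_cast
  ring

theorem planeWave_eq (k : Plane) (m : Fin 2 → ℤ) (y : Plane) :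
    planeWave k m y = phase k y * mFourier m (toTorus y) := by
  rw [← phase_dualVec, ← phase_add_left]
  rfl

/-- The quasi-periodic function on the plane with periodic part `F`. -/
def blochLift (k : Plane) (F : Torus → ℂ) (y : Plane) : ℂ := phase k y * F (toTorus y)

theorem blochLift_congr {k : Plane} {F G : Torus → ℂ} (h : F =ᵐ[torusMeasure] G) :
    blochLift k F =ᵐ[volume] blochLift k G := by
  filter_upwards [ae_toTorus_of_ae h] with y hy
  rw [blochLift, blochLift, hy]

theorem ae_eq_of_blochLift_ae_eq {k : Plane} {F G : Torus → ℂ}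
    (h : blochLift k F =ᵐ[volume] blochLift k G) : F =ᵐ[torusMeasure] G := by
  refine ae_of_ae_toTorus ?_
  filter_upwards [h] with y hy
  refine mul_left_cancel₀ (norm_ne_zero_iff.1 ?_) hy
  rw [norm_phase]
  exact one_ne_zero

theorem aestronglyMeasurable_blochLift {k : Plane} {F : Torus → ℂ}
    (hF : AEStronglyMeasurable F torusMeasure) : AEStronglyMeasurable (blochLift k F) volume :=
  (continuous_phase k).aestronglyMeasurable.mul
    (hF.comp_quasiMeasurePreserving quasiMeasurePreserving_toTorus)

theorem eLpNorm_blochLift {k : Plane} {F : Torus → ℂ} (hF : AEStronglyMeasurable F torusMeasure) :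
    eLpNorm (blochLift k F) 2 (volume.restrict cell) =
      (volume cell) ^ (1 / 2 : ℝ) * eLpNorm F 2 torusMeasure := by
  have h1 : eLpNorm (blochLift k F) 2 (volume.restrict cell) =
      eLpNorm (F ∘ toTorus) 2 (volume.restrict cell) := by
    refine eLpNorm_congr_norm_ae (Eventually.of_forall fun y => ?_)
    rw [blochLift, norm_mul, norm_phase, one_mul]
    rfl
  rw [h1, ← eLpNorm_map_measure _ measurable_toTorus.aemeasurable, map_toTorus_restrict_cell.1,
    eLpNorm_smul_measure_of_ne_top (by norm_num)]
  · simp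
  · rw [map_toTorus_restrict_cell.1]
    exact hF.smul_measure _

theorem blochLift_add_latticeVec (k : Plane) (F : Torus → ℂ) (n : Fin 2 → ℤ) (y : Plane) :
    blochLift k F (y + latticeVec n) =
      Complex.exp (Complex.I * (inner ℝ k (latticeVec n) : ℝ)) * blochLift k F y := by
  rw [blochLift, blochLift, toTorus_add_latticeVec, phase_add_right]
  change phase k y * phase k (latticeVec n) * _ = phase k (latticeVec n) * (_ * _)
  ring

theorem memL2_blochLift {k : Plane} {F : Torus → ℂ} (hF : MemLp F 2 torusMeasure) :
    MemL2 k (blochLift k F) := by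
  refine ⟨⟨(aestronglyMeasurable_blochLift hF.1).restrict, ?_⟩,
    fun n => Eventually.of_forall (blochLift_add_latticeVec k F n)⟩
  rw [eLpNorm_blochLift hF.1]
  refine ENNReal.mul_lt_top (ENNReal.rpow_lt_top_of_nonneg (by norm_num) ?_) hF.2
  exact map_toTorus_restrict_cell.2.2

/-- The function `e^{-ik·y} f` is periodic almost everywhere, and its values on the cell define `F`.
Countability of the lattice allows a single null set for all translations. -/
theorem MemL2.exists_blochLift {k : Plane} {f : Plane → ℂ} (hf : MemL2 k f) :
    ∃ F : Torus → ℂ, MemLp F 2 torusMeasure ∧ f =ᵐ[volume] blochLift k F := by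
  have hg : MemLp (fun y => phase (-k) y * f y) 2 (volume.restrict cell) := by
    refine (memLp_congr_norm ((continuous_phase _).aestronglyMeasurable.mul hf.1.1) hf.1.1
      (Eventually.of_forall fun y => ?_)).2 hf.1
    rw [Pi.mul_apply, norm_mul, norm_phase, one_mul]
  refine ⟨(fun y => phase (-k) y * f y) ∘ torusSection,
    (hg.smul_measure (ENNReal.inv_ne_top.2 map_toTorus_restrict_cell.2.1)).comp_measurePreserving
      measurePreserving_torusSection, ?_⟩
  filter_upwards [ae_all_iff.2 hf.2] with y hy
  obtain ⟨n, hn⟩ := exists_torusSection_toTorus y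
  rw [blochLift, Function.comp_apply, hn, hy n, phase_add_right]
  have h1 : phase (-k) (latticeVec n) * phase k (latticeVec n) = 1 := by
    rw [phase_neg_left, conj_phase_mul_phase]
  have h2 : phase k y * phase (-k) y = 1 := by
    rw [phase_neg_left, mul_comm, conj_phase_mul_phase]
  change f y = phase k y * (phase (-k) y * phase (-k) (latticeVec n) *
    (phase k (latticeVec n) * f y))
  linear_combination (-f y * phase (-k) (latticeVec n) * phase k (latticeVec n)) * h2 - f y * h1

/-- The Bloch function with given Fourier coefficients. -/
def bloch (k : Plane) (u : SeqL2 (Fin 2 → ℤ)) : Plane → ℂ :=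
  blochLift k (torusBasis.repr.symm u)

theorem memL2_bloch (k : Plane) (u : SeqL2 (Fin 2 → ℤ)) : MemL2 k (bloch k u) :=
  memL2_blochLift (Lp.memLp _)

/-- A Bloch function is determined by the Fourier coefficients of its periodic part. -/
theorem blochLift_ae_eq_bloch {k : Plane} {F : Torus → ℂ} (hF : MemLp F 2 torusMeasure)
    {u : SeqL2 (Fin 2 → ℤ)} (hu : ∀ m, ∫ x, mFourier (-m) x * F x ∂torusMeasure = u m) :
    blochLift k F =ᵐ[volume] bloch k u := by
  have h : torusBasis.repr hF.toLp = u := by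
    ext m
    rw [torusBasis_repr, ← hu m]
    refine integral_congr_ae ?_
    filter_upwards [hF.coeFn_toLp] with x hx
    rw [hx]
  rw [bloch, ← h, LinearIsometryEquiv.symm_apply_apply]
  exact blochLift_congr hF.coeFn_toLp.symm

theorem MemL2.exists_bloch {k : Plane} {f : Plane → ℂ} (hf : MemL2 k f) :
    ∃ u, f =ᵐ[volume] bloch k u := by
  obtain ⟨F, hF, hfF⟩ := hf.exists_blochLift
  exact ⟨torusBasis.repr hF.toLp, hfF.trans (blochLift_ae_eq_bloch hF fun m => by
    rw [torusBasis_repr]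
    refine integral_congr_ae ?_
    filter_upwards [hF.coeFn_toLp] with x hx
    rw [hx])⟩

theorem bloch_injective {k : Plane} {u w : SeqL2 (Fin 2 → ℤ)}
    (h : bloch k u =ᵐ[volume] bloch k w) : u = w :=
  torusBasis.repr.symm.injective (Lp.ext (ae_eq_of_blochLift_ae_eq h))

theorem bloch_add (k : Plane) (u w : SeqL2 (Fin 2 → ℤ)) :
    bloch k (u + w) =ᵐ[volume] fun y => bloch k u y + bloch k w y := by
  rw [bloch, map_add]
  filter_upwards [blochLift_congr (k := k) (Lp.coeFn_add (torusBasis.repr.symm u) (torusBasis.repr.symm w))]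
    with y hy
  rw [hy, blochLift, Pi.add_apply, mul_add]
  rfl

theorem bloch_smul (k : Plane) (c : ℂ) (u : SeqL2 (Fin 2 → ℤ)) :
    bloch k (c • u) =ᵐ[volume] fun y => c * bloch k u y := by
  rw [bloch, map_smul]
  filter_upwards [blochLift_congr (k := k) (Lp.coeFn_smul c (torusBasis.repr.symm u))] with y hy
  rw [hy, blochLift, Pi.smul_apply, smul_eq_mul, bloch, blochLift]
  ring

theorem bloch_zero (k : Plane) : bloch k 0 =ᵐ[volume] 0 := by
  have := bloch_smul k 0 0
  rw [smul_zero] at this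
  filter_upwards [this] with y hy
  rw [hy, zero_mul]
  rfl

theorem fourierCoeffAt_congr {k : Plane} {f g : Plane → ℂ} (h : f =ᵐ[volume] g) (m : Fin 2 → ℤ) :
    fourierCoeffAt k m f = fourierCoeffAt k m g := by
  unfold fourierCoeffAt
  congr 1
  refine integral_congr_ae ?_
  filter_upwards [ae_restrict_of_ae h] with y hy
  rw [hy]

theorem cellInner_congr {f f' g g' : Plane → ℂ} (h : f =ᵐ[volume] f') (h' : g =ᵐ[volume] g') :
    cellInner f g = cellInner f' g' := by
  unfold cellInner
  refine integral_congr_ae ?_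
  filter_upwards [ae_restrict_of_ae h, ae_restrict_of_ae h'] with y hy hy'
  rw [hy, hy']

/-- The phases cancel, so the coefficient at `k + m·k` is the torus coefficient of the periodic
part; the factor `|Ω|⁻¹` matches the probability measure. -/
theorem fourierCoeffAt_bloch (k : Plane) (u : SeqL2 (Fin 2 → ℤ)) (m : Fin 2 → ℤ) :
    fourierCoeffAt k m (bloch k u) = u m := by
  have h1 : ∀ y, Complex.exp (-(Complex.I * (inner ℝ (k + dualVec m) y : ℝ))) * bloch k u y =
      (fun x => mFourier (-m) x * torusBasis.repr.symm u x) (toTorus y) := fun y => by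
    have h2 : Complex.exp (-(Complex.I * (inner ℝ (k + dualVec m) y : ℝ))) =
        phase (-k) y * mFourier (-m) (toTorus y) := by
      rw [mFourier_neg, ← phase_dualVec, ← phase_neg_left, ← phase_add_left, phase]
      congr 1
      rw [← neg_add, inner_neg_left]
      push_cast
      ring
    rw [h2, bloch, blochLift, phase_neg_left]
    linear_combination (mFourier (-m) (toTorus y) * torusBasis.repr.symm u (toTorus y)) *
      conj_phase_mul_phase k y
  have h2 := integral_cell_toTorus ((mFourier (-m)).continuous.aestronglyMeasurable.mul
    (Lp.aestronglyMeasurable (torusBasis.repr.symm u)))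
  have h3 : (volume.real cell : ℂ) ≠ 0 := by exact_mod_cast volumeReal_cell_pos.ne'
  unfold fourierCoeffAt
  rw [integral_congr_ae (Eventually.of_forall h1), inv_mul_eq_iff_eq_mul₀ h3]
  refine h2.trans ?_
  congr 1
  refine (torusBasis_repr _ m).symm.trans ?_
  rw [LinearIsometryEquiv.apply_symm_apply]

/-- Parseval's identity. The factor `|Ω|` remains because the torus carries a probability measure;
it is the reason for the later rescaling by `√|Ω|`. -/
theorem cellInner_bloch (k : Plane) (u w : SeqL2 (Fin 2 → ℤ)) :
    cellInner (bloch k u) (bloch k w) = (volume.real cell : ℂ) * inner ℂ u w := by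
  have h1 : ∀ y, starRingEnd ℂ (bloch k u y) * bloch k w y =
      (fun x => starRingEnd ℂ (torusBasis.repr.symm u x) * torusBasis.repr.symm w x)
        (toTorus y) := fun y => by
    rw [bloch, bloch, blochLift, blochLift, map_mul]
    linear_combination (starRingEnd ℂ (torusBasis.repr.symm u (toTorus y)) *
      torusBasis.repr.symm w (toTorus y)) * conj_phase_mul_phase k y
  have h2 := integral_cell_toTorus ((Lp.aestronglyMeasurable (torusBasis.repr.symm u)).star.mul
    (Lp.aestronglyMeasurable (torusBasis.repr.symm w)))
  unfold cellInner
  rw [integral_congr_ae (Eventually.of_forall h1)]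
  refine h2.trans ?_
  congr 1
  rw [← torusBasis.repr.symm.inner_map_map u w, L2.inner_def]
  refine integral_congr_ae (Eventually.of_forall fun x => ?_)
  simp only [RCLike.inner_apply, Pi.mul_apply, Pi.star_apply, RCLike.star_def]
  ring

theorem bloch_eq_sum (k : Plane) (s : Finset (Fin 2 → ℤ)) (c : (Fin 2 → ℤ) → ℂ) :
    (fun y => ∑ m ∈ s, c m * planeWave k m y) =ᵐ[volume]
      bloch k (torusBasis.repr (∑ m ∈ s, c m • torusBasis m)) := by
  rw [bloch, LinearIsometryEquiv.symm_apply_apply]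
  have h1 : (fun y => ∑ m ∈ s, c m * planeWave k m y) =
      blochLift k (fun x => ∑ m ∈ s, c m * mFourier m x) := by
    ext y
    rw [blochLift, Finset.mul_sum]
    refine Finset.sum_congr rfl fun m _ => ?_
    rw [planeWave_eq]
    ring
  rw [h1]
  refine blochLift_congr ?_
  have h2 : ∀ m, (c m • torusBasis m : Lp ℂ 2 torusMeasure) =ᵐ[torusMeasure]
      fun x => c m * mFourier m x := fun m => by
    filter_upwards [Lp.coeFn_smul (c m) (torusBasis m), torusBasis_apply m] with x hx hx'
    rw [hx, Pi.smul_apply, hx', smul_eq_mul]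
  filter_upwards [Lp.coeFn_fun_finsetSum s (fun m => c m • torusBasis m), ae_all_iff.2 h2]
    with x hx hx'
  rw [hx]
  exact Finset.sum_congr rfl fun m _ => (hx' m).symm

theorem eLpNorm_bloch (k : Plane) (u : SeqL2 (Fin 2 → ℤ)) :
    eLpNorm (bloch k u) 2 (volume.restrict cell) = (volume cell) ^ (1 / 2 : ℝ) * ‖u‖ₑ := by
  rw [bloch, eLpNorm_blochLift (Lp.aestronglyMeasurable _), ← Lp.enorm_def,
    LinearIsometryEquiv.enorm_map]

theorem hasFourierSeries_bloch (k : Plane) (u : SeqL2 (Fin 2 → ℤ)) :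
    HasFourierSeries k u (bloch k u) := by
  refine ⟨memL2_bloch k u, ?_⟩
  have h1 : ∀ s : Finset (Fin 2 → ℤ),
      eLpNorm (fun y => bloch k u y - ∑ m ∈ s, u m * planeWave k m y) 2 (volume.restrict cell) =
      (volume cell) ^ (1 / 2 : ℝ) *
        ‖u + (-1 : ℂ) • torusBasis.repr (∑ m ∈ s, u m • torusBasis m)‖ₑ := fun s => by
    rw [← eLpNorm_bloch k]
    refine eLpNorm_congr_ae (ae_restrict_of_ae ?_)
    filter_upwards [bloch_eq_sum k s u,
      bloch_add k u ((-1 : ℂ) • torusBasis.repr (∑ m ∈ s, u m • torusBasis m)),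
      bloch_smul k (-1) (torusBasis.repr (∑ m ∈ s, u m • torusBasis m))] with y h1 h2 h3
    rw [h2, h3, h1]
    ring
  simp only [h1]
  have h2 : Tendsto (fun s : Finset (Fin 2 → ℤ) =>
      u + (-1 : ℂ) • torusBasis.repr (∑ m ∈ s, u m • torusBasis m)) atTop (𝓝 0) := by
    have h3 : Tendsto (fun s : Finset (Fin 2 → ℤ) => ∑ m ∈ s, u m • torusBasis m) atTop
        (𝓝 (torusBasis.repr.symm u)) := torusBasis.hasSum_repr_symm u
    have h4 := ((torusBasis.repr.continuous.tendsto _).comp h3).const_smul (-1 : ℂ) |>.const_add u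
    simpa using h4
  have h3 := h2.enorm
  rw [enorm_zero] at h3
  have h4 := ENNReal.Tendsto.const_mul h3 (a := (volume cell) ^ (1 / 2 : ℝ))
    (Or.inr (ENNReal.rpow_lt_top_of_nonneg (by norm_num) map_toTorus_restrict_cell.2.2).ne)
  rwa [mul_zero] at h4

/-- Uniqueness of the `L²` limit of the partial sums. It identifies the function that
`fourierSeries` picks by choice, up to a null set. -/
theorem HasFourierSeries.ae_eq_bloch {k : Plane} {u : SeqL2 (Fin 2 → ℤ)} {f : Plane → ℂ}
    (hf : HasFourierSeries k u f) : f =ᵐ[volume] bloch k u := by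
  obtain ⟨w, hw⟩ := hf.1.exists_bloch
  suffices h : w = u by rwa [h] at hw
  have hwu := (hasFourierSeries_bloch k u).2
  have h1 : ∀ s : Finset (Fin 2 → ℤ), (volume cell) ^ (1 / 2 : ℝ) * ‖w + (-1 : ℂ) • u‖ₑ ≤
      eLpNorm (fun y => f y - ∑ m ∈ s, u m * planeWave k m y) 2 (volume.restrict cell) +
      eLpNorm (fun y => bloch k u y - ∑ m ∈ s, u m * planeWave k m y) 2
        (volume.restrict cell) := fun s => by
    have hsum : AEStronglyMeasurable (fun y => ∑ m ∈ s, u m * planeWave k m y)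
        (volume.restrict cell) :=
      ((memL2_bloch k _).1.1.congr (ae_restrict_of_ae (bloch_eq_sum k s u).symm))
    rw [← eLpNorm_bloch k, eLpNorm_congr_ae (g := (fun y => f y - ∑ m ∈ s, u m * planeWave k m y) -
      fun y => bloch k u y - ∑ m ∈ s, u m * planeWave k m y)]
    · exact eLpNorm_sub_le (hf.1.1.1.sub hsum) ((memL2_bloch k u).1.1.sub hsum) (by norm_num)
    · refine ae_restrict_of_ae ?_
      filter_upwards [hw, bloch_add k w ((-1 : ℂ) • u), bloch_smul k (-1) u] with y h1 h2 h3
      rw [Pi.sub_apply, h2, h3, h1]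
      ring
  have h2 := ge_of_tendsto' (hf.2.add hwu) h1
  rw [add_zero, nonpos_iff_eq_zero, mul_eq_zero] at h2
  rcases h2 with h2 | h2
  · rw [ENNReal.rpow_eq_zero_iff] at h2
    rcases h2 with h2 | h2
    · exact absurd h2.1 map_toTorus_restrict_cell.2.1
    · norm_num at h2
  · rw [enorm_eq_zero, neg_one_smul, ← sub_eq_add_neg, sub_eq_zero] at h2
    exact h2

theorem fourierSeries_ae_eq_bloch (k : Plane) (u : SeqL2 (Fin 2 → ℤ)) :
    fourierSeries k u =ᵐ[volume] bloch k u := by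
  have h : ∃ f, HasFourierSeries k u f := ⟨_, hasFourierSeries_bloch k u⟩
  rw [fourierSeries, dif_pos h]
  exact h.choose_spec.ae_eq_bloch

end

end FracHoneycomb

namespace FracHoneycomb

noncomputable section

open UnitAddTorus

/-! ### The potential -/

/-- A periodic continuous potential as a function on the torus. -/
def torusPot (V : Plane → ℝ) (x : Torus) : ℂ := (V (torusSection x) : ℂ)

theorem torusPot_toTorus {V : Plane → ℝ} (hV : IsHoneycomb V) (y : Plane) :
    torusPot V (toTorus y) = V y := by
  obtain ⟨n, hn⟩ := exists_torusSection_toTorus y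
  rw [torusPot, hn, hV.periodic]

theorem memLp_torusPot {V : Plane → ℝ} (hV : IsHoneycomb V) : MemLp (torusPot V) ⊤ torusMeasure := by
  have hc : Continuous V := hV.smooth.continuous
  obtain ⟨C, hC⟩ := isCompact_cell.exists_bound_of_continuousOn hc.continuousOn
  refine memLp_top_of_bound ?_ C (Eventually.of_forall fun x => ?_)
  · exact (Complex.measurable_ofReal.comp
      (hc.measurable.comp measurable_torusSection)).aestronglyMeasurable
  · rw [torusPot, Complex.norm_real]
    exact hC _ (torusSection_mem_cell x)

/-- Multiplication by the potential, acting on Fourier coefficients. -/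
def potOp {V : Plane → ℝ} (hV : IsHoneycomb V) : SeqL2 (Fin 2 → ℤ) →L[ℂ] SeqL2 (Fin 2 → ℤ) :=
  (torusBasis.repr.toContinuousLinearEquiv : Lp ℂ 2 torusMeasure →L[ℂ] SeqL2 (Fin 2 → ℤ)).comp
    (((ContinuousLinearMap.mul ℂ ℂ).holderL torusMeasure ⊤ 2 2 (memLp_torusPot hV).toLp).comp
      (torusBasis.repr.symm.toContinuousLinearEquiv : SeqL2 (Fin 2 → ℤ) →L[ℂ] Lp ℂ 2 torusMeasure))

theorem symm_potOp {V : Plane → ℝ} (hV : IsHoneycomb V) (u : SeqL2 (Fin 2 → ℤ)) :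
    (torusBasis.repr.symm (potOp hV u) : Torus → ℂ) =ᵐ[torusMeasure]
      fun x => torusPot V x * torusBasis.repr.symm u x := by
  have h : torusBasis.repr.symm (potOp hV u) = (ContinuousLinearMap.mul ℂ ℂ).holder 2
      (memLp_torusPot hV).toLp (torusBasis.repr.symm u) :=
    torusBasis.repr.symm_apply_apply _
  rw [h]
  filter_upwards [(ContinuousLinearMap.mul ℂ ℂ).coeFn_holder (r := 2) (memLp_torusPot hV).toLp
    (torusBasis.repr.symm u), (memLp_torusPot hV).coeFn_toLp] with x h1 h2
  rw [h1, h2]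
  rfl

/-- A periodic potential acts on the periodic part alone. One operator on sequences therefore serves
every `k`, and `k` enters the problem only through the symbol. -/
theorem bloch_potOp {V : Plane → ℝ} (hV : IsHoneycomb V) (k : Plane) (u : SeqL2 (Fin 2 → ℤ)) :
    bloch k (potOp hV u) =ᵐ[volume] fun y => (V y : ℂ) * bloch k u y := by
  filter_upwards [blochLift_congr (k := k) (symm_potOp hV u)] with y hy
  rw [bloch, hy, blochLift, torusPot_toTorus hV, bloch, blochLift]
  ring

theorem isSymmetric_potOp {V : Plane → ℝ} (hV : IsHoneycomb V) : (potOp hV).IsSymmetric := by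
  intro u w
  change inner ℂ (potOp hV u) w = inner ℂ u (potOp hV w)
  rw [← torusBasis.repr.symm.inner_map_map (potOp hV u), ← torusBasis.repr.symm.inner_map_map u,
    L2.inner_def, L2.inner_def]
  refine integral_congr_ae ?_
  filter_upwards [symm_potOp hV u, symm_potOp hV w] with x h1 h2
  rw [h1, h2, RCLike.inner_apply, RCLike.inner_apply, map_mul, torusPot, Complex.conj_ofReal]
  ring

/-! ### Eigenfunctions and bands in terms of Fourier coefficients -/

/-- The symbol of the fractional Laplacian. -/
def symbol (σ : ℝ) (k : Plane) (m : Fin 2 → ℤ) : ℝ := ‖k + dualVec m‖ ^ σ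

theorem one_add_rpow_le {σ x : ℝ} (hσ : 0 ≤ σ) (hx : 0 ≤ x) :
    (1 + x) ^ σ ≤ 2 ^ σ * (1 + x ^ σ) := by
  have h2 : (0 : ℝ) ≤ 2 ^ σ := by positivity
  have hxσ : 0 ≤ x ^ σ := by positivity
  rcases le_total x 1 with h | h
  · have := Real.rpow_le_rpow (by positivity) (show 1 + x ≤ 2 by linarith) hσ
    nlinarith
  · have := Real.rpow_le_rpow (by positivity) (show 1 + x ≤ 2 * x by linarith) hσ
    rw [Real.mul_rpow (by norm_num) hx] at this
    nlinarith

theorem symbol_sq (σ : ℝ) (k : Plane) (m : Fin 2 → ℤ) :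
    symbol σ k m ^ 2 = (‖k + dualVec m‖ ^ 2) ^ σ := by
  rw [symbol, ← Real.rpow_natCast, ← Real.rpow_natCast, ← Real.rpow_mul (norm_nonneg _),
    ← Real.rpow_mul (norm_nonneg _), mul_comm]

/-- The weights `(1 + |ξ|²)^σ` and `1 + |ξ|^{2σ}` are comparable, so the Sobolev space is exactly
the domain of multiplication by the symbol. -/
theorem memSobolev_bloch_iff {σ : ℝ} (hσ : 0 ≤ σ) (k : Plane) (u : SeqL2 (Fin 2 → ℤ)) :
    MemSobolev σ k (bloch k u) ↔ Memℓp (fun m => (symbol σ k m : ℂ) * u m) 2 := by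
  have hterm : ∀ m, ‖(symbol σ k m : ℂ) * u m‖ ^ 2 = (‖k + dualVec m‖ ^ 2) ^ σ * ‖u m‖ ^ 2 :=
    fun m => by
      rw [norm_mul, Complex.norm_real, mul_pow, Real.norm_eq_abs, sq_abs, symbol_sq]
  simp only [MemSobolev, fourierCoeffAt_bloch, memL2_bloch, true_and, memℓp_two_iff, hterm]
  constructor
  · refine fun h => Summable.of_nonneg_of_le (fun m => by positivity) (fun m => ?_) h
    exact mul_le_mul_of_nonneg_right
      (Real.rpow_le_rpow (by positivity) (by linarith) hσ) (sq_nonneg _)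
  · intro h
    refine Summable.of_nonneg_of_le (fun m => by positivity) (fun m => ?_)
      ((u.hasSum_normSq.summable.add h).mul_left (2 ^ σ))
    rw [← one_add_mul, ← mul_assoc]
    exact mul_le_mul_of_nonneg_right (one_add_rpow_le hσ (sq_nonneg _)) (sq_nonneg _)

theorem fracLaplacian_bloch {σ : ℝ} (k : Plane) {f : Plane → ℂ} {u w : SeqL2 (Fin 2 → ℤ)}
    (hf : f =ᵐ[volume] bloch k u) (hw : ∀ m, w m = (symbol σ k m : ℂ) * u m) :
    fracLaplacian σ k f =ᵐ[volume] bloch k w := by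
  have h : (fun m => ((‖k + dualVec m‖ ^ σ : ℝ) : ℂ) * fourierCoeffAt k m f) = w := by
    ext m
    rw [fourierCoeffAt_congr hf, fourierCoeffAt_bloch, hw]
    rfl
  rw [fracLaplacian, h]
  exact fourierSeries_ae_eq_bloch k w

theorem MemSobolev.congr {σ : ℝ} {k : Plane} {f g : Plane → ℂ} (hf : MemSobolev σ k f)
    (h : f =ᵐ[volume] g) : MemSobolev σ k g := by
  refine ⟨⟨hf.1.1.ae_eq (ae_restrict_of_ae h), fun n => ?_⟩, ?_⟩
  · have h' := (measurePreserving_add_right (volume : Measure Plane)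
      (latticeVec n)).quasiMeasurePreserving.ae h
    filter_upwards [hf.1.2 n, h, h'] with y h1 h2 h3
    rw [← h3, h1, h2]
  · simpa only [fourierCoeffAt_congr h] using hf.2

/-- Eigenfunctions in terms of Fourier coefficients. -/
theorem isEigenfunction_iff {σ : ℝ} (hσ : 0 ≤ σ) {V : Plane → ℝ} (hV : IsHoneycomb V) {k : Plane}
    {E : ℝ} {f : Plane → ℂ} :
    IsEigenfunction σ V k E f ↔
      ∃ u ∈ eig (symbol σ k) (potOp hV) E, u ≠ 0 ∧ f =ᵐ[volume] bloch k u := by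
  constructor
  · rintro ⟨hS, h0, heq⟩
    obtain ⟨u, hu⟩ := hS.1.exists_bloch
    have hmem := (memSobolev_bloch_iff hσ k u).1 (hS.congr hu)
    refine ⟨u, ?_, ?_, hu⟩
    · have h1 := fracLaplacian_bloch (σ := σ) k (w := ⟨_, hmem⟩) hu fun m => rfl
      have h2 : (⟨_, hmem⟩ : SeqL2 (Fin 2 → ℤ)) + potOp hV u = (E : ℂ) • u := by
        refine bloch_injective (k := k) ?_
        filter_upwards [heq, h1, hu, bloch_potOp hV k u, bloch_smul k E u,
          bloch_add k ⟨_, hmem⟩ (potOp hV u)] with y h1 h2 h3 h4 h5 h6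
        rw [h6, h5, h4, ← h2, ← h3, h1]
      intro m
      rw [← h2]
      rfl
    · rintro rfl
      exact h0 (hu.trans (bloch_zero k))
  · rintro ⟨u, hu, hu0, hfu⟩
    have himg : ∀ m, ((E : ℂ) • u - potOp hV u) m = (symbol σ k m : ℂ) * u m := fun m =>
      ((mem_eig.1 hu).diag_eq m).symm
    have hmem : Memℓp (fun m => (symbol σ k m : ℂ) * u m) 2 := by
      have h := lp.memℓp ((E : ℂ) • u - potOp hV u)
      rwa [show ⇑((E : ℂ) • u - potOp hV u) = fun m => (symbol σ k m : ℂ) * u m from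
        funext himg] at h
    refine ⟨((memSobolev_bloch_iff hσ k u).2 hmem).congr hfu.symm, fun h => hu0 ?_, ?_⟩
    · exact bloch_injective (hfu.symm.trans (h.trans (bloch_zero k).symm))
    · filter_upwards [fracLaplacian_bloch k hfu himg, hfu, bloch_potOp hV k u,
        bloch_smul k E u, bloch_add k ((E : ℂ) • u - potOp hV u) (potOp hV u)] with y h1 h2 h3 h4 h5
      rw [h1, h2, ← h3, ← h4, ← h5, sub_add_cancel]

theorem aestronglyMeasurable_bloch (k : Plane) (u : SeqL2 (Fin 2 → ℤ)) :
    AEStronglyMeasurable (bloch k u) volume :=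
  aestronglyMeasurable_blochLift (Lp.aestronglyMeasurable _)

/-- The Bloch function with given Fourier coefficients, modulo null functions. -/
def blochLin (k : Plane) : SeqL2 (Fin 2 → ℤ) →ₗ[ℂ] (Plane →ₘ[(volume : Measure Plane)] ℂ) where
  toFun u := AEEqFun.mk (bloch k u) (aestronglyMeasurable_bloch k u)
  map_add' u w := by
    rw [AEEqFun.mk_add_mk, AEEqFun.mk_eq_mk]
    exact bloch_add k u w
  map_smul' c u := by
    refine AEEqFun.ext ?_
    filter_upwards [AEEqFun.coeFn_mk (bloch k (c • u)) (aestronglyMeasurable_bloch k (c • u)),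
      AEEqFun.coeFn_smul c (AEEqFun.mk (bloch k u) (aestronglyMeasurable_bloch k u)),
      AEEqFun.coeFn_mk (bloch k u) (aestronglyMeasurable_bloch k u),
      bloch_smul k c u] with y h1 h2 h3 h4
    rw [h1, RingHom.id_apply, h2, Pi.smul_apply, h3, h4, smul_eq_mul]

theorem coeFn_blochLin (k : Plane) (u : SeqL2 (Fin 2 → ℤ)) :
    blochLin k u =ᵐ[volume] bloch k u := AEEqFun.coeFn_mk _ _

theorem blochLin_injective (k : Plane) : Function.Injective (blochLin k) := fun u w h =>
  bloch_injective ((coeFn_blochLin k u).symm.trans (h ▸ coeFn_blochLin k w))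

theorem eigenspaceUpTo_eq_map {σ : ℝ} (hσ : 0 ≤ σ) {V : Plane → ℝ} (hV : IsHoneycomb V)
    (k : Plane) (E : ℝ) :
    eigenspaceUpTo σ V k E =
      (specOn (symbol σ k) (potOp hV) (Set.Iic E)).map (blochLin k) := by
  refine le_antisymm (Submodule.span_le.2 ?_) (Submodule.map_le_iff_le_comap.2
    (specOn_le_iff.2 fun μ hμ u hu => ?_))
  · rintro Φ ⟨μ, hμ, hΦ⟩
    obtain ⟨u, hu, -, hΦu⟩ := (isEigenfunction_iff hσ hV).1 hΦ
    refine ⟨u, eig_le_specOn (Set.mem_Iic.2 hμ) hu, AEEqFun.ext ?_⟩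
    exact (coeFn_blochLin k u).trans hΦu.symm
  · rw [Submodule.mem_comap]
    by_cases hu0 : u = 0
    · rw [hu0, map_zero]
      exact Submodule.zero_mem _
    · exact Submodule.subset_span ⟨μ, hμ, (isEigenfunction_iff hσ hV).2
        ⟨u, hu, hu0, coeFn_blochLin k u⟩⟩

theorem norm_v₁ : ‖v₁‖ = 1 := by
  rw [EuclideanSpace.norm_eq, Fin.sum_univ_two]
  simp [v₁]
  ring_nf
  norm_num

theorem norm_v₂ : ‖v₂‖ = 1 := by
  rw [EuclideanSpace.norm_eq, Fin.sum_univ_two]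
  simp [v₂]
  ring_nf
  norm_num

theorem inner_dualVec_v₁ (m : Fin 2 → ℤ) : inner ℝ (dualVec m) v₁ = 2 * Real.pi * m 0 := by
  obtain ⟨h1, h2, -, -⟩ := dual_relations
  rw [dualVec, inner_add_left, inner_smul_left, inner_smul_left, real_inner_comm, h1,
    real_inner_comm, h2]
  simp
  ring

theorem inner_dualVec_v₂ (m : Fin 2 → ℤ) : inner ℝ (dualVec m) v₂ = 2 * Real.pi * m 1 := by
  obtain ⟨-, -, h1, h2⟩ := dual_relations
  rw [dualVec, inner_add_left, inner_smul_left, inner_smul_left, real_inner_comm, h1,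
    real_inner_comm, h2]
  simp
  ring

/-- Pairing with the unit vectors `v₁`, `v₂` recovers `2π m₁`, `2π m₂`, so a bound on the norm
leaves finitely many indices. -/
theorem tendsto_norm_dualVec (k : Plane) :
    Tendsto (fun m : Fin 2 → ℤ => ‖k + dualVec m‖) cofinite atTop := by
  refine tendsto_atTop.2 fun R => ?_
  rw [eventually_cofinite]
  obtain ⟨N, hN⟩ := exists_nat_ge (R + ‖k‖)
  refine (Set.finite_Icc (fun _ : Fin 2 => -(N : ℤ)) fun _ => (N : ℤ)).subset fun m hm => ?_
  have h1 : ‖dualVec m‖ ≤ N := by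
    have h2 := norm_sub_le (k + dualVec m) k
    rw [add_sub_cancel_left] at h2
    have h3 : ‖k + dualVec m‖ < R := not_le.1 hm
    linarith
  have key : ∀ (v : Plane) (z : ℤ), ‖v‖ = 1 → inner ℝ (dualVec m) v = 2 * Real.pi * z →
      -(N : ℤ) ≤ z ∧ z ≤ N := fun v z hv hz => by
    have h2 := abs_real_inner_le_norm (dualVec m) v
    rw [hv, mul_one, hz, abs_mul, abs_of_pos Real.two_pi_pos] at h2
    have h3 : |(z : ℝ)| ≤ N := by
      nlinarith [Real.pi_gt_three, abs_nonneg (z : ℝ)]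
    have h4 := abs_le.1 h3
    exact ⟨by exact_mod_cast h4.1, by exact_mod_cast h4.2⟩
  have h3 := key v₁ (m 0) norm_v₁ (inner_dualVec_v₁ m)
  have h4 := key v₂ (m 1) norm_v₂ (inner_dualVec_v₂ m)
  refine ⟨fun i => ?_, fun i => ?_⟩ <;> fin_cases i
  exacts [h3.1, h4.1, h3.2, h4.2]

theorem tendsto_symbol {σ : ℝ} (hσ : 0 < σ) (k : Plane) :
    Tendsto (symbol σ k) cofinite atTop :=
  (tendsto_rpow_atTop hσ).comp (tendsto_norm_dualVec k)

/-- The injective map `blochLin` preserves rank. Finite dimension is essential, since `finrank`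
defaults to `0` otherwise. -/
theorem natCast_le_rank_eigenspaceUpTo_iff {σ : ℝ} (hσ : 0 < σ) {V : Plane → ℝ}
    (hV : IsHoneycomb V) (k : Plane) (E : ℝ) (b : ℕ) :
    (b : Cardinal) ≤ Module.rank ℂ (eigenspaceUpTo σ V k E) ↔
      b ≤ Module.finrank ℂ (specOn (symbol σ k) (potOp hV) (Set.Iic E)) := by
  have := finiteDimensional_specOn (isSymmetric_potOp hV) (tendsto_symbol hσ k) E
  have e := Submodule.equivMapOfInjective (blochLin k) (blochLin_injective k)
    (specOn (symbol σ k) (potOp hV) (Set.Iic E))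
  rw [eigenspaceUpTo_eq_map hσ.le hV, ← e.rank_eq, ← Module.finrank_eq_rank, Nat.cast_le]

theorem band_eq_seqBand {σ : ℝ} (hσ : 0 < σ) {V : Plane → ℝ} (hV : IsHoneycomb V) (b : ℕ)
    (k : Plane) : band σ V b k = seqBand (symbol σ k) (potOp hV) b := by
  unfold band seqBand
  congr 1
  ext E
  exact natCast_le_rank_eigenspaceUpTo_iff hσ hV k E b

end

end FracHoneycomb

namespace FracHoneycomb

noncomputable section

open UnitAddTorus

/-! ### Inversion and conjugation -/

theorem conjInv_congr {f g : Plane → ℂ} (h : f =ᵐ[volume] g) : conjInv f =ᵐ[volume] conjInv g := by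
  filter_upwards [(Measure.measurePreserving_neg (volume : Measure Plane)).quasiMeasurePreserving.ae h]
    with y hy
  rw [conjInv, conjInv, hy]

theorem conjInv_blochLift (k : Plane) (F : Torus → ℂ) :
    conjInv (blochLift k F) = blochLift k fun x => starRingEnd ℂ (F (-x)) := by
  ext y
  rw [conjInv, blochLift, blochLift, map_mul, toTorus_neg, phase_neg_right, Complex.conj_conj]

theorem mFourier_apply_neg (m : Fin 2 → ℤ) (x : Torus) :
    mFourier m (-x) = mFourier (-m) x := by
  rw [← toTorus_torusSection x, ← toTorus_neg, ← phase_dualVec, phase_neg_right, phase_dualVec,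
    mFourier_neg]

instance : torusMeasure.IsNegInvariant :=
  ⟨(AddMonoidHom.measurePreserving (f := negAddMonoidHom (α := Torus)) continuous_neg
    neg_surjective rfl).map_eq⟩

/-- Inversion and complex conjugation each conjugate a plane wave, so together they fix it and
merely conjugate its coefficient. The partner `Φ₂` thus has the conjugate sequence, at the same
quasi-momentum. -/
theorem conjInv_bloch (k : Plane) (u : SeqL2 (Fin 2 → ℤ)) :
    conjInv (bloch k u) =ᵐ[volume] bloch k (star u) := by
  have hneg := Measure.measurePreserving_neg torusMeasure
  rw [bloch, conjInv_blochLift]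
  refine blochLift_ae_eq_bloch
    (((Lp.memLp (torusBasis.repr.symm u)).comp_measurePreserving hneg).star) fun m => ?_
  have h1 : torusBasis.repr (torusBasis.repr.symm u) m = u m := by
    rw [LinearIsometryEquiv.apply_symm_apply]
  rw [lp.star_apply, ← h1, torusBasis_repr, RCLike.star_def, ← integral_conj,
    ← integral_neg_eq_self]
  refine integral_congr_ae (Eventually.of_forall fun x => ?_)
  simp [mFourier_apply_neg, mFourier_neg]

theorem potOp_star {V : Plane → ℝ} (hV : IsHoneycomb V) (u : SeqL2 (Fin 2 → ℤ)) :
    potOp hV (star u) = star (potOp hV u) := by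
  -- Any quasi-momentum would do. The identity comes from `V` being real and even.
  refine bloch_injective (k := 0) ?_
  refine EventuallyEq.trans ?_ (conjInv_bloch 0 (potOp hV u))
  filter_upwards [bloch_potOp hV 0 (star u), conjInv_congr (bloch_potOp hV 0 u),
    conjInv_bloch 0 u] with y h1 h2 h3
  rw [h1, h2, ← h3, conjInv, conjInv, map_mul, Complex.conj_ofReal, hV.even]

theorem star_mem_eig {V : Plane → ℝ} (hV : IsHoneycomb V) {d : (Fin 2 → ℤ) → ℝ} {E : ℝ}
    {u : SeqL2 (Fin 2 → ℤ)} (hu : u ∈ eig d (potOp hV) E) : star u ∈ eig d (potOp hV) E := by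
  rw [mem_eig] at hu ⊢
  intro m
  have h := congrArg (starRingEnd ℂ) (hu m)
  have h1 : ∀ w : SeqL2 (Fin 2 → ℤ), ((E : ℂ) • w) m = (E : ℂ) * w m := fun w => rfl
  rw [h1] at h ⊢
  simpa [potOp_star] using h

/-! ### Rotation -/

theorem rotStar_apply (y : Plane) :
    rotStar y = !₂[-(1 / 2) * y 0 - √3 / 2 * y 1, √3 / 2 * y 0 - 1 / 2 * y 1] := by
  ext i
  fin_cases i <;> simp [rotStar, rotMatrix] <;> ring

/-- The rotation `rotStar` as a linear isometry. -/
def rotStarIsometry : Plane →ₗᵢ[ℝ] Plane where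
  toFun := rotStar
  map_add' x y := by
    simp only [rotStar_apply]
    ext i
    fin_cases i <;> simp <;> ring
  map_smul' c y := by
    simp only [rotStar_apply]
    ext i
    fin_cases i <;> simp <;> ring
  norm_map' y := by
    change ‖rotStar y‖ = ‖y‖
    have h3 : √3 ^ 2 = 3 := Real.sq_sqrt (by norm_num)
    rw [EuclideanSpace.norm_eq, EuclideanSpace.norm_eq, Fin.sum_univ_two, Fin.sum_univ_two,
      rotStar_apply]
    congr 1
    simp only [Real.norm_eq_abs, sq_abs, Matrix.cons_val_zero, Matrix.cons_val_one]
    linear_combination (y 0 ^ 2 / 4 + y 1 ^ 2 / 4) * h3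

theorem norm_rotStar (y : Plane) : ‖rotStar y‖ = ‖y‖ := rotStarIsometry.norm_map y

theorem measurePreserving_rotStar : MeasurePreserving rotStar (volume : Measure Plane) volume :=
  (rotStarIsometry.toLinearIsometryEquiv rfl).measurePreserving

theorem planeCoord_rotStar (y : Plane) :
    planeCoord (rotStar y) = ![planeCoord y 1, -planeCoord y 0 - planeCoord y 1] := by
  have h3 : √3 ≠ 0 := by positivity
  have h3' : √3 ^ 2 = 3 := Real.sq_sqrt (by norm_num)
  rw [planeCoord_apply, rotStar_apply, planeCoord_apply]
  ext i
  fin_cases i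
  · simp
    field_simp
    linear_combination y 0 * h3'
  · simp
    field_simp
    linear_combination -y 0 * h3'

/-- The rotation acting on the torus. -/
def torusRot (x : Torus) : Torus := ![x 1, -x 0 - x 1]

theorem toTorus_rotStar (y : Plane) : toTorus (rotStar y) = torusRot (toTorus y) := by
  ext i
  rw [toTorus, planeCoord_rotStar]
  fin_cases i <;> simp [torusRot, toTorus]

theorem measurePreserving_torusRot : MeasurePreserving torusRot torusMeasure torusMeasure := by
  let f : Torus →+ Torus :=
    { toFun := torusRot
      map_zero' := by
        ext i
        fin_cases i <;> simp [torusRot]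
      map_add' := fun x y => by
        ext i
        fin_cases i
        · rfl
        · simp only [torusRot, Pi.add_apply]
          change -(x 0 + y 0) - (x 1 + y 1) = (-x 0 - x 1) + (-y 0 - y 1)
          abel }
  refine AddMonoidHom.measurePreserving (f := f) ?_ ?_ ?_
  · change Continuous torusRot
    refine continuous_pi fun i => ?_
    fin_cases i
    · exact continuous_apply 1
    · exact (continuous_apply 0).neg.sub (continuous_apply 1)
  · intro x
    refine ⟨![-x 0 - x 1, x 0], ?_⟩
    ext i
    fin_cases i
    · rfl
    · change -(-x 0 - x 1) - x 0 = x 1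
      abel
  · rfl

/-- The action of the rotation on the indices of the dual lattice points `K + Λ*`. -/
def rotIndex : (Fin 2 → ℤ) ≃ (Fin 2 → ℤ) where
  toFun m := ![m 1 - m 0 - 1, -m 0]
  invFun m := ![-m 1, m 0 - m 1 + 1]
  left_inv m := by
    ext i
    fin_cases i
    · simp
    · simp
      ring
  right_inv m := by
    ext i
    fin_cases i
    · simp
      ring
    · simp

theorem rotIndex_apply (m : Fin 2 → ℤ) : rotIndex m = ![m 1 - m 0 - 1, -m 0] := rfl

theorem rotStar_pointK_add (m : Fin 2 → ℤ) :
    rotStar (pointK + dualVec m) = pointK + dualVec (rotIndex m) := by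
  have h3 : √3 ≠ 0 := by positivity
  have h3' : √3 ^ 2 = 3 := Real.sq_sqrt (by norm_num)
  rw [rotStar_apply, rotIndex_apply]
  ext i
  fin_cases i <;> simp [pointK, dualVec, k₁, k₂] <;> field_simp <;> ring_nf <;> rw [h3'] <;> ring

theorem mFourier_torusRot (m : Fin 2 → ℤ) (x : Torus) :
    mFourier (-rotIndex m) (torusRot x) = mFourier (-m) x * mFourier ![0, 1] x := by
  rw [← toTorus_torusSection x, ← toTorus_rotStar, ← phase_dualVec, ← phase_dualVec,
    ← phase_dualVec, ← phase_add_left]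
  simp only [phase, inner_add_left, inner_dualVec, planeCoord_rotStar, rotIndex_apply]
  congr 3
  simp
  ring

/-- This is the relation `R K = K + k₂`: the point `K` is fixed by the rotation modulo the dual
lattice, so rotation acts on `L²_K`. -/
theorem phase_pointK_rotStar (y : Plane) :
    phase pointK (rotStar y) = phase pointK y * mFourier ![0, 1] (toTorus y) := by
  have h3 : √3 ≠ 0 := by positivity
  have h3' : √3 ^ 2 = 3 := Real.sq_sqrt (by norm_num)
  rw [← phase_dualVec, ← phase_add_left, phase, phase]
  congr 3
  simp only [rotStar_apply, PiLp.inner_apply, Fin.sum_univ_two]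
  simp [pointK, dualVec, k₁, k₂]
  field_simp
  ring_nf
  rw [h3']
  ring

/-- Rotation covariance in terms of Fourier coefficients. -/
theorem apply_rotIndex {Φ : Plane → ℂ} {u : SeqL2 (Fin 2 → ℤ)} {c : ℂ}
    (hu : Φ =ᵐ[volume] bloch pointK u) (hΦ : ∀ᵐ y : Plane, Φ (rotStar y) = c * Φ y)
    (m : Fin 2 → ℤ) : u (rotIndex m) = c * u m := by
  set G := torusBasis.repr.symm u with hG
  have h1 : ∀ᵐ x ∂torusMeasure, mFourier ![0, 1] x * G (torusRot x) = c * G x := by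
    refine ae_of_ae_toTorus ?_
    filter_upwards [hu, measurePreserving_rotStar.quasiMeasurePreserving.ae hu, hΦ] with y h1 h2 h3
    rw [h2, h1, bloch, blochLift, blochLift, phase_pointK_rotStar, toTorus_rotStar] at h3
    have h4 : phase pointK y ≠ 0 := norm_ne_zero_iff.1 (by simp [norm_phase])
    refine mul_left_cancel₀ h4 ?_
    rw [← hG] at h3
    linear_combination h3
  have h2 : ∀ n, ∫ x, mFourier (-n) x * G x ∂torusMeasure = u n := fun n => by
    rw [← torusBasis_repr, hG, LinearIsometryEquiv.apply_symm_apply]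
  have h3 : AEStronglyMeasurable (fun x => mFourier (-rotIndex m) x * G x) torusMeasure :=
    (mFourier _).continuous.aestronglyMeasurable.mul (Lp.aestronglyMeasurable _)
  have h4 := integral_map measurePreserving_torusRot.measurable.aemeasurable
    (by rwa [measurePreserving_torusRot.map_eq])
  rw [measurePreserving_torusRot.map_eq] at h4
  rw [← h2, ← h2, ← integral_const_mul, h4]
  refine integral_congr_ae ?_
  filter_upwards [h1] with x hx
  rw [mFourier_torusRot]
  linear_combination mFourier (-m) x * hx

end

end FracHoneycomb

namespace FracHoneycomb

noncomputable section

/-! ### The linearized symbol at `K` -/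

/-- The radial factor of the gradient of the symbol at the dual lattice points `K + Λ*`. -/
def gradWeight (σ : ℝ) (m : Fin 2 → ℤ) : ℝ := σ * ‖pointK + dualVec m‖ ^ (σ - 2)

/-- The derivative of the symbol at `K` in the direction `κ`. -/
def symbolDeriv (σ : ℝ) (κ : Plane) (m : Fin 2 → ℤ) : ℝ :=
  gradWeight σ m * inner ℝ (pointK + dualVec m) κ

/-- The plane as the complex line. -/
def toComplex (y : Plane) : ℂ := ⟨y 0, y 1⟩

theorem toComplex_rotStar (y : Plane) : toComplex (rotStar y) = tau * toComplex y := by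
  have h : tau = ⟨-(1 / 2), √3 / 2⟩ := by
    have h1 : (2 * Real.pi / 3 : ℂ) = ((Real.pi - Real.pi / 3 : ℝ) : ℂ) := by
      push_cast
      ring
    rw [tau, h1, mul_comm]
    apply Complex.ext
    · rw [Complex.exp_ofReal_mul_I_re, Real.cos_pi_sub, Real.cos_pi_div_three]
    · rw [Complex.exp_ofReal_mul_I_im, Real.sin_pi_sub, Real.sin_pi_div_three]
  rw [h, toComplex, toComplex, rotStar_apply]
  apply Complex.ext
  · simp
  · simp
    ring

theorem norm_tau : ‖tau‖ = 1 := by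
  have h : tau = Complex.exp ((2 * Real.pi / 3 : ℝ) * Complex.I) := by
    rw [tau]
    push_cast
    ring_nf
  rw [h, Complex.norm_exp_ofReal_mul_I]

theorem isPrimitiveRoot_tau : IsPrimitiveRoot tau 3 := by
  have h := Complex.isPrimitiveRoot_exp 3 (by norm_num)
  rwa [show (2 * Real.pi * Complex.I / (3 : ℕ) : ℂ) = Complex.I * (2 * Real.pi / 3) by
    push_cast; ring] at h

theorem tau_ne_one : tau ≠ 1 := isPrimitiveRoot_tau.ne_one (by norm_num)

theorem tau_pow_three : tau ^ 3 = 1 := isPrimitiveRoot_tau.pow_eq_one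

theorem conj_tau : starRingEnd ℂ tau = tau ^ 2 := by
  have h1 : starRingEnd ℂ tau * tau = 1 := by
    rw [← Complex.normSq_eq_conj_mul_self, Complex.normSq_eq_norm_sq, norm_tau]
    simp
  linear_combination (-starRingEnd ℂ tau) * tau_pow_three + tau ^ 2 * h1

theorem tau_sq_ne_one : tau ^ 2 ≠ 1 := fun h => tau_ne_one (by
  linear_combination tau_pow_three - tau * h)

/-- Reindexing by the bijection `rotIndex` multiplies the sum by `c ≠ 1` without changing it. This
is the source of every vanishing matrix element. -/
theorem hasSum_zero_of_rotIndex {f : (Fin 2 → ℤ) → ℂ} (hf : Summable f) {c : ℂ} (hc : c ≠ 1)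
    (h : ∀ m, f (rotIndex m) = c * f m) : HasSum f 0 := by
  have h1 : ∑' m, f m = c * ∑' m, f m := by
    rw [← tsum_mul_left, ← rotIndex.tsum_eq]
    exact tsum_congr h
  have h2 : (1 - c) * ∑' m, f m = 0 := by linear_combination h1
  have h3 := (mul_eq_zero.1 h2).resolve_left (sub_ne_zero.2 hc.symm)
  exact h3 ▸ hf.hasSum

theorem gradWeight_rotIndex (σ : ℝ) (m : Fin 2 → ℤ) :
    gradWeight σ (rotIndex m) = gradWeight σ m := by
  rw [gradWeight, ← rotStar_pointK_add, norm_rotStar, gradWeight]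

/-- The pairing with `v₁` is `2π (1/3 + m₁)`, of modulus at least `2π/3`. The points `K + Λ*` thus
stay away from the origin, where the symbol may fail to be smooth. -/
theorem one_le_norm_pointK_add (m : Fin 2 → ℤ) : 1 ≤ ‖pointK + dualVec m‖ := by
  have h1 : inner ℝ (pointK + dualVec m) v₁ = 2 * Real.pi * (1 / 3 + m 0) := by
    obtain ⟨h1, h2, -, -⟩ := dual_relations
    rw [inner_add_left, inner_dualVec_v₁, pointK, inner_smul_left, inner_sub_left, real_inner_comm,
      h1, real_inner_comm, h2]
    simp
    ring
  have h2 := abs_real_inner_le_norm (pointK + dualVec m) v₁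
  rw [norm_v₁, mul_one, h1, abs_mul, abs_of_pos Real.two_pi_pos] at h2
  have h3 : (1 / 3 : ℝ) ≤ |1 / 3 + (m 0 : ℝ)| := by
    rcases le_or_gt 0 (m 0) with h | h
    · have : (0 : ℝ) ≤ m 0 := by exact_mod_cast h
      rw [abs_of_nonneg (by linarith)]
      linarith
    · have : (m 0 : ℝ) ≤ -1 := by exact_mod_cast (by omega : m 0 ≤ -1)
      rw [abs_of_nonpos (by linarith)]
      linarith
  nlinarith [Real.pi_gt_three]

/-- The gradient has size `σ |ξ|^{σ-1}`, dominated by the symbol since `|ξ| ≥ 1`. First order terms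
are thus bounded relative to the operator and its eigenvectors lie in their domain. -/
theorem abs_gradWeight_mul_norm_le {σ : ℝ} (h0 : 0 ≤ σ) (h2 : σ ≤ 2) (m : Fin 2 → ℤ) :
    |gradWeight σ m| * ‖pointK + dualVec m‖ ≤ 2 * symbol σ pointK m := by
  have h1 := one_le_norm_pointK_add m
  have h3 : 0 < ‖pointK + dualVec m‖ := by linarith
  have h4 : ‖pointK + dualVec m‖ ^ (σ - 2) * ‖pointK + dualVec m‖ =
      ‖pointK + dualVec m‖ ^ (σ - 1) := by
    rw [← Real.rpow_add_one h3.ne']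
    ring_nf
  have h5 : ‖pointK + dualVec m‖ ^ (σ - 1) ≤ ‖pointK + dualVec m‖ ^ σ :=
    Real.rpow_le_rpow_of_exponent_le h1 (by linarith)
  rw [gradWeight, abs_of_nonneg (by positivity), mul_assoc, h4, symbol]
  exact mul_le_mul h2 h5 (by positivity) (by norm_num)

theorem abs_symbolDeriv_le {σ : ℝ} (h0 : 0 ≤ σ) (h2 : σ ≤ 2) (κ : Plane) (m : Fin 2 → ℤ) :
    |symbolDeriv σ κ m| ≤ 2 * ‖κ‖ * symbol σ pointK m := by
  rw [symbolDeriv, abs_mul]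
  calc |gradWeight σ m| * |inner ℝ (pointK + dualVec m) κ|
      ≤ |gradWeight σ m| * (‖pointK + dualVec m‖ * ‖κ‖) :=
        mul_le_mul_of_nonneg_left (abs_real_inner_le_norm _ _) (abs_nonneg _)
    _ = |gradWeight σ m| * ‖pointK + dualVec m‖ * ‖κ‖ := by ring
    _ ≤ 2 * symbol σ pointK m * ‖κ‖ :=
        mul_le_mul_of_nonneg_right (abs_gradWeight_mul_norm_le h0 h2 m) (norm_nonneg _)
    _ = 2 * ‖κ‖ * symbol σ pointK m := by ring

/-- Writing `ξ·κ` through `ξ` and `conj ξ` as complex numbers splits the derivative into two parts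
on which the rotation acts by `τ` and `τ²`. -/
theorem symbolDeriv_eq (σ : ℝ) (κ : Plane) (m : Fin 2 → ℤ) :
    (symbolDeriv σ κ m : ℂ) = (gradWeight σ m : ℂ) *
      ((starRingEnd ℂ (toComplex κ) * toComplex (pointK + dualVec m) +
        toComplex κ * starRingEnd ℂ (toComplex (pointK + dualVec m))) / 2) := by
  rw [symbolDeriv, PiLp.inner_apply, Fin.sum_univ_two]
  push_cast
  congr 1
  apply Complex.ext <;> simp [toComplex] <;> ring

theorem exists_gradWeight_mul {σ : ℝ} (h0 : 0 ≤ σ) (h2 : σ ≤ 2)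
    {V : SeqL2 (Fin 2 → ℤ) →L[ℂ] SeqL2 (Fin 2 → ℤ)} {E : ℝ} {u : SeqL2 (Fin 2 → ℤ)}
    (hu : u ∈ eig (symbol σ pointK) V E) (j : Fin 2) :
    ∃ g : SeqL2 (Fin 2 → ℤ),
      ∀ m, g m = ((gradWeight σ m * (pointK + dualVec m) j : ℝ) : ℂ) * u m := by
  refine ⟨⟨_, memℓp_two_of_le (C := 1)
    (lp.memℓp ((2 : ℂ) • ((E : ℂ) • u - V u))) fun m => ?_⟩, fun m => rfl⟩
  have h1 : ((2 : ℂ) • ((E : ℂ) • u - V u)) m = 2 * ((symbol σ pointK m : ℂ) * u m) := by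
    rw [(mem_eig.1 hu).diag_eq m]
    rfl
  have h3 : 0 ≤ symbol σ pointK m := Real.rpow_nonneg (norm_nonneg _) _
  rw [h1, one_mul, norm_mul, norm_mul, norm_mul, Complex.norm_real, Complex.norm_real, ← mul_assoc,
    Real.norm_eq_abs, Real.norm_eq_abs, abs_mul, abs_of_nonneg h3]
  refine mul_le_mul_of_nonneg_right ?_ (norm_nonneg _)
  refine (mul_le_mul_of_nonneg_left (PiLp.norm_apply_le (pointK + dualVec m) j)
    (abs_nonneg _)).trans ((abs_gradWeight_mul_norm_le h0 h2 m).trans (by simp))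

theorem summable_gradWeight_mul {σ : ℝ} (h0 : 0 ≤ σ) (h2 : σ ≤ 2)
    {V : SeqL2 (Fin 2 → ℤ) →L[ℂ] SeqL2 (Fin 2 → ℤ)} {E : ℝ} {u w : SeqL2 (Fin 2 → ℤ)}
    (hu : u ∈ eig (symbol σ pointK) V E) (j : Fin 2) :
    Summable fun m => ((gradWeight σ m * (pointK + dualVec m) j : ℝ) : ℂ) *
      (starRingEnd ℂ (w m) * u m) := by
  obtain ⟨g, hg⟩ := exists_gradWeight_mul h0 h2 hu j
  refine (lp.hasSum_inner w g).summable.congr fun m => ?_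
  rw [hg, RCLike.inner_apply]
  ring

theorem summable_gradWeight_toComplex {σ : ℝ} (h0 : 0 ≤ σ) (h2 : σ ≤ 2)
    {V : SeqL2 (Fin 2 → ℤ) →L[ℂ] SeqL2 (Fin 2 → ℤ)} {E : ℝ} {u w : SeqL2 (Fin 2 → ℤ)}
    (hu : u ∈ eig (symbol σ pointK) V E) :
    (Summable fun m => (gradWeight σ m : ℂ) * toComplex (pointK + dualVec m) *
      (starRingEnd ℂ (w m) * u m)) ∧
    Summable fun m => (gradWeight σ m : ℂ) * starRingEnd ℂ (toComplex (pointK + dualVec m)) *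
      (starRingEnd ℂ (w m) * u m) := by
  have h1 := summable_gradWeight_mul h0 h2 (w := w) hu 0
  have h3 := (summable_gradWeight_mul h0 h2 (w := w) hu 1).mul_left Complex.I
  have h4 : ∀ y : Plane, toComplex y = y 0 + Complex.I * y 1 := fun y => by
    apply Complex.ext <;> simp [toComplex]
  have h5 : ∀ y : Plane, starRingEnd ℂ (toComplex y) = y 0 - Complex.I * y 1 := fun y => by
    apply Complex.ext <;> simp [toComplex]
  refine ⟨(h1.add h3).congr fun m => ?_, (h1.sub h3).congr fun m => ?_⟩
  · rw [h4]
    push_cast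
    ring
  · rw [h5]
    push_cast
    ring

/-- The density `|u|²` is rotation invariant, so the `ξ` and `conj ξ` parts pick up `τ` and `τ²`,
and both sums vanish. -/
theorem hasSum_symbolDeriv_normSq {σ : ℝ} (h0 : 0 ≤ σ) (h2 : σ ≤ 2)
    {V : SeqL2 (Fin 2 → ℤ) →L[ℂ] SeqL2 (Fin 2 → ℤ)} {E : ℝ} {u : SeqL2 (Fin 2 → ℤ)}
    (hu : u ∈ eig (symbol σ pointK) V E) {c : ℂ} (hc : ‖c‖ = 1)
    (hrot : ∀ m, u (rotIndex m) = c * u m) (κ : Plane) :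
    HasSum (fun m => symbolDeriv σ κ m * ‖u m‖ ^ 2) 0 := by
  have hn : ∀ m, starRingEnd ℂ (u (rotIndex m)) * u (rotIndex m) =
      starRingEnd ℂ (u m) * u m := fun m => by
    rw [Complex.conj_mul', Complex.conj_mul', hrot, norm_mul, hc, one_mul]
  obtain ⟨s1, s2⟩ := summable_gradWeight_toComplex h0 h2 (w := u) hu
  have h3 := (hasSum_zero_of_rotIndex s1 tau_ne_one fun m => by
    rw [gradWeight_rotIndex, hn, ← rotStar_pointK_add, toComplex_rotStar]
    ring).mul_left (starRingEnd ℂ (toComplex κ) / 2)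
  have h4 := (hasSum_zero_of_rotIndex s2 tau_sq_ne_one fun m => by
    rw [gradWeight_rotIndex, hn, ← rotStar_pointK_add, toComplex_rotStar, map_mul, conj_tau]
    ring).mul_left (toComplex κ / 2)
  have h5 := h3.add h4
  rw [mul_zero, mul_zero, add_zero] at h5
  rw [← Complex.hasSum_ofReal]
  refine h5.congr_fun fun m => ?_
  push_cast
  rw [symbolDeriv_eq, ← Complex.conj_mul']
  ring

/-- The off-diagonal matrix element of the linearized symbol. -/
theorem hasSum_symbolDeriv_conj_sq {σ : ℝ} (h0 : 0 ≤ σ) (h2 : σ ≤ 2) {V : Plane → ℝ}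
    (hV : IsHoneycomb V) {E : ℝ} {u : SeqL2 (Fin 2 → ℤ)}
    (hu : u ∈ eig (symbol σ pointK) (potOp hV) E)
    (hrot : ∀ m, u (rotIndex m) = tau * u m) {Φ : Plane → ℂ}
    (hΦ : Φ =ᵐ[volume] bloch pointK u) (κ : Plane) :
    HasSum (fun m => (symbolDeriv σ κ m : ℂ) * (starRingEnd ℂ (u m) * (star u) m))
      (-(toComplex κ * starRingEnd ℂ (fermiVelocity σ Φ) / (volume.real cell : ℂ))) := by
  have hsu := star_mem_eig hV hu
  -- Here `(conj τ)² = τ⁴ = τ`. Against this density the `ξ` part acquires `τ²` and sums to zero,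
  -- whereas the `conj ξ` part acquires `τ · τ² = 1` and survives as `Q`.
  have hq : ∀ m, starRingEnd ℂ (u (rotIndex m)) * (star u) (rotIndex m) =
      tau * (starRingEnd ℂ (u m) * (star u) m) := fun m => by
    rw [lp.star_apply, lp.star_apply, RCLike.star_def, hrot, map_mul, conj_tau]
    linear_combination (tau * starRingEnd ℂ (u m) * starRingEnd ℂ (u m)) * tau_pow_three
  obtain ⟨s1, s2⟩ := summable_gradWeight_toComplex h0 h2 (w := u) hsu
  have h3 := hasSum_zero_of_rotIndex s1 tau_sq_ne_one fun m => by
    rw [gradWeight_rotIndex, hq, ← rotStar_pointK_add, toComplex_rotStar]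
    ring
  obtain ⟨Q, hQ⟩ := s2
  have h5 := (h3.mul_left (starRingEnd ℂ (toComplex κ) / 2)).add (hQ.mul_left (toComplex κ / 2))
  have hc : (volume.real cell : ℂ) ≠ 0 := by exact_mod_cast volumeReal_cell_pos.ne'
  -- The minus sign is `i · i`: one factor belongs to `p^σ`, the other to the pairing with `i p^σ`.
  have hw : ∀ (j : Fin 2) (S : ℂ),
      HasSum (fun m => ((gradWeight σ m * (pointK + dualVec m) j : ℝ) : ℂ) *
        (starRingEnd ℂ (u m) * (star u) m)) S →
      cellInner Φ (fun y => Complex.I * momentum σ j (conjInv Φ) y) =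
        -((volume.real cell : ℂ) * S) := fun j S hS => by
    obtain ⟨g, hg⟩ := exists_gradWeight_mul h0 h2 hsu j
    have e1 : momentum σ j (conjInv Φ) = fourierSeries pointK (Complex.I • g : SeqL2 _) := by
      unfold momentum
      congr 1
      ext m
      rw [fourierCoeffAt_congr ((conjInv_congr hΦ).trans (conjInv_bloch _ u)),
        fourierCoeffAt_bloch, lp.coeFn_smul, Pi.smul_apply, hg, gradWeight, smul_eq_mul]
      push_cast
      ring
    have e2 : (fun y => Complex.I * momentum σ j (conjInv Φ) y) =ᵐ[volume]
        bloch pointK (Complex.I • (Complex.I • g)) := by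
      filter_upwards [e1 ▸ fourierSeries_ae_eq_bloch pointK (Complex.I • g),
        bloch_smul pointK Complex.I (Complex.I • g)] with y h1 h2
      rw [h1, h2]
    have e3 : inner ℂ u g = S := (lp.hasSum_inner u g).unique
      (hS.congr_fun fun m => by rw [hg, RCLike.inner_apply]; ring)
    rw [cellInner_congr hΦ e2, cellInner_bloch, smul_smul, Complex.I_mul_I, neg_one_smul,
      inner_neg_right, e3]
    ring
  have hz : ∀ y : Plane, ((y 0 : ℝ) : ℂ) = (toComplex y + starRingEnd ℂ (toComplex y)) / 2 ∧
      ((y 1 : ℝ) : ℂ) = -Complex.I * (toComplex y - starRingEnd ℂ (toComplex y)) / 2 := fun y => by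
    constructor <;> apply Complex.ext <;> simp [toComplex]
  -- Since the `ξ` sum vanishes, the components `(ξ + conj ξ)/2` and `-i (ξ - conj ξ)/2` contribute
  -- `Q / 2` and `i Q / 2`. Pairing with `(1, i)` then adds these up instead of cancelling them.
  have hw0 := hw 0 (Q / 2) (by
    have h := (h3.add hQ).div_const 2
    rw [zero_add] at h
    refine h.congr_fun fun m => ?_
    push_cast
    rw [(hz _).1]
    ring)
  have hw1 := hw 1 (Complex.I * Q / 2) (by
    have h := ((h3.sub hQ).mul_left (-Complex.I)).div_const 2
    rw [zero_sub, neg_mul_neg] at h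
    refine h.congr_fun fun m => ?_
    push_cast
    rw [(hz _).2]
    ring)
  have hF : starRingEnd ℂ (fermiVelocity σ Φ) = -((volume.real cell : ℂ) * (Q / 2)) := by
    rw [fermiVelocity, Fin.sum_univ_two, hw0, hw1]
    simp only [map_mul, map_add, Complex.conj_conj, Matrix.cons_val_zero, Matrix.cons_val_one,
      Complex.conj_I, map_one, map_div₀, map_ofNat]
    linear_combination ((volume.real cell : ℂ) * Q / 4) * Complex.I_mul_I
  have hval : -(toComplex κ * starRingEnd ℂ (fermiVelocity σ Φ) / (volume.real cell : ℂ)) =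
      starRingEnd ℂ (toComplex κ) / 2 * 0 + toComplex κ / 2 * Q := by
    rw [hF]
    field_simp
    ring
  rw [hval]
  refine h5.congr_fun fun m => ?_
  rw [symbolDeriv_eq]
  ring

/-- `Φ₁` and `Φ₂` belong to the different rotation eigenvalues `τ` and `conj τ`. -/
theorem inner_star_eq_zero {u : SeqL2 (Fin 2 → ℤ)} (hrot : ∀ m, u (rotIndex m) = tau * u m) :
    inner ℂ u (star u) = 0 := by
  have h := lp.hasSum_inner (𝕜 := ℂ) u (star u)
  refine h.unique (hasSum_zero_of_rotIndex h.summable tau_ne_one fun m => ?_)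
  rw [RCLike.inner_apply, RCLike.inner_apply, lp.star_apply, lp.star_apply, RCLike.star_def, hrot,
    map_mul, conj_tau]
  linear_combination (tau * starRingEnd ℂ (u m) * starRingEnd ℂ (u m)) * tau_pow_three

end

end FracHoneycomb

namespace FracHoneycomb

/-! ### Bands and eigenvalue counts -/

section Counting

variable {ι : Type*} {d : ι → ℝ} {V : SeqL2 ι →L[ℂ] SeqL2 ι}

-- Vectors supported on `b` fixed indices form a trial space on which `d` acts as a bounded
-- operator, so min-max bounds the `b`-th eigenvalue. Without this the infimum defining a band could
-- be over the empty set.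
open Classical in
theorem exists_le_finrank_specOn [Infinite ι] (hV : V.IsSymmetric)
    (hd : Tendsto d cofinite atTop) (b : ℕ) :
    ∃ E, b ≤ Module.finrank ℂ (specOn d V (Set.Iic E)) := by
  obtain ⟨s, rfl⟩ := Infinite.exists_subset_card_eq ι b
  let T : (s → ℂ) →ₗ[ℂ] SeqL2 ι :=
    ∑ i : s, ((LinearMap.toSpanSingleton ℂ (SeqL2 ι) (lp.single 2 (i : ι) (1 : ℂ))).comp
      (LinearMap.proj i))
  have hT : ∀ c m, T c m = ∑ i : s, c i * (Pi.single (i : ι) (1 : ℂ) : ι → ℂ) m := fun c m => by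
    simp only [T, LinearMap.sum_apply, LinearMap.comp_apply, LinearMap.proj_apply,
      LinearMap.toSpanSingleton_apply, lp.coeFn_sum, Finset.sum_apply, lp.coeFn_smul,
      Pi.smul_apply, smul_eq_mul, lp.coeFn_single]
  have hTs : ∀ c (j : s), T c j = c j := fun c j => by
    rw [hT, Finset.sum_eq_single j]
    · simp
    · intro i _ hij
      rw [Pi.single_eq_of_ne (fun h => hij (Subtype.ext h.symm)), mul_zero]
    · simp
  have hTn : ∀ c m, m ∉ s → T c m = 0 := fun c m hm => by
    rw [hT]
    refine Finset.sum_eq_zero fun i _ => ?_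
    rw [Pi.single_eq_of_ne (fun h : m = i => hm (h ▸ i.2)), mul_zero]
  have hinj : Function.Injective T := fun c c' h => funext fun j => by
    rw [← hTs c, ← hTs c', h]
  have hbd : ∀ m, |if m ∈ s then d m else 0| ≤ ∑ i ∈ s, |d i| := fun m => by
    split_ifs with hm
    · exact Finset.single_le_sum (fun i _ => abs_nonneg (d i)) hm
    · rw [abs_zero]
      exact Finset.sum_nonneg fun i _ => abs_nonneg _
  set D := diagOp _ _ hbd
  have hW : ∀ u ∈ LinearMap.range T, ∃ w, HasImage d V u w ∧
      (inner ℂ u w).re ≤ ‖D + V‖ * ‖u‖ ^ 2 := by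
    rintro u ⟨c, rfl⟩
    refine ⟨(D + V) (T c), fun m => ?_, (le_abs_self _).trans (abs_re_inner_apply_le _ _)⟩
    have h1 : (D + V) (T c) m =
        (((if m ∈ s then d m else 0 : ℝ) : ℂ)) * T c m + V (T c) m := rfl
    rw [h1]
    split_ifs with hm
    · rfl
    · rw [hTn c m hm, mul_zero, mul_zero]
  refine ⟨‖D + V‖, le_trans (le_of_eq ?_) (le_finrank_specOn_of_form_le hV hd (LinearMap.range T) hW)⟩
  rw [LinearMap.finrank_range_of_inj hinj, Module.finrank_fintype_fun_eq_card, Fintype.card_coe]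

theorem finrank_specOn_mono (hV : V.IsSymmetric) (hd : Tendsto d cofinite atTop) {A B : Set ℝ}
    {E : ℝ} (hAB : A ⊆ B) (hB : B ⊆ Set.Iic E) :
    Module.finrank ℂ (specOn d V A) ≤ Module.finrank ℂ (specOn d V B) := by
  have := finiteDimensional_specOn hV hd E
  have := Submodule.finiteDimensional_of_le (specOn_mono (d := d) (V := V) hB)
  exact Submodule.finrank_mono (specOn_mono hAB)

/-- The infimum defining a band is attained. -/
theorem le_finrank_specOn_seqBand [Infinite ι] (hV : V.IsSymmetric)
    (hd : Tendsto d cofinite atTop) (b : ℕ) :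
    b ≤ Module.finrank ℂ (specOn d V (Set.Iic (seqBand d V b))) := by
  obtain ⟨δ, hδ, hgap, -⟩ := exists_spectral_gap hV hd (seqBand d V b)
  obtain ⟨E, hE, hlt⟩ := Real.lt_sInf_add_pos
    (s := {E | b ≤ Module.finrank ℂ (specOn d V (Set.Iic E))})
    (exists_le_finrank_specOn hV hd b) hδ
  rw [← hgap]
  exact le_trans hE (finrank_specOn_mono hV hd (Set.Iic_subset_Iic.2 hlt.le) subset_rfl)

theorem seqBand_le_iff [Infinite ι] (hV : V.IsSymmetric) (hd : Tendsto d cofinite atTop) {b : ℕ}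
    (hb : 1 ≤ b) {E : ℝ} :
    seqBand d V b ≤ E ↔ b ≤ Module.finrank ℂ (specOn d V (Set.Iic E)) :=
  ⟨fun h => (le_finrank_specOn_seqBand hV hd b).trans
    (finrank_specOn_mono hV hd (Set.Iic_subset_Iic.2 h) subset_rfl), seqBand_le hV hd hb⟩

/-- The eigenvalue counts below and up to an isolated pair of coinciding bands. -/
theorem finrank_specOn_of_seqBand_eq [Infinite ι] (hV : V.IsSymmetric)
    (hd : Tendsto d cofinite atTop) {n : ℕ} {E : ℝ} (h₁ : seqBand d V (n + 1) = E)
    (h₂ : seqBand d V (n + 2) = E)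
    (h₃ : ∀ b, 1 ≤ b → b ≠ n + 1 → b ≠ n + 2 → seqBand d V b ≠ E) :
    Module.finrank ℂ (specOn d V (Set.Iio E)) = n ∧
      Module.finrank ℂ (specOn d V (Set.Iic E)) = n + 2 := by
  obtain ⟨δ, hδ, -, hgap⟩ := exists_spectral_gap hV hd E
  have hn2 := (seqBand_le_iff hV hd (by omega)).1 h₂.le
  refine ⟨le_antisymm ?_ ?_, le_antisymm ?_ hn2⟩
  · by_contra! hlt
    rw [hgap] at hlt
    have := seqBand_le hV hd (b := n + 1) (by omega) hlt
    linarith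
  -- For `n = 0` there is no band below: the index `0` carries no eigenvalue and is excluded from
  -- the isolation hypothesis. For `n > 0` isolation makes band `n` strictly smaller than `E`.
  · rcases Nat.eq_zero_or_pos n with rfl | hn
    · exact Nat.zero_le _
    · have h4 : seqBand d V n ≤ E := seqBand_le hV hd hn (by omega)
      have h5 := lt_of_le_of_ne h4 (h₃ n hn (by omega) (by omega))
      exact (le_finrank_specOn_seqBand hV hd n).trans
        (finrank_specOn_mono hV hd (fun x hx => lt_of_le_of_lt hx h5) Set.Iio_subset_Iic_self)
  · by_contra! hlt
    have h4 : seqBand d V (n + 3) ≤ E := seqBand_le hV hd (by omega) hlt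
    have h5 : seqBand d V (n + 2) ≤ seqBand d V (n + 3) := seqBand_le hV hd (by omega)
      ((by omega : n + 2 ≤ n + 3).trans (le_finrank_specOn_seqBand hV hd _))
    exact h₃ (n + 3) (by omega) (by omega) (by omega) (le_antisymm h4 (h₂ ▸ h5))

end Counting

/-! ### Uniform expansion of the symbol at `K` -/

section Expansion

/-- The upper bound is Bernoulli's inequality for exponent `p`. The lower bound follows from
Bernoulli for `1 - p` through `x = x^p x^{1-p}`. No lower bound on `x` beyond `0` is required. -/
theorem abs_rpow_sub_le {p x : ℝ} (hp : 0 < p) (hp1 : p ≤ 1) (hx : 0 ≤ x) :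
    |x ^ p - 1 - p * (x - 1)| ≤ (x - 1) ^ 2 := by
  have h1 : x ^ p ≤ 1 + p * (x - 1) := by
    have := rpow_one_add_le_one_add_mul_self (s := x - 1) (by linarith) hp.le hp1
    rwa [add_sub_cancel] at this
  have h2 : x ^ (1 - p) ≤ 1 + (1 - p) * (x - 1) := by
    have := rpow_one_add_le_one_add_mul_self (s := x - 1) (p := 1 - p) (by linarith)
      (by linarith) (by linarith)
    rwa [add_sub_cancel] at this
  have h3 : x ^ p * x ^ (1 - p) = x := by
    rw [← Real.rpow_add_of_nonneg hx hp.le (by linarith), add_sub_cancel, Real.rpow_one]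
  have h4 : x ≤ x ^ p * (1 + (1 - p) * (x - 1)) :=
    h3.symm.le.trans (mul_le_mul_of_nonneg_left h2 (Real.rpow_nonneg hx p))
  have h5 : 0 < 1 + (1 - p) * (x - 1) := by nlinarith
  have h6 : 1 + p * (x - 1) - (x - 1) ^ 2 ≤ x ^ p := by
    refine le_of_mul_le_mul_right (le_trans ?_ h4) h5
    nlinarith [mul_nonneg (sq_nonneg (x - 1)) (mul_nonneg (by linarith : 0 ≤ 1 - p) hx),
      mul_nonneg (sq_nonneg (x - 1)) (sq_nonneg p)]
  rw [abs_le]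
  constructor
  · linarith
  · nlinarith [sq_nonneg (x - 1)]

/-- With `x = |ξ + κ|² / |ξ|²` the power becomes `|ξ|^σ x^{σ/2}`, to which the scalar estimate with
`p = σ/2 ≤ 1` applies. Uniformity in `ξ` comes from `|ξ|^{σ-2} ≤ 1`. The constant is `9 + 1`: the
`9` squares `|2 ξ·κ + |κ|²| ≤ 3 |ξ||κ|`, and the `1` bounds the quadratic term `σ/2 |κ|²`. -/
theorem abs_norm_rpow_sub_le {F : Type*} [NormedAddCommGroup F] [InnerProductSpace ℝ F] {σ : ℝ}
    (h0 : 0 < σ) (h2 : σ ≤ 2) {ξ κ : F} (hξ : 1 ≤ ‖ξ‖) (hκ : ‖κ‖ ≤ 1) :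
    |‖ξ + κ‖ ^ σ - ‖ξ‖ ^ σ - σ * ‖ξ‖ ^ (σ - 2) * inner ℝ ξ κ| ≤ 10 * ‖κ‖ ^ 2 := by
  set r := ‖ξ‖ with hr
  set t := ‖κ‖ with ht
  have hr0 : 0 < r := by linarith
  have ht0 : 0 ≤ t := norm_nonneg _
  set a := inner ℝ ξ κ with ha
  have hs : ‖ξ + κ‖ ^ 2 = r ^ 2 + (2 * a + t ^ 2) := by rw [norm_add_sq_real]; ring
  set x := ‖ξ + κ‖ ^ 2 / r ^ 2 with hx
  have hx1 : x - 1 = (2 * a + t ^ 2) / r ^ 2 := by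
    rw [hx, hs]
    field_simp
    ring
  have hpow : ∀ y : ℝ, 0 ≤ y → (y ^ 2) ^ (σ / 2) = y ^ σ := fun y hy => by
    rw [← Real.rpow_natCast, ← Real.rpow_mul hy]
    congr 1
    push_cast
    ring
  have hxp : r ^ σ * x ^ (σ / 2) = ‖ξ + κ‖ ^ σ := by
    rw [hx, Real.div_rpow (by positivity) (by positivity), hpow _ (norm_nonneg _), hpow _ hr0.le]
    field_simp
  have hr2 : r ^ σ = r ^ (σ - 2) * r ^ 2 := by
    rw [← Real.rpow_natCast, ← Real.rpow_add hr0]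
    congr 1
    push_cast
    ring
  have hw1 : r ^ (σ - 2) ≤ 1 := Real.rpow_le_one_of_one_le_of_nonpos hξ (by linarith)
  have hw0 : 0 < r ^ (σ - 2) := by positivity
  have key := abs_rpow_sub_le (p := σ / 2) (x := x) (by linarith) (by linarith) (by positivity)
  have hlin : r ^ σ * (σ / 2 * (x - 1)) = r ^ (σ - 2) * (σ * a + σ / 2 * t ^ 2) := by
    rw [hx1, hr2]
    field_simp
  have hid : ‖ξ + κ‖ ^ σ - r ^ σ - σ * r ^ (σ - 2) * a =
      r ^ σ * (x ^ (σ / 2) - 1 - σ / 2 * (x - 1)) + r ^ (σ - 2) * (σ / 2 * t ^ 2) := by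
    linear_combination -hxp + hlin
  have hq : (x - 1) ^ 2 * r ^ 2 ≤ 9 * t ^ 2 := by
    have h1 : |a| ≤ r * t := abs_real_inner_le_norm ξ κ
    have h3 : |2 * a + t ^ 2| ≤ 3 * (r * t) := by
      have h4 : t ^ 2 ≤ r * t := by nlinarith
      have h5 := abs_le.1 h1
      rw [abs_le]
      constructor <;> nlinarith [sq_nonneg t]
    have h4 : (2 * a + t ^ 2) ^ 2 ≤ (3 * (r * t)) ^ 2 := sq_le_sq' (abs_le.1 h3).1 (abs_le.1 h3).2
    rw [hx1, div_pow, div_mul_eq_mul_div, div_le_iff₀ (by positivity)]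
    nlinarith [sq_nonneg r]
  have h1 : |r ^ σ * (x ^ (σ / 2) - 1 - σ / 2 * (x - 1))| ≤ 9 * t ^ 2 := by
    rw [abs_mul, abs_of_pos (by positivity)]
    calc r ^ σ * |x ^ (σ / 2) - 1 - σ / 2 * (x - 1)| ≤ r ^ σ * (x - 1) ^ 2 :=
          mul_le_mul_of_nonneg_left key (by positivity)
      _ = r ^ (σ - 2) * ((x - 1) ^ 2 * r ^ 2) := by rw [hr2]; ring
      _ ≤ 1 * ((x - 1) ^ 2 * r ^ 2) := mul_le_mul_of_nonneg_right hw1 (by positivity)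
      _ ≤ 9 * t ^ 2 := by rwa [one_mul]
  have h3 : |r ^ (σ - 2) * (σ / 2 * t ^ 2)| ≤ t ^ 2 := by
    rw [abs_of_nonneg (by positivity)]
    calc r ^ (σ - 2) * (σ / 2 * t ^ 2) ≤ 1 * (1 * t ^ 2) := by
          refine mul_le_mul hw1 ?_ (by positivity) (by norm_num)
          exact mul_le_mul_of_nonneg_right (by linarith) (sq_nonneg t)
      _ = t ^ 2 := by ring
  rw [hid]
  refine (abs_add_le _ _).trans ?_
  linarith

theorem abs_symbol_sub_le {σ : ℝ} (h0 : 0 < σ) (h2 : σ ≤ 2) {k : Plane}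
    (hk : ‖k - pointK‖ ≤ 1) (m : Fin 2 → ℤ) :
    |symbol σ k m - symbol σ pointK m - symbolDeriv σ (k - pointK) m| ≤
      10 * ‖k - pointK‖ ^ 2 := by
  have h := abs_norm_rpow_sub_le h0 h2 (one_le_norm_pointK_add m) hk
  rwa [show pointK + dualVec m + (k - pointK) = k + dualVec m by abel] at h

end Expansion

end FracHoneycomb

/-! ### The Dirac cone at `K` -/

namespace FracHoneycomb

theorem norm_toComplex (y : Plane) : ‖toComplex y‖ = ‖y‖ := by
  rw [EuclideanSpace.norm_eq, Fin.sum_univ_two, Complex.norm_eq_sqrt_sq_add_sq]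
  simp only [toComplex, Real.norm_eq_abs, sq_abs]

theorem exists_phase_mul_norm (κ : Plane) : ∃ ζ : ℂ, ‖ζ‖ = 1 ∧ -toComplex κ = (‖κ‖ : ℂ) * ζ := by
  by_cases h : toComplex κ = 0
  · refine ⟨1, norm_one, ?_⟩
    rw [← norm_toComplex, h]
    simp
  · have h1 : (‖toComplex κ‖ : ℂ) ≠ 0 := by exact_mod_cast norm_ne_zero_iff.2 h
    refine ⟨-toComplex κ / ‖toComplex κ‖, ?_, ?_⟩
    · rw [norm_div, norm_neg, Complex.norm_real, norm_norm, div_self (norm_ne_zero_iff.2 h)]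
    · rw [← norm_toComplex, mul_div_cancel₀ _ h1]

/-- The two bands meeting at `E` at the point `K` are conical there. -/
theorem exists_conical_bands_pointK {σ : ℝ} (h0 : 0 < σ) (h2 : σ ≤ 2) {V : Plane → ℝ}
    (hV : IsHoneycomb V) {E : ℝ} {n : ℕ}
    (h₁ : band σ V (n + 1) pointK = E) (h₂ : band σ V (n + 2) pointK = E)
    (h₃ : ∀ b, 1 ≤ b → b ≠ n + 1 → b ≠ n + 2 → band σ V b pointK ≠ E)
    {Φ : Plane → ℂ} (hΦ : IsEigenfunction σ V pointK E Φ)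
    (hrot : ∀ᵐ y : Plane, Φ (rotStar y) = tau * Φ y) (hnorm : cellInner Φ Φ = 1)
    {v : ℝ} (hv : fermiVelocity σ Φ = v) (hv0 : 0 ≤ v) :
    ∃ t₀ > 0, ∃ C > 0, ∀ k : Plane, ‖k - pointK‖ < t₀ →
      |band σ V (n + 2) k - E - v * ‖k - pointK‖| ≤ C * ‖k - pointK‖ ^ 2 ∧
        |band σ V (n + 1) k - E + v * ‖k - pointK‖| ≤ C * ‖k - pointK‖ ^ 2 := by
  simp only [band_eq_seqBand h0 hV] at h₁ h₂ h₃ ⊢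
  have hsymm := isSymmetric_potOp hV
  have hd := tendsto_symbol h0 pointK
  obtain ⟨hlt, hle⟩ := finrank_specOn_of_seqBand_eq hsymm hd h₁ h₂ h₃
  obtain ⟨u, hu, -, hΦu⟩ := (isEigenfunction_iff h0.le hV).1 hΦ
  have hurot := apply_rotIndex hΦu hrot
  set c := volume.real cell with hc
  have hc0 : 0 < c := volumeReal_cell_pos
  -- Sequences must be scaled by `√|Ω|` to be normalized in `ℓ²`. The same scaling cancels the area
  -- in the off-diagonal matrix element.
  have hcs : ((√c : ℝ) : ℂ) * ((√c : ℝ) : ℂ) = (c : ℂ) := by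
    rw [← Complex.ofReal_mul, Real.mul_self_sqrt hc0.le]
  have hsu := star_mem_eig hV hu
  have n₁ : (c : ℂ) * inner ℂ u u = 1 := by
    rw [← cellInner_bloch pointK, ← cellInner_congr hΦu hΦu, hnorm]
  have n₂ : inner ℂ (star u) (star u) = inner ℂ u u := by
    rw [inner_self_eq_norm_sq_to_K, inner_self_eq_norm_sq_to_K, norm_star]
  have hinner : ∀ x y : SeqL2 (Fin 2 → ℤ),
      inner ℂ (((√c : ℝ) : ℂ) • x) (((√c : ℝ) : ℂ) • y) = (c : ℂ) * inner ℂ x y := fun x y => by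
    rw [inner_smul_left, inner_smul_right, Complex.conj_ofReal, ← mul_assoc, hcs]
  have hsrot : ∀ m, (star u) (rotIndex m) = starRingEnd ℂ tau * (star u) m := fun m => by
    rw [lp.star_apply, lp.star_apply, hurot, RCLike.star_def, map_mul]
  obtain ⟨t₀, ht₀, C, hC, H⟩ := exists_conical_bands hsymm hd
    (fun m => Real.rpow_nonneg (norm_nonneg _) _)
    (Submodule.smul_mem _ ((√c : ℝ) : ℂ) hu) (Submodule.smul_mem _ ((√c : ℝ) : ℂ) hsu)
    ((hinner u u).trans n₁) ((hinner _ _).trans (n₂ ▸ n₁))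
    -- The constant `M = 10` covers both the relative bound `2 |κ|` on the linear term and the
    -- remainder `10 |κ|²`.
    ((hinner u (star u)).trans (by rw [inner_star_eq_zero hurot, mul_zero])) hlt hle
    (M := 10) (by norm_num) hv0
  refine ⟨min t₀ 1, lt_min ht₀ one_pos, C, hC, fun k hk => ?_⟩
  obtain ⟨ζ, hζ, hζk⟩ := exists_phase_mul_norm (k - pointK)
  have hdiag : ∀ x : SeqL2 (Fin 2 → ℤ),
      HasSum (fun m => symbolDeriv σ (k - pointK) m * ‖x m‖ ^ 2) 0 →
      HasSum (fun m => symbolDeriv σ (k - pointK) m * ‖(((√c : ℝ) : ℂ) • x) m‖ ^ 2) 0 :=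
    fun x hx => by
      have h := hx.mul_left c
      rw [mul_zero] at h
      refine h.congr_fun fun m => ?_
      rw [lp.coeFn_smul, Pi.smul_apply, norm_smul, mul_pow, Complex.norm_real, Real.norm_eq_abs,
        sq_abs, Real.sq_sqrt hc0.le]
      ring
  refine H ‖k - pointK‖ (symbol σ k) (symbolDeriv σ (k - pointK)) ζ (norm_nonneg _)
    (hk.trans_le (min_le_left _ _)) hζ (tendsto_symbol h0 k) (fun m => ?_)
    (abs_symbol_sub_le h0 h2 (hk.trans_le (min_le_right _ _)).le)
    (hdiag u (hasSum_symbolDeriv_normSq h0.le h2 hu norm_tau hurot _))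
    (hdiag _ (hasSum_symbolDeriv_normSq h0.le h2 hsu
      (by rw [RCLike.norm_conj, norm_tau]) hsrot _)) ?_
  · refine (abs_symbolDeriv_le h0.le h2 _ m).trans (mul_le_mul_of_nonneg_right ?_
      (Real.rpow_nonneg (norm_nonneg _) _))
    nlinarith [norm_nonneg (k - pointK)]
  · have h := (hasSum_symbolDeriv_conj_sq h0.le h2 hV hu hurot hΦu (k - pointK)).mul_left (c : ℂ)
    have hc' : (c : ℂ) ≠ 0 := by exact_mod_cast hc0.ne'
    rw [hv, Complex.conj_ofReal, ← hc, mul_neg, mul_div_cancel₀ _ hc', ← neg_mul, hζk] at h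
    rw [show ((v * ‖k - pointK‖ : ℝ) : ℂ) * ζ = (‖k - pointK‖ : ℂ) * ζ * v by push_cast; ring]
    refine h.congr_fun fun m => ?_
    rw [lp.coeFn_smul, lp.coeFn_smul, Pi.smul_apply, Pi.smul_apply, smul_eq_mul, smul_eq_mul,
      map_mul, Complex.conj_ofReal, ← hcs]
    ring

end FracHoneycomb

theorem theorem3p1 (σ : ℝ) (hσ₁ : 1 < σ) (hσ₂ : σ ≤ 2)
    (V : Plane → ℝ) (hV : IsHoneycomb V)
    (E_D : ℝ) (bs : ℕ) (hbs : 1 ≤ bs)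
    (hdeg₁ : band σ V bs pointK = E_D) (hdeg₂ : band σ V (bs + 1) pointK = E_D)
    (hdeg₃ : ∀ b : ℕ, 1 ≤ b → b ≠ bs → b ≠ bs + 1 → band σ V b pointK ≠ E_D)
    (Φ₁ : Plane → ℂ) (hΦ_eig : IsEigenfunction σ V pointK E_D Φ₁)
    (hΦ_rot : ∀ᵐ y : Plane, Φ₁ (rotStar y) = tau * Φ₁ y)
    (hΦ_norm : cellInner Φ₁ Φ₁ = 1)
    (vF : ℝ) (hvF : fermiVelocity σ Φ₁ = (vF : ℂ)) (hvF_pos : 0 < vF) :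
    ∃ q₀ : ℝ, 0 < q₀ ∧ ∃ C : ℝ, 0 < C ∧ ∃ ePlus eMinus : Plane → ℝ,
      ∀ k : Plane, ‖k - pointK‖ < q₀ →
        band σ V (bs + 1) k - E_D = vF * ‖k - pointK‖ * (1 + ePlus (k - pointK)) ∧
        band σ V bs k - E_D = -(vF * ‖k - pointK‖ * (1 + eMinus (k - pointK))) ∧
        |ePlus (k - pointK)| ≤ C * ‖k - pointK‖ ∧
        |eMinus (k - pointK)| ≤ C * ‖k - pointK‖ ∧
        (k ≠ pointK → band σ V bs k < band σ V (bs + 1) k) := by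
  -- Here `n` is the number of eigenvalues strictly below the Dirac energy.
  obtain ⟨n, rfl⟩ : ∃ n, bs = n + 1 := ⟨bs - 1, by omega⟩
  obtain ⟨t₀, ht₀, C, hC, H⟩ := exists_conical_bands_pointK (by linarith) hσ₂ hV hdeg₁ hdeg₂
    hdeg₃ hΦ_eig hΦ_rot hΦ_norm hvF hvF_pos.le
  -- The bound `vF / C` gives `C |κ| < vF`, so the quadratic errors cannot close the splitting `2 vF
  -- |κ|`. The functions `e` are the errors divided by `vF |κ|`; at `κ = 0` the quotient is `0` by
  -- convention.
  refine ⟨min t₀ (vF / C), lt_min ht₀ (by positivity), C / vF, by positivity,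
    fun x => (band σ V (n + 2) (x + pointK) - E_D - vF * ‖x‖) / (vF * ‖x‖),
    fun x => -(band σ V (n + 1) (x + pointK) - E_D + vF * ‖x‖) / (vF * ‖x‖), fun k hk => ?_⟩
  obtain ⟨h1, h2⟩ := H k (hk.trans_le (min_le_left _ _))
  simp only [sub_add_cancel]
  by_cases hkK : k = pointK
  · subst hkK
    simp [hdeg₁, hdeg₂]
  have ht : 0 < ‖k - pointK‖ := norm_pos_iff.2 (sub_ne_zero.2 hkK)
  have htC : C * ‖k - pointK‖ < vF := by
    have := (lt_div_iff₀ hC).1 (hk.trans_le (min_le_right _ _))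
    linarith
  have hquot : ∀ z : ℝ, |z| ≤ C * ‖k - pointK‖ ^ 2 →
      |z / (vF * ‖k - pointK‖)| ≤ C / vF * ‖k - pointK‖ := fun z hz => by
    rw [abs_div, abs_of_pos (by positivity : 0 < vF * ‖k - pointK‖), div_le_iff₀ (by positivity)]
    refine hz.trans (le_of_eq ?_)
    field_simp
  refine ⟨?_, ?_, hquot _ h1, hquot _ (by rwa [abs_neg]), fun _ => ?_⟩
  · field_simp
    ring
  · field_simp
    ring
  · have h3 := (abs_le.1 h1).1
    have h4 := (abs_le.1 h2).2
    change band σ V (n + 1) k < band σ V (n + 2) k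
    nlinarith
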